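/- Consider the one-dimensional Falicov-Kimball model with parameter $U$. For a configuration $\omega\in\{0,1\}^{\mathbb Z}$ of classical particles and a finite interval $\Lambda\subset\mathbb Z$, let $$H_\Lambda(\omega)=-\sum_{x,y\in\Lambda,\ |x-y|=1}a^\dagger_xa_y-U\sum_{x\in\Lambda}\omega_x\,a^\dagger_xa_x$$ act on spinless lattice fermions in $\Lambda$, let $E_\Lambda(N,\omega)$ be its lowest eigenvalue on the $N$-electron space, and for periodic $\omega$ and $\rho_e\in[0,1]$ let $$e(\rho_e,\omega)=\lim_{\Lambda\nearrow\mathbb Z}\tfrac1{|\Lambda|}E_\Lambda(\lfloor\rho_e|\Lambda|\rfloor,\omega),\qquad \rho_c(\omega)=\lim_{\Lambda\nearrow\mathbb Z}\tfrac1{|\Lambda|}\sum_{x\in\Lambda}\omega_x$$ (both limits exist). Let $e(\rho_e,\rho_c)$ be the infimum of $e(\rho_e,\omega)$ over the periodic $\omega$ with $\rho_c(\omega)=\rho_c$. A mixture consists of finitely many periodic configurations $\omega^{(i)}$ with weights $\alpha_i\ge0$, $\sum_i\alpha_i=1$; its density is $\sum_i\alpha_i\rho_c(\omega^{(i)})$,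 and its energy at electron density $\rho_e$ is the infimum of $\sum_i\alpha_i\,e(\rho_e^{(i)},\omega^{(i)})$ over all $\rho_e^{(i)}\in[0,1]$ with $\sum_i\alpha_i\rho_e^{(i)}=\rho_e$. A periodic configuration or a mixture is a canonical ground state for $(\rho_e,\rho_c)$ if it has density $\rho_c$ and its energy at electron density $\rho_e$ equals $e(\rho_e,\rho_c)$. For relatively prime integers $0\le p\le q$, $q\ge1$, let $\omega_{p/q}$ be the configuration of period $q$ whose occupied sites are the solutions $k_j$ of $p\,k_j\equiv j \pmod q$, $0\le j\le p-1$. A configuration with occupied sites $\dots<x_{-1}<0\le x_0<x_1<\dots$ is called homogeneous if for some integer $\ell\ge1$ all distances $x_i-x_{i-1}$ are $\ell$ or $\ell+1$; its derivative is the configuration $\omega'$ with $\omega'_i=1$ if $x_i-x_{i-1}=\ell$ and $\omega'_i=0$ if $x_i-x_{i-1}=\ell+1$. It is most homogeneous if repeated differentiation leads to the empty or the full configuration. **Theorem.** There is a constant $c>0$, independent of $p$, $q$ and $U$, such that for all relatively prime $0\le p\le q$, $q\ge1$, and all $U>c\,4^q$, the following holds for $\rho_e=\rho_c=p/q$. The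 configuration $\omega_{p/q}$ is most homogeneous; the periodic canonical ground states are exactly the translates of $\omega_{p/q}$ and of its reflection; and a mixture is a canonical ground state if and only if each of its components of positive weight is one of these. -/

import Mathlib

open Filter Topology

noncomputable section

namespace FalicovKimball

/-- Configurations of classical particles on the one-dimensional lattice:
`ω x = 1` if the site `x` is occupied, `ω x = 0` if it is empty. -/
abbrev Config : Type := ℤ → Fin 2

/-! ### The model in a finite box -/

/-- Complex functions `Ψ(x₁, …, x_N)` of `N` variables in the box `Λ`. -/
abbrev WaveFunction (Λ : Finset ℤ) (N : ℕ) : Type := (Fin N → Λ) → ℂ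

/-- `Ψ` is antisymmetric, i.e. belongs to the `N`-electron Hilbert space of the box. -/
def IsAntisymmetric {Λ : Finset ℤ} {N : ℕ} (Ψ : WaveFunction Λ N) : Prop :=
  ∀ (σ : Equiv.Perm (Fin N)) (x : Fin N → Λ), Ψ (x ∘ σ) = ((Equiv.Perm.sign σ : ℤ) : ℂ) * Ψ x

/-- The inner product of the `N`-electron Hilbert space. -/
def innerProd {Λ : Finset ℤ} {N : ℕ} (Φ Ψ : WaveFunction Λ N) : ℂ :=
  ∑ x : Fin N → Λ, (starRingEnd ℂ) (Φ x) * Ψ x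

/-- The annihilation operator `a_x`, from `N + 1` to `N` electrons. -/
def annihilate {Λ : Finset ℤ} {N : ℕ} (x : Λ) (Ψ : WaveFunction Λ (N + 1)) : WaveFunction Λ N :=
  fun y => (Real.sqrt (N + 1) : ℂ) * Ψ (Fin.cons x y : Fin (N + 1) → Λ)

/-- The creation operator `a†_x`, from `N` to `N + 1` electrons. -/
def create {Λ : Finset ℤ} {N : ℕ} (x : Λ) (Ψ : WaveFunction Λ N) : WaveFunction Λ (N + 1) :=
  fun y => ((Real.sqrt (N + 1))⁻¹ : ℂ) *
    ∑ i : Fin (N + 1), if y i = x then (-1 : ℂ) ^ (i : ℕ) * Ψ (fun j => y (i.succAbove j)) else 0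

/-- The Falicov-Kimball Hamiltonian
`H_Λ(ω) = - ∑_{|x-y|=1} a†_x a_y - U ∑_x ω_x a†_x a_x` in the sector with `N` electrons
(every `a_y` vanishes on the sector without electrons). -/
def hamiltonian (U : ℝ) (ω : Config) (Λ : Finset ℤ) :
    (N : ℕ) → WaveFunction Λ N → WaveFunction Λ N
  | 0, _ => 0
  | _ + 1, Ψ =>
      - (∑ x : Λ, ∑ y : Λ, if |(x : ℤ) - (y : ℤ)| = 1 then create x (annihilate y Ψ) else 0)
      - ∑ x : Λ, ((U : ℂ) * ((ω x : ℕ) : ℂ)) • create x (annihilate x Ψ)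

/-- The ground state energy `E_Λ(N, ω) = inf ⟨Ψ, H_Λ(ω) Ψ⟩` over the normalized states
with `N` electrons. -/
def groundEnergy (U : ℝ) (ω : Config) (Λ : Finset ℤ) (N : ℕ) : ℝ :=
  sInf {E : ℝ | ∃ Ψ : WaveFunction Λ N, IsAntisymmetric Ψ ∧ innerProd Ψ Ψ = 1 ∧
    E = (innerProd Ψ (hamiltonian U ω Λ N Ψ)).re}

/-! ### Infinite volume -/

/-- `Λ ↗ ℤ`: the left end of the box `{a, …, b}` tends to `-∞` and the right end to `+∞`. -/
abbrev boxes : Filter (ℤ × ℤ) := atBot ×ˢ atTop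

/-- The box with given end points. -/
abbrev box (ab : ℤ × ℤ) : Finset ℤ := Finset.Icc ab.1 ab.2

/-- `E_Λ(N_e, ω) / |Λ|` with `N_e` the integer part of `ρe |Λ|`. -/
def energyPerSite (U ρe : ℝ) (ω : Config) (Λ : Finset ℤ) : ℝ :=
  groundEnergy U ω Λ ⌊ρe * (Λ.card : ℝ)⌋₊ / (Λ.card : ℝ)

/-- The energy per site `e(ρe, ω)` in the infinite volume limit. -/
def energyDensity (U ρe : ℝ) (ω : Config) : ℝ :=
  limUnder boxes fun ab => energyPerSite U ρe ω (box ab)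

/-- `N_c(ω) / |Λ|`, the fraction of the sites of `Λ` that are occupied. -/
def particlesPerSite (ω : Config) (Λ : Finset ℤ) : ℝ :=
  (∑ x ∈ Λ, ((ω x : ℕ) : ℝ)) / (Λ.card : ℝ)

/-- The density `ρc(ω)` of classical particles. -/
def particleDensity (ω : Config) : ℝ :=
  limUnder boxes fun ab => particlesPerSite ω (box ab)

/-- Periodic configurations. -/
def IsPeriodic (ω : Config) : Prop := ∃ n : ℤ, 0 < n ∧ ∀ x, ω (x + n) = ω x

/-- The absolute ground state energy density `e(ρe, ρc)`: the infimum of `e(ρe, ω)` over the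
periodic configurations of density `ρc`. -/
def minEnergyDensity (U ρe ρc : ℝ) : ℝ :=
  sInf {E : ℝ | ∃ ω : Config, IsPeriodic ω ∧ particleDensity ω = ρc ∧ E = energyDensity U ρe ω}

/-- The periodic configurations in the canonical ground state phase diagram. -/
def periodicGroundStates (U ρe ρc : ℝ) : Set Config :=
  {ω | IsPeriodic ω ∧ particleDensity ω = ρc ∧
    energyDensity U ρe ω = minEnergyDensity U ρe ρc}

/-- A mixture of finitely many periodic configurations: the configuration `comp i` fills the
fraction `weight i` of the volume. -/
structure Mixture where
  size : ℕ
  weight : Fin size → ℝ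
  comp : Fin size → Config
  weight_nonneg : ∀ i, 0 ≤ weight i
  weight_sum : ∑ i, weight i = 1
  comp_periodic : ∀ i, IsPeriodic (comp i)

/-- The density of classical particles of a mixture. -/
def Mixture.particleDensity (m : Mixture) : ℝ :=
  ∑ i, m.weight i * FalicovKimball.particleDensity (m.comp i)

/-- The energy per site of a mixture: the electrons distribute themselves over the components
in the optimal way. -/
def Mixture.energyDensity (U ρe : ℝ) (m : Mixture) : ℝ :=
  sInf {E : ℝ | ∃ r : Fin m.size → ℝ, (∀ i, r i ∈ Set.Icc (0 : ℝ) 1) ∧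
    ∑ i, m.weight i * r i = ρe ∧
    E = ∑ i, m.weight i * FalicovKimball.energyDensity U (r i) (m.comp i)}

/-- The mixtures in the canonical ground state phase diagram. -/
def mixedGroundStates (U ρe ρc : ℝ) : Set Mixture :=
  {m | m.particleDensity = ρc ∧ m.energyDensity U ρe = minEnergyDensity U ρe ρc}

/-! ### Most homogeneous configurations -/

/-- The configuration whose occupied sites are the solutions `k` of
`p k = j mod q`, `0 ≤ j ≤ p - 1`. -/
def formulaConfig (p q : ℕ) : Config :=
  open Classical in fun k => if ∃ j : ℕ, j < p ∧ (p : ℤ) * k ≡ (j : ℤ) [ZMOD (q : ℤ)] then 1 else 0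

/-- `ω'` is the derivative of the homogeneous configuration `ω`: the occupied sites of `ω`,
in increasing order, are `… < x (-1) < x 0 < x 1 < …`, where `x 0` is the first one that is
nonnegative; the distance of every `x i` to the preceding occupied site is `ℓ` or `ℓ + 1`;
and `ω' i` is 1 in the first case and 0 in the second. -/
def IsDerivative (ω ω' : Config) : Prop :=
  ∃ (ℓ : ℤ) (x : ℤ → ℤ), 1 ≤ ℓ ∧ StrictMono x ∧ Set.range x = {k | ω k = 1} ∧
    x (-1) < 0 ∧ 0 ≤ x 0 ∧
    ∀ i, (x i - x (i - 1) = ℓ ∧ ω' i = 1) ∨ (x i - x (i - 1) = ℓ + 1 ∧ ω' i = 0)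

/-- A configuration is most homogeneous if the empty or the full configuration is obtained from
it by taking derivatives repeatedly. -/
inductive IsMostHomogeneous : Config → Prop
  | empty : IsMostHomogeneous (fun _ => 0)
  | full : IsMostHomogeneous (fun _ => 1)
  | step {ω ω' : Config} : IsDerivative ω ω' → IsMostHomogeneous ω' → IsMostHomogeneous ω

/-- The translates of `ω` and of its mirror image. -/
def orbit (ω : Config) : Set Config :=
  {η | ∃ a : ℤ, (∀ k, η k = ω (k + a)) ∨ (∀ k, η k = ω (a - k))}

end FalicovKimball

end

/-!
Write `U = 2 v`; up to a constant the one-particle energies are `±v` on the empty and occupied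
sites, coupled by the hopping. The fermions are free, so the ground state energy in a box is the
sum of the lowest one-particle levels (`IsEigensystem.groundEnergy_eq`, `groundEnergy_box`). The
levels form a band near `-v`, with one level per particle, and a band near `v`. The energy is
therefore at least the sum of all negative levels, with equality if there are as many electrons as
particles (`le_lowEnergy`, `lowEnergy_numOnes`). The sum of the negative levels is an integral of
the logarithm of `|det (h + i y)|²` over `y` (`bandShift_eq`), and what remains is to find the
configurations for which this integral, the band shift, is largest.

By Dodgson's identity for the determinants of intervals of the chain the integral is a sum of
interactions `stringTerm` of all strings of consecutive sites. The interaction of a string of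
length `j + 2` is of order `v ^ (-(2 j + 1))` (`abs_stringTerm_le`), so longer strings matter less.
Its leading term is computed by beta integrals, and its dependence on the two ends shows that, if
two strings `0u0` and `1u1` are replaced by `0u1` and `1u0`, the shift grows at leading order
(`stringTerm_exchange`).

To use this, a finite collection of periodic configurations is read as a permutation `π` of a
finite set of sites, each cycle being one period wound up on a circle. Exchanging the successors of
two sites recombines the tails: if the configurations behind these sites agree up to the ends of
`0u0` and `1u1`, only the two strings change at that length, and the number of changed longer
strings grows linearly, which their decay controls as soon as `v ^ 2 > 176 * 8 ^ j`
(`totalShift_lt_exchange`). So if `π` is optimal for given occupation numbers, two intervals of the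
same length `k ≤ q` never differ by more than one in their numbers of particles
(`numOnes_le_of_forall_totalShift_le`). At density `p / q` every interval of length `q` then holds
exactly `p` particles, and a discrepancy argument identifies every cycle with a translate of
`ω_{p/q}` (`exists_eq_formulaConfig`). Hence this configuration maximizes the shift among all
periodic configurations and all mixtures with rational weights of density `p / q`. Real weights
follow by linear programming duality (`sum_mul_nonpos_of_integral`). Since the lower bound on the
energy depends on the electron densities of the components only through their mean, it settles the
mixtures too (`mem_mixedGroundStates_iff`).

That the configuration is most homogeneous is Euclid's algorithm: the derivative of the
configuration for `p / q` is a translate of the one for `(p - q % p) / p`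
(`isDerivative_codingConfig`).
-/

namespace FalicovKimball

/-! ### Free fermions: the ground state energy is a sum of one-particle eigenvalues -/

/-- The one-particle Hamiltonian of the box: hopping between neighbours and potential `-U ω`. -/
def oneBody (U : ℝ) (ω : Config) (Λ : Finset ℤ) : Matrix Λ Λ ℂ := fun x y =>
  -(if |(x : ℤ) - (y : ℤ)| = 1 then 1 else 0) - if x = y then (U : ℂ) * ((ω x : ℕ) : ℂ) else 0

/-- The operator `∑ᵢ hᵢ` acting on functions of `N` variables, `h` acting on the `i`-th one. -/
def secondQuantized {ι : Type*} [Fintype ι] {N : ℕ} (h : Matrix ι ι ℂ) (Ψ : (Fin N → ι) → ℂ) :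
    (Fin N → ι) → ℂ :=
  fun z => ∑ i, ∑ y, h (z i) y * Ψ (Function.update z i y)

/-- Moving the `i`-th argument of an antisymmetric function to the front costs `(-1) ^ i`. -/
theorem IsAntisymmetric.cons_removeNth {Λ : Finset ℤ} {N : ℕ} {Ψ : WaveFunction Λ (N + 1)}
    (hΨ : IsAntisymmetric Ψ) (i : Fin (N + 1)) (y : Λ) (z : Fin (N + 1) → Λ) :
    (-1 : ℂ) ^ (i : ℕ) * Ψ (Fin.cons y fun j => z (i.succAbove j)) =
      Ψ (Function.update z i y) := by
  have h1 : (Fin.cons y fun j => z (i.succAbove j) : Fin (N + 1) → Λ) =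
      Function.update z i y ∘ ⇑(i.cycleRange.symm) := by
    funext j
    refine Fin.cases ?_ (fun j => ?_) j
    · simp [Fin.cycleRange_symm_zero]
    · simp [Fin.cycleRange_symm_succ, Fin.succAbove_ne]
  rw [h1, hΨ, Equiv.Perm.sign_symm, Fin.sign_cycleRange]
  push_cast
  rw [← mul_assoc, ← pow_add, Even.neg_one_pow ⟨_, rfl⟩, one_mul]

theorem create_annihilate {Λ : Finset ℤ} {N : ℕ} {Ψ : WaveFunction Λ (N + 1)}
    (hΨ : IsAntisymmetric Ψ) (x y : Λ) (z : Fin (N + 1) → Λ) :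
    create x (annihilate y Ψ) z = ∑ i, if z i = x then Ψ (Function.update z i y) else 0 := by
  have h0 : ((Real.sqrt (N + 1) : ℝ) : ℂ) ≠ 0 := by
    simp only [ne_eq, Complex.ofReal_eq_zero]; positivity
  simp only [create, annihilate]
  rw [Finset.mul_sum]
  refine Finset.sum_congr rfl fun i _ => ?_
  split_ifs
  · rw [← hΨ.cons_removeNth]
    field_simp
  · simp

/-- On antisymmetric functions the Hamiltonian is the sum of the one-particle Hamiltonians of the
electrons. -/
theorem hamiltonian_eq_secondQuantized (U : ℝ) (ω : Config) (Λ : Finset ℤ) (N : ℕ)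
    (Ψ : WaveFunction Λ N) (hΨ : IsAntisymmetric Ψ) :
    hamiltonian U ω Λ N Ψ = secondQuantized (oneBody U ω Λ) Ψ := by
  cases N with
  | zero => funext z; simp [hamiltonian, secondQuantized]
  | succ N =>
    funext z
    have key : ∀ x y : Λ, create x (annihilate y Ψ) z =
        ∑ i, if z i = x then Ψ (Function.update z i y) else 0 :=
      fun x y => create_annihilate hΨ x y z
    have e1 : (∑ x : Λ, ∑ y : Λ, if |(x : ℤ) - (y : ℤ)| = 1 then create x (annihilate y Ψ) else 0) z
        = ∑ i, ∑ y : Λ, (if |(z i : ℤ) - (y : ℤ)| = 1 then (1 : ℂ) else 0) *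
            Ψ (Function.update z i y) := by
      simp only [Finset.sum_apply]
      have : ∀ x y : Λ, (if |(x : ℤ) - (y : ℤ)| = 1 then create x (annihilate y Ψ) else 0) z
          = ∑ i, if z i = x then (if |(x : ℤ) - (y : ℤ)| = 1 then (1 : ℂ) else 0) *
            Ψ (Function.update z i y) else 0 := by
        intro x y
        split_ifs with h
        · rw [key]; simp
        · simp
      simp only [this]
      rw [Finset.sum_congr rfl fun x _ => Finset.sum_comm, Finset.sum_comm]
      refine Finset.sum_congr rfl fun i _ => ?_
      rw [Finset.sum_comm]
      refine Finset.sum_congr rfl fun y _ => ?_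
      simp
    have e2 : (∑ x : Λ, ((U : ℂ) * ((ω x : ℕ) : ℂ)) • create x (annihilate x Ψ)) z
        = ∑ i, ∑ y : Λ, (if z i = y then (U : ℂ) * ((ω (z i) : ℕ) : ℂ) else 0) *
            Ψ (Function.update z i y) := by
      simp only [Finset.sum_apply, Pi.smul_apply, key, smul_eq_mul, Finset.mul_sum]
      rw [Finset.sum_comm]
      refine Finset.sum_congr rfl fun i _ => ?_
      refine Finset.sum_congr rfl fun y _ => ?_
      split_ifs with h
      · rw [h]
      · simp
    simp only [hamiltonian, Pi.sub_apply, Pi.neg_apply]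
    rw [e1, e2]
    simp only [secondQuantized, oneBody]
    rw [← Finset.sum_neg_distrib, ← Finset.sum_sub_distrib]
    refine Finset.sum_congr rfl fun i _ => ?_
    rw [← Finset.sum_neg_distrib, ← Finset.sum_sub_distrib]
    refine Finset.sum_congr rfl fun y _ => ?_
    ring

/-- An orthonormal basis `v k` of `ι → ℂ` consisting of eigenvectors of `h`, with eigenvalues
`ev k`. Not tied to a particular choice of basis, so that it can be moved along
bijections of the index type. -/
structure IsEigensystem {ι κ : Type*} [Fintype ι] [Fintype κ] [DecidableEq ι] [DecidableEq κ]
    (h : Matrix ι ι ℂ) (v : κ → ι → ℂ) (ev : κ → ℝ) : Prop where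
  orth : ∀ k l, ∑ x, (starRingEnd ℂ) (v k x) * v l x = if k = l then 1 else 0
  complete : ∀ x y, ∑ k, v k x * (starRingEnd ℂ) (v k y) = if x = y then 1 else 0
  eig : ∀ k x, ∑ y, h x y * v k y = ev k * v k x

/-- The product state `v (k 0) ⊗ ⋯ ⊗ v (k (N - 1))`. -/
def productState {ι κ : Type*} {N : ℕ} (v : κ → ι → ℂ) (k : Fin N → κ) (x : Fin N → ι) : ℂ :=
  ∏ i, v (k i) (x i)

section Eigensystem

variable {ι κ : Type*} [Fintype ι] [Fintype κ] [DecidableEq ι] [DecidableEq κ]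
  {h : Matrix ι ι ℂ} {v : κ → ι → ℂ} {ev : κ → ℝ} {N : ℕ}

theorem IsEigensystem.secondQuantized_productState (H : IsEigensystem h v ev) (k : Fin N → κ) :
    secondQuantized h (productState v k) =
      fun z => ((∑ i, ev (k i) : ℝ) : ℂ) * productState v k z := by
  funext z
  simp only [secondQuantized]
  push_cast
  rw [Finset.sum_mul]
  refine Finset.sum_congr rfl fun i _ => ?_
  have : ∀ y, productState v k (Function.update z i y) =
      v (k i) y * ∏ j ∈ Finset.univ.erase i, v (k j) (z j) := by
    intro y
    rw [productState, ← Finset.mul_prod_erase _ _ (Finset.mem_univ i)]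
    congr 1
    · simp
    · refine Finset.prod_congr rfl fun j hj => ?_
      rw [Function.update_of_ne (Finset.ne_of_mem_erase hj)]
  simp only [this]
  have h2 : productState v k z = v (k i) (z i) * ∏ j ∈ Finset.univ.erase i, v (k j) (z j) := by
    rw [productState, ← Finset.mul_prod_erase _ _ (Finset.mem_univ i)]
  rw [h2, ← mul_assoc, ← H.eig, Finset.sum_mul]
  refine Finset.sum_congr rfl fun y _ => by ring

theorem IsEigensystem.productState_orth (H : IsEigensystem h v ev) (k l : Fin N → κ) :
    ∑ x, (starRingEnd ℂ) (productState v k x) * productState v l x = if k = l then 1 else 0 := by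
  simp only [productState, map_prod, ← Finset.prod_mul_distrib]
  have := Finset.prod_univ_sum (fun _ : Fin N => (Finset.univ : Finset ι))
    (fun i y => (starRingEnd ℂ) (v (k i) y) * v (l i) y)
  rw [Fintype.piFinset_univ] at this
  rw [← this]
  simp only [H.orth]
  split_ifs with hkl
  · simp [hkl]
  · obtain ⟨i, hi⟩ := Function.ne_iff.mp hkl
    exact Finset.prod_eq_zero (Finset.mem_univ i) (if_neg hi)

theorem IsEigensystem.productState_complete (H : IsEigensystem h v ev) (x y : Fin N → ι) :
    ∑ k, productState v k x * (starRingEnd ℂ) (productState v k y) = if x = y then 1 else 0 := by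
  simp only [productState, map_prod, ← Finset.prod_mul_distrib]
  have := Finset.prod_univ_sum (fun _ : Fin N => (Finset.univ : Finset κ))
    (fun i k => v k (x i) * (starRingEnd ℂ) (v k (y i)))
  rw [Fintype.piFinset_univ] at this
  rw [← this]
  simp only [H.complete]
  split_ifs with hkl
  · simp [hkl]
  · obtain ⟨i, hi⟩ := Function.ne_iff.mp hkl
    exact Finset.prod_eq_zero (Finset.mem_univ i) (if_neg hi)

/-- The coefficients of `Ψ` in the basis of product states. -/
def coeff (v : κ → ι → ℂ) (Ψ : (Fin N → ι) → ℂ) (k : Fin N → κ) : ℂ :=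
  ∑ x, (starRingEnd ℂ) (productState v k x) * Ψ x

theorem IsEigensystem.expansion (H : IsEigensystem h v ev) (Ψ : (Fin N → ι) → ℂ) :
    Ψ = fun x => ∑ k, coeff v Ψ k * productState v k x := by
  funext x
  simp only [coeff, Finset.sum_mul]
  rw [Finset.sum_comm]
  have : ∀ y, ∑ k, (starRingEnd ℂ) (productState v k y) * Ψ y * productState v k x =
      (if x = y then 1 else 0) * Ψ y := by
    intro y
    rw [← H.productState_complete, Finset.sum_mul]
    exact Finset.sum_congr rfl fun k _ => by ring
  simp [this]

theorem secondQuantized_sum {ι α : Type*} [Fintype ι] (h : Matrix ι ι ℂ)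
    (s : Finset α) (c : α → ℂ) (Φ : α → (Fin N → ι) → ℂ) :
    secondQuantized h (fun x => ∑ a ∈ s, c a * Φ a x) =
      fun x => ∑ a ∈ s, c a * secondQuantized h (Φ a) x := by
  funext z
  simp only [secondQuantized, Finset.mul_sum]
  rw [Finset.sum_congr rfl fun i _ => Finset.sum_comm, Finset.sum_comm]
  exact Finset.sum_congr rfl fun a _ => Finset.sum_congr rfl fun i _ =>
    Finset.sum_congr rfl fun y _ => by ring

theorem IsEigensystem.inner_secondQuantized (H : IsEigensystem h v ev) (Ψ : (Fin N → ι) → ℂ) :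
    (∑ x, (starRingEnd ℂ) (Ψ x) * secondQuantized h Ψ x).re =
      ∑ k, Complex.normSq (coeff v Ψ k) * ∑ i, ev (k i) := by
  have h1 : secondQuantized h Ψ = fun x => ∑ k, coeff v Ψ k *
      (((∑ i, ev (k i) : ℝ) : ℂ) * productState v k x) := by
    conv_lhs => rw [H.expansion Ψ]
    rw [secondQuantized_sum]
    simp only [H.secondQuantized_productState]
  have h2 : ∑ x, (starRingEnd ℂ) (Ψ x) * secondQuantized h Ψ x =
      ∑ k, ((Complex.normSq (coeff v Ψ k) * ∑ i, ev (k i) : ℝ) : ℂ) := by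
    rw [h1]
    simp only [Finset.mul_sum]
    rw [Finset.sum_comm]
    refine Finset.sum_congr rfl fun k _ => ?_
    have h3 : (starRingEnd ℂ) (coeff v Ψ k) = ∑ x, (starRingEnd ℂ) (Ψ x) * productState v k x := by
      simp only [coeff, map_sum, map_mul, Complex.conj_conj]
      exact Finset.sum_congr rfl fun x _ => by ring
    rw [← Finset.mul_sum, Complex.ofReal_mul, Complex.normSq_eq_conj_mul_self, h3,
      Finset.sum_mul, Finset.sum_mul]
    exact Finset.sum_congr rfl fun x _ => by ring
  rw [h2, ← Complex.ofReal_sum, Complex.ofReal_re]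

theorem IsEigensystem.inner_self (H : IsEigensystem h v ev) (Ψ : (Fin N → ι) → ℂ) :
    ∑ x, (starRingEnd ℂ) (Ψ x) * Ψ x = ((∑ k, Complex.normSq (coeff v Ψ k) : ℝ) : ℂ) := by
  have h1 : ∑ x, (starRingEnd ℂ) (Ψ x) * Ψ x =
      ∑ x, (starRingEnd ℂ) (Ψ x) * ∑ k, coeff v Ψ k * productState v k x :=
    Finset.sum_congr rfl fun x _ => by rw [← congrFun (H.expansion Ψ) x]
  rw [h1]
  push_cast
  simp only [Finset.mul_sum]
  rw [Finset.sum_comm]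
  refine Finset.sum_congr rfl fun k _ => ?_
  have h3 : (starRingEnd ℂ) (coeff v Ψ k) = ∑ x, (starRingEnd ℂ) (Ψ x) * productState v k x := by
    simp only [coeff, map_sum, map_mul, Complex.conj_conj]
    exact Finset.sum_congr rfl fun x _ => by ring
  rw [Complex.normSq_eq_conj_mul_self, h3, Finset.sum_mul]
  exact Finset.sum_congr rfl fun x _ => by ring

theorem productState_comp {ι κ : Type*} (v : κ → ι → ℂ) (k : Fin N → κ) (x : Fin N → ι)
    (σ : Equiv.Perm (Fin N)) : productState v (k ∘ σ) (x ∘ σ) = productState v k x := by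
  simp only [productState, Function.comp_apply]
  exact Equiv.prod_comp σ fun i => v (k i) (x i)

/-- The Pauli principle: an antisymmetric function has no component along a product state with
a repeated factor. -/
theorem coeff_eq_zero {ι κ : Type*} [Fintype ι] {Ψ : (Fin N → ι) → ℂ}
    (hΨ : ∀ (σ : Equiv.Perm (Fin N)) (x : Fin N → ι),
      Ψ (x ∘ σ) = ((Equiv.Perm.sign σ : ℤ) : ℂ) * Ψ x)
    (v : κ → ι → ℂ) {k : Fin N → κ} (hk : ¬ Function.Injective k) : coeff v Ψ k = 0 := by
  simp only [Function.Injective, not_forall] at hk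
  obtain ⟨i, j, hij, hne⟩ := hk
  have h1 : k ∘ Equiv.swap i j = k := by
    funext l
    simp only [Function.comp_apply]
    rcases eq_or_ne l i with rfl | hi
    · simp [hij]
    · rcases eq_or_ne l j with rfl | hj
      · simp [hij]
      · rw [Equiv.swap_apply_of_ne_of_ne hi hj]
  have h2 : coeff v Ψ k = -coeff v Ψ k := by
    have e := Equiv.sum_comp ((Equiv.swap i j).arrowCongr (Equiv.refl ι))
      (fun x => (starRingEnd ℂ) (productState v k x) * Ψ x)
    have e2 : ∀ x : Fin N → ι, ((Equiv.swap i j).arrowCongr (Equiv.refl ι)) x =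
        x ∘ Equiv.swap i j := by
      intro x; funext l; simp [Equiv.arrowCongr]
    conv_lhs => rw [coeff, ← e]
    simp only [e2, coeff]
    rw [← Finset.sum_neg_distrib]
    refine Finset.sum_congr rfl fun x _ => ?_
    rw [hΨ]
    conv_lhs => rw [← h1, productState_comp]
    simp [Equiv.Perm.sign_swap hne]
  have h3 : (2 : ℂ) * coeff v Ψ k = 0 := by linear_combination h2
  simpa using h3

/-- The antisymmetrized (unnormalized) product state. -/
def slater (v : κ → ι → ℂ) (k : Fin N → κ) (x : Fin N → ι) : ℂ :=
  ∑ σ : Equiv.Perm (Fin N), ((Equiv.Perm.sign σ : ℤ) : ℂ) * productState v (k ∘ σ) x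

theorem slater_antisymm {ι κ : Type*} (v : κ → ι → ℂ) (k : Fin N → κ)
    (τ : Equiv.Perm (Fin N)) (x : Fin N → ι) :
    slater v k (x ∘ τ) = ((Equiv.Perm.sign τ : ℤ) : ℂ) * slater v k x := by
  simp only [slater, Finset.mul_sum]
  rw [← Equiv.sum_comp (Equiv.mulRight τ)]
  refine Finset.sum_congr rfl fun σ _ => ?_
  have : k ∘ ⇑(σ * τ) = (k ∘ σ) ∘ τ := rfl
  rw [Equiv.coe_mulRight, this, productState_comp, Equiv.Perm.sign_mul]
  push_cast
  ring

theorem IsEigensystem.secondQuantized_slater (H : IsEigensystem h v ev) (k : Fin N → κ) :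
    secondQuantized h (slater v k) = fun z => ((∑ i, ev (k i) : ℝ) : ℂ) * slater v k z := by
  have h1 : slater v k = fun x => ∑ σ : Equiv.Perm (Fin N), ((Equiv.Perm.sign σ : ℤ) : ℂ) *
    productState v (k ∘ σ) x := rfl
  rw [h1, secondQuantized_sum]
  simp only [H.secondQuantized_productState, Finset.mul_sum]
  funext z
  refine Finset.sum_congr rfl fun σ _ => ?_
  have : ∑ i, ev ((k ∘ σ) i) = ∑ i, ev (k i) := Equiv.sum_comp σ fun i => ev (k i)
  rw [this]
  ring

/-- A Slater determinant of different orbitals does not vanish, because its component along the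
product state is one. -/
theorem IsEigensystem.slater_ne_zero (H : IsEigensystem h v ev) {k : Fin N → κ}
    (hk : Function.Injective k) : slater v k ≠ 0 := by
  intro h0
  have h1 : ∑ x, (starRingEnd ℂ) (productState v k x) * slater v k x = 1 := by
    simp only [slater, Finset.mul_sum]
    rw [Finset.sum_comm]
    have : ∀ σ : Equiv.Perm (Fin N), ∑ x, (starRingEnd ℂ) (productState v k x) *
        (((Equiv.Perm.sign σ : ℤ) : ℂ) * productState v (k ∘ σ) x) = if σ = 1 then 1 else 0 := by
      intro σ
      have e : ∑ x, (starRingEnd ℂ) (productState v k x) *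
        (((Equiv.Perm.sign σ : ℤ) : ℂ) * productState v (k ∘ σ) x) =
        ((Equiv.Perm.sign σ : ℤ) : ℂ) *
          ∑ x, (starRingEnd ℂ) (productState v k x) * productState v (k ∘ σ) x := by
        rw [Finset.mul_sum]; exact Finset.sum_congr rfl fun x _ => by ring
      rw [e, H.productState_orth]
      by_cases hσ : σ = 1
      · subst hσ; simp
      · rw [if_neg, if_neg hσ, mul_zero]
        intro hk'
        apply hσ
        ext i
        have := hk (congrFun hk' i)
        simp [← this]
    simp [this]
  rw [h0] at h1
  simp at h1

end Eigensystem

/-- The ground state energy of `N` electrons is the least sum of `N` one-particle eigenvalues. -/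
theorem IsEigensystem.groundEnergy_eq {κ : Type*} [Fintype κ] [DecidableEq κ] {U : ℝ}
    {ω : Config} {Λ : Finset ℤ} {v : κ → Λ → ℂ} {ev : κ → ℝ}
    (H : IsEigensystem (oneBody U ω Λ) v ev) (S : Finset κ)
    (hS : ∀ T : Finset κ, T.card = S.card → ∑ k ∈ S, ev k ≤ ∑ k ∈ T, ev k) :
    groundEnergy U ω Λ S.card = ∑ k ∈ S, ev k := by
  have hleast : IsLeast {E : ℝ | ∃ Ψ : WaveFunction Λ S.card, IsAntisymmetric Ψ ∧
      innerProd Ψ Ψ = 1 ∧ E = (innerProd Ψ (hamiltonian U ω Λ S.card Ψ)).re}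
      (∑ k ∈ S, ev k) := by
    constructor
    -- the minimum is attained by the normalized Slater determinant of the orbitals in `S`
    · let k : Fin S.card → κ := fun i => (S.equivFin.symm i : κ)
      have hk : Function.Injective k := fun i j hij =>
        S.equivFin.symm.injective (Subtype.ext hij)
      have hsum : ∑ i, ev (k i) = ∑ k ∈ S, ev k := by
        rw [← Finset.sum_coe_sort S]
        exact Equiv.sum_comp S.equivFin.symm fun i => ev i
      set n : ℝ := ∑ x, Complex.normSq (slater v k x) with hn
      have hn0 : 0 < n := by
        obtain ⟨x, hx⟩ := Function.ne_iff.mp (H.slater_ne_zero hk)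
        exact Finset.sum_pos' (fun _ _ => Complex.normSq_nonneg _)
          ⟨x, Finset.mem_univ _, Complex.normSq_pos.mpr hx⟩
      have hs : ((Real.sqrt n : ℝ) : ℂ) * (Real.sqrt n : ℝ) = n := by
        rw [← Complex.ofReal_mul, Real.mul_self_sqrt hn0.le]
      have hs0 : ((Real.sqrt n : ℝ) : ℂ) ≠ 0 := by
        rw [Complex.ofReal_ne_zero]; exact (Real.sqrt_pos.mpr hn0).ne'
      let Ψ : WaveFunction Λ S.card := fun x => ((Real.sqrt n : ℝ) : ℂ)⁻¹ * slater v k x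
      have hA : IsAntisymmetric Ψ := by
        intro σ x
        simp only [Ψ, slater_antisymm]
        ring
      have hin : innerProd Ψ Ψ = 1 := by
        have e : ∀ x, (starRingEnd ℂ) (Ψ x) * Ψ x =
            (n : ℂ)⁻¹ * ((Complex.normSq (slater v k x) : ℝ) : ℂ) := by
          intro x
          simp only [Ψ, map_mul, map_inv₀, Complex.conj_ofReal, Complex.normSq_eq_conj_mul_self]
          rw [← hs]
          field_simp
        rw [innerProd, Finset.sum_congr rfl fun x _ => e x, ← Finset.mul_sum,
          ← Complex.ofReal_sum, ← hn]
        exact inv_mul_cancel₀ (Complex.ofReal_ne_zero.mpr hn0.ne')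
      refine ⟨Ψ, hA, hin, ?_⟩
      have hH : secondQuantized (oneBody U ω Λ) Ψ =
          fun z => ((∑ i, ev (k i) : ℝ) : ℂ) * Ψ z := by
        have := secondQuantized_sum (h := oneBody U ω Λ) (N := S.card) {()}
          (fun _ => ((Real.sqrt n : ℝ) : ℂ)⁻¹) (fun _ => slater v k)
        simp only [Finset.sum_singleton, H.secondQuantized_slater] at this
        rw [this]
        funext z
        simp only [Ψ]
        ring
      rw [hamiltonian_eq_secondQuantized _ _ _ _ _ hA, hH, ← hsum]
      have : innerProd Ψ (fun z => ((∑ i, ev (k i) : ℝ) : ℂ) * Ψ z) =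
          ((∑ i, ev (k i) : ℝ) : ℂ) * innerProd Ψ Ψ := by
        simp only [innerProd, Finset.mul_sum]
        exact Finset.sum_congr rfl fun x _ => by ring
      rw [this, hin, mul_one, Complex.ofReal_re]
    -- any other state is a superposition of product states of `N` distinct orbitals
    · rintro E ⟨Ψ, hA, hin, rfl⟩
      rw [hamiltonian_eq_secondQuantized _ _ _ _ _ hA]
      simp only [innerProd] at hin ⊢
      rw [H.inner_secondQuantized]
      rw [H.inner_self] at hin
      have hone : ∑ k, Complex.normSq (coeff v Ψ k) = 1 := by exact_mod_cast hin
      calc ∑ k ∈ S, ev k = ∑ k, Complex.normSq (coeff v Ψ k) * ∑ k ∈ S, ev k := by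
            rw [← Finset.sum_mul, hone, one_mul]
        _ ≤ _ := by
            refine Finset.sum_le_sum fun k _ => ?_
            by_cases hk : Function.Injective k
            · refine mul_le_mul_of_nonneg_left ?_ (Complex.normSq_nonneg _)
              rw [← Finset.sum_image (s := Finset.univ) (g := k) (f := ev) (fun i _ j _ h => hk h)]
              refine hS _ ?_
              rw [Finset.card_image_of_injective _ hk, Finset.card_univ, Fintype.card_fin]
            · rw [coeff_eq_zero hA v hk]; simp
  exact hleast.csInf_eq

/-! ### The one-particle matrix of a chain and the Ky Fan principle -/

/-- The diagonal entry of the one-particle Hamiltonian, shifted by `v = U / 2`. -/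
def siteEnergy (v : ℝ) (a : Fin 2) : ℝ := if a = 1 then -v else v

/-- The one-particle Hamiltonian of the first `n` sites of `s`, shifted by `v = U / 2`. -/
def chain (v : ℝ) (s : ℕ → Fin 2) (n : ℕ) : Matrix (Fin n) (Fin n) ℂ := fun i j =>
  if i = j then (siteEnergy v (s i) : ℂ)
  else if (i : ℕ) + 1 = j ∨ (j : ℕ) + 1 = i then -1 else 0

theorem chain_isHermitian (v : ℝ) (s : ℕ → Fin 2) (n : ℕ) : (chain v s n).IsHermitian := by
  ext i j
  simp only [Matrix.conjTranspose_apply, chain]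
  by_cases h : i = j
  · subst h; simp
  · rw [if_neg h, if_neg (Ne.symm h)]
    simp only [or_comm (a := (j : ℕ) + 1 = i)]
    split_ifs <;> simp

/-- The one-particle levels of the chain. -/
noncomputable def levels (v : ℝ) (s : ℕ → Fin 2) (n : ℕ) : Fin n → ℝ :=
  (chain_isHermitian v s n).eigenvalues

/-- An orthonormal eigenbasis of the chain. -/
noncomputable def orbitals (v : ℝ) (s : ℕ → Fin 2) (n : ℕ) (k x : Fin n) : ℂ :=
  (chain_isHermitian v s n).eigenvectorBasis k x

theorem isEigensystem_chain (v : ℝ) (s : ℕ → Fin 2) (n : ℕ) :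
    IsEigensystem (chain v s n) (orbitals v s n) (levels v s n) where
  orth k l := by
    have := orthonormal_iff_ite.mp (chain_isHermitian v s n).eigenvectorBasis.orthonormal k l
    rw [← this, PiLp.inner_apply]
    refine Finset.sum_congr rfl fun x _ => ?_
    simp [orbitals, mul_comm]
  complete x y := by
    have := (chain_isHermitian v s n).eigenvectorBasis.sum_inner_mul_inner
      (EuclideanSpace.single x (1 : ℂ)) (EuclideanSpace.single y (1 : ℂ))
    simp only [EuclideanSpace.inner_single_left, EuclideanSpace.inner_single_right, map_one,
      one_mul] at this
    have e : (starRingEnd ℂ) ((EuclideanSpace.single x (1 : ℂ) : EuclideanSpace ℂ (Fin n)).ofLp y) =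
        if x = y then 1 else 0 := by
      simp [eq_comm]
    rw [← e, ← this]
    rfl
  eig k x := by
    have := congrFun ((chain_isHermitian v s n).mulVec_eigenvectorBasis k) x
    simpa [Matrix.mulVec, dotProduct, orbitals, levels] using this

/-- The least sum of `N` levels of a chain. -/
noncomputable def lowEnergy (v : ℝ) (s : ℕ → Fin 2) (n N : ℕ) : ℝ :=
  sInf ((fun S : Finset (Fin n) => ∑ k ∈ S, levels v s n k) '' {S | S.card = N})

theorem exists_lowEnergy (v : ℝ) (s : ℕ → Fin 2) {n N : ℕ} (h : N ≤ n) :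
    ∃ S : Finset (Fin n), S.card = N ∧ lowEnergy v s n N = ∑ k ∈ S, levels v s n k ∧
      ∀ T : Finset (Fin n), T.card = S.card →
        ∑ k ∈ S, levels v s n k ≤ ∑ k ∈ T, levels v s n k := by
  have hne : (Finset.powersetCard N (Finset.univ : Finset (Fin n))).Nonempty := by
    rw [Finset.powersetCard_nonempty]; simpa using h
  obtain ⟨S, hS, hmin⟩ := Finset.exists_min_image _
    (fun S : Finset (Fin n) => ∑ k ∈ S, levels v s n k) hne
  rw [Finset.mem_powersetCard_univ] at hS
  refine ⟨S, hS, ?_, fun T hT => hmin T ?_⟩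
  · refine IsLeast.csInf_eq ⟨⟨S, hS, rfl⟩, ?_⟩
    rintro _ ⟨T, hT, rfl⟩
    exact hmin T (by rw [Finset.mem_powersetCard_univ]; exact hT)
  · rw [Finset.mem_powersetCard_univ, hT, hS]

theorem lowEnergy_le (v : ℝ) (s : ℕ → Fin 2) {n : ℕ} (T : Finset (Fin n)) :
    lowEnergy v s n T.card ≤ ∑ k ∈ T, levels v s n k := by
  obtain ⟨S, hS, he, hmin⟩ := exists_lowEnergy v s (N := T.card) (by simpa using T.card_le_univ)
  rw [he]
  exact hmin T hS.symm

/-- The configuration seen from the site `a`. -/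
def streamAt (ω : Config) (a : ℤ) : ℕ → Fin 2 := fun k => ω (a + k)

/-- The sites of an interval with `n` sites. -/
def boxEquiv (a : ℤ) (n : ℕ) : Fin n ≃ Finset.Icc a (a + n - 1) where
  toFun i := ⟨a + (i : ℕ), by rw [Finset.mem_Icc]; omega⟩
  invFun x := ⟨((x : ℤ) - a).toNat, by have := Finset.mem_Icc.mp x.2; omega⟩
  left_inv i := by ext; simp
  right_inv x := by
    have := Finset.mem_Icc.mp x.2
    ext; simp only; omega

theorem oneBody_boxEquiv (v : ℝ) (ω : Config) (a : ℤ) (n : ℕ) (i j : Fin n) :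
    oneBody (2 * v) ω (Finset.Icc a (a + n - 1)) (boxEquiv a n i) (boxEquiv a n j) =
      chain v (streamAt ω a) n i j - if i = j then (v : ℂ) else 0 := by
  have hij : |((boxEquiv a n i : Finset.Icc a (a + n - 1)) : ℤ) - (boxEquiv a n j : ℤ)| = 1 ↔
      ((i : ℕ) + 1 = j ∨ (j : ℕ) + 1 = i) := by
    simp only [boxEquiv, Equiv.coe_fn_mk]
    rw [abs_eq (by norm_num)]
    omega
  unfold oneBody
  simp only [hij, (boxEquiv a n).injective.eq_iff, chain]
  by_cases h : i = j
  · subst h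
    have h01 : ω (a + (i : ℕ)) = 0 ∨ ω (a + (i : ℕ)) = 1 := by
      generalize ω (a + (i : ℕ)) = t; fin_cases t <;> simp
    rcases h01 with h | h
    · simp [siteEnergy, streamAt, boxEquiv, h]
    · simp [siteEnergy, streamAt, boxEquiv, h]; ring
  · rw [if_neg h, if_neg h]
    simp [h]
    split_ifs <;> simp

theorem isEigensystem_box (v : ℝ) (ω : Config) (a : ℤ) (n : ℕ) :
    IsEigensystem (oneBody (2 * v) ω (Finset.Icc a (a + n - 1)))
      (fun k x => orbitals v (streamAt ω a) n k ((boxEquiv a n).symm x))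
      (fun k => levels v (streamAt ω a) n k - v) where
  orth k l := by
    rw [← (isEigensystem_chain v (streamAt ω a) n).orth k l]
    exact Equiv.sum_comp (boxEquiv a n).symm fun x =>
      (starRingEnd ℂ) (orbitals v (streamAt ω a) n k x) * orbitals v (streamAt ω a) n l x
  complete x y := by
    rw [(isEigensystem_chain v (streamAt ω a) n).complete]
    simp
  eig k x := by
    obtain ⟨i, rfl⟩ := (boxEquiv a n).surjective x
    rw [← Equiv.sum_comp (boxEquiv a n)]
    simp only [oneBody_boxEquiv, Equiv.symm_apply_apply, sub_mul, Finset.sum_sub_distrib,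
      (isEigensystem_chain v (streamAt ω a) n).eig]
    simp [sub_mul]

theorem groundEnergy_box (v : ℝ) (ω : Config) (a : ℤ) {n N : ℕ} (h : N ≤ n) :
    groundEnergy (2 * v) ω (Finset.Icc a (a + n - 1)) N =
      lowEnergy v (streamAt ω a) n N - v * N := by
  obtain ⟨S, hS, he, hmin⟩ := exists_lowEnergy v (streamAt ω a) h
  have hconst : ∀ T : Finset (Fin n), ∑ k ∈ T, (levels v (streamAt ω a) n k - v) =
      ∑ k ∈ T, levels v (streamAt ω a) n k - v * T.card := by
    intro T
    rw [Finset.sum_sub_distrib]; simp [mul_comm]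
  have := (isEigensystem_box v ω a n).groundEnergy_eq S (by
    intro T hT
    rw [hconst, hconst, hT]
    have := hmin T hT
    linarith)
  rw [hconst, hS] at this
  rw [this, he]

/-- Filling `N` levels with occupations in `[0, 1]` costs at least the sum of the lowest ones. -/
theorem sum_lowest_le {κ : Type*} [Fintype κ] [DecidableEq κ] (ev occ : κ → ℝ) (S : Finset κ)
    (hS : ∀ T : Finset κ, T.card = S.card → ∑ k ∈ S, ev k ≤ ∑ k ∈ T, ev k)
    (h0 : ∀ k, 0 ≤ occ k) (h1 : ∀ k, occ k ≤ 1) (hsum : ∑ k, occ k = S.card) :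
    ∑ k ∈ S, ev k ≤ ∑ k, ev k * occ k := by
  rcases S.eq_empty_or_nonempty with rfl | hne
  · simp only [Finset.card_empty, Nat.cast_zero] at hsum
    have := (Finset.sum_eq_zero_iff_of_nonneg fun k _ => h0 k).mp hsum
    rw [Finset.sum_empty]
    exact (Finset.sum_eq_zero fun k hk => by rw [this k hk, mul_zero]).ge
  obtain ⟨m, hm, hmax⟩ := Finset.exists_max_image S ev hne
  have hout : ∀ l ∉ S, ev m ≤ ev l := by
    intro l hl
    have hl' : l ∉ S.erase m := fun h => hl (Finset.mem_of_mem_erase h)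
    have := hS (insert l (S.erase m)) (by
      rw [Finset.card_insert_of_notMem hl', Finset.card_erase_of_mem hm]
      have := Finset.card_pos.mpr hne
      omega)
    rw [Finset.sum_insert hl', ← Finset.add_sum_erase _ _ hm] at this
    linarith
  have key : ∀ k, 0 ≤ (ev k - ev m) * (occ k - if k ∈ S then 1 else 0) := by
    intro k
    split_ifs with hk
    · exact mul_nonneg_of_nonpos_of_nonpos (by linarith [hmax k hk]) (by linarith [h1 k])
    · exact mul_nonneg (by linarith [hout k hk]) (by linarith [h0 k])
  have hs := Finset.sum_nonneg fun k (_ : k ∈ Finset.univ) => key k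
  have e : ∑ k, (ev k - ev m) * (occ k - if k ∈ S then 1 else 0) =
      ∑ k, ev k * occ k - ∑ k ∈ S, ev k - ev m * (∑ k, occ k - S.card) := by
    have e1 : ∀ k, (ev k - ev m) * (occ k - if k ∈ S then 1 else 0) =
        ev k * occ k - (if k ∈ S then ev k else 0) -
          ev m * (occ k - if k ∈ S then 1 else 0) := by
      intro k; split_ifs <;> ring
    simp only [e1, Finset.sum_sub_distrib, ← Finset.mul_sum]
    simp
  rw [e, hsum] at hs
  linarith

section Eigensystem

variable {ι κ : Type*} [Fintype ι] [Fintype κ] [DecidableEq ι] [DecidableEq κ]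
  {h : Matrix ι ι ℂ} {v : κ → ι → ℂ} {ev : κ → ℝ}

theorem IsEigensystem.expansion_one (H : IsEigensystem h v ev) (w : ι → ℂ) (x : ι) :
    w x = ∑ k, (∑ y, (starRingEnd ℂ) (v k y) * w y) * v k x := by
  simp only [Finset.sum_mul]
  rw [Finset.sum_comm]
  have : ∀ y, ∑ k, (starRingEnd ℂ) (v k y) * w y * v k x = (if x = y then 1 else 0) * w y := by
    intro y
    rw [← H.complete, Finset.sum_mul]
    exact Finset.sum_congr rfl fun k _ => by ring
  simp [this]

theorem IsEigensystem.quadraticForm (H : IsEigensystem h v ev) (w : ι → ℂ) :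
    ∑ x, ∑ y, (starRingEnd ℂ) (w x) * (h x y * w y) =
      ((∑ k, ev k * Complex.normSq (∑ y, (starRingEnd ℂ) (v k y) * w y) : ℝ) : ℂ) := by
  have h1 : ∀ x, ∑ y, h x y * w y =
      ∑ k, (∑ y, (starRingEnd ℂ) (v k y) * w y) * (ev k * v k x) := by
    intro x
    have e : ∀ y, h x y * w y = ∑ k, (∑ z, (starRingEnd ℂ) (v k z) * w z) * (h x y * v k y) := by
      intro y
      conv_lhs => rw [H.expansion_one w y]
      rw [Finset.mul_sum]
      exact Finset.sum_congr rfl fun k _ => by ring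
    simp only [e]
    rw [Finset.sum_comm]
    refine Finset.sum_congr rfl fun k _ => ?_
    rw [← Finset.mul_sum, H.eig]
  simp only [← Finset.mul_sum, h1]
  simp only [Finset.mul_sum]
  rw [Finset.sum_comm]
  push_cast
  refine Finset.sum_congr rfl fun k _ => ?_
  have h3 : (starRingEnd ℂ) (∑ y, (starRingEnd ℂ) (v k y) * w y) =
      ∑ x, (starRingEnd ℂ) (w x) * v k x := by
    simp only [map_sum, map_mul, Complex.conj_conj]
    exact Finset.sum_congr rfl fun x _ => by ring
  rw [Complex.normSq_eq_conj_mul_self, h3, Finset.sum_mul, Finset.mul_sum]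
  exact Finset.sum_congr rfl fun x _ => by ring

theorem IsEigensystem.parseval (H : IsEigensystem h v ev) (w : ι → ℂ) :
    ∑ k, Complex.normSq (∑ y, (starRingEnd ℂ) (v k y) * w y) = ∑ x, Complex.normSq (w x) := by
  have e : ((∑ k, Complex.normSq (∑ y, (starRingEnd ℂ) (v k y) * w y) : ℝ) : ℂ) =
      ((∑ x, Complex.normSq (w x) : ℝ) : ℂ) := by
    push_cast
    simp only [Complex.normSq_eq_conj_mul_self (z := w _)]
    have h1 : ∀ x, (starRingEnd ℂ) (w x) * w x = (starRingEnd ℂ) (w x) *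
        ∑ k, (∑ y, (starRingEnd ℂ) (v k y) * w y) * v k x := fun x => by
      rw [← H.expansion_one w x]
    simp only [h1]
    simp only [Finset.mul_sum]
    rw [Finset.sum_comm]
    refine Finset.sum_congr rfl fun k _ => ?_
    have h3 : (starRingEnd ℂ) (∑ y, (starRingEnd ℂ) (v k y) * w y) =
        ∑ x, (starRingEnd ℂ) (w x) * v k x := by
      simp only [map_sum, map_mul, Complex.conj_conj]
      exact Finset.sum_congr rfl fun x _ => by ring
    rw [Complex.normSq_eq_conj_mul_self, h3, Finset.sum_mul]
    exact Finset.sum_congr rfl fun x _ => by ring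
  exact_mod_cast e

/-- The Ky Fan principle: the energy of an orthonormal family is at least the sum of the lowest
eigenvalues. -/
theorem IsEigensystem.sum_lowest_le_of_orthonormal {τ : Type*} [Fintype τ] [DecidableEq τ]
    (H : IsEigensystem h v ev) (S : Finset κ)
    (hS : ∀ T : Finset κ, T.card = S.card → ∑ k ∈ S, ev k ≤ ∑ k ∈ T, ev k)
    (w : τ → ι → ℂ) (hw : ∀ i j, ∑ x, (starRingEnd ℂ) (w i x) * w j x = if i = j then 1 else 0)
    (hcard : Fintype.card τ = S.card) :
    ∑ k ∈ S, ev k ≤ ∑ i, (∑ x, ∑ y, (starRingEnd ℂ) (w i x) * (h x y * w i y)).re := by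
  have hnorm : ∀ i, ∑ x, Complex.normSq (w i x) = 1 := by
    intro i
    have := hw i i
    simp only [← Complex.normSq_eq_conj_mul_self, if_true] at this
    exact_mod_cast this
  have hbessel : ∀ k, ∑ i, Complex.normSq (∑ y, (starRingEnd ℂ) (v k y) * w i y) ≤ 1 := by
    intro k
    have hon : Orthonormal ℂ (fun i => (WithLp.toLp 2 (w i) : EuclideanSpace ℂ ι)) := by
      rw [orthonormal_iff_ite]
      intro i j
      rw [← hw i j, PiLp.inner_apply]
      exact Finset.sum_congr rfl fun x _ => by simp [mul_comm]
    have hb := hon.sum_inner_products_le (WithLp.toLp 2 (v k) : EuclideanSpace ℂ ι)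
      (s := Finset.univ)
    have hvk : ‖(WithLp.toLp 2 (v k) : EuclideanSpace ℂ ι)‖ ^ 2 = 1 := by
      rw [EuclideanSpace.norm_sq_eq]
      have := H.orth k k
      simp only [← Complex.normSq_eq_conj_mul_self, if_true] at this
      have h2 : ∑ x, Complex.normSq (v k x) = 1 := by exact_mod_cast this
      rw [← h2]
      exact Finset.sum_congr rfl fun x _ => by simp [Complex.normSq_eq_norm_sq]
    rw [hvk] at hb
    refine le_trans (le_of_eq ?_) hb
    refine Finset.sum_congr rfl fun i _ => ?_
    rw [Complex.normSq_eq_norm_sq, ← norm_inner_symm, PiLp.inner_apply]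
    congr 2
    exact Finset.sum_congr rfl fun x _ => by simp [mul_comm]
  have := sum_lowest_le ev (fun k => ∑ i, Complex.normSq (∑ y, (starRingEnd ℂ) (v k y) * w i y)) S
    hS (fun k => Finset.sum_nonneg fun i _ => Complex.normSq_nonneg _) hbessel (by
      rw [Finset.sum_comm]
      simp only [H.parseval, hnorm]
      simp [hcard])
  refine this.trans (le_of_eq ?_)
  simp only [H.quadraticForm, Complex.ofReal_re, Finset.mul_sum]
  rw [Finset.sum_comm]

end Eigensystem

/-- The energy is subadditive: the orbitals of two adjacent chains, extended by zero, are an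
orthonormal family in the joint chain. -/
theorem lowEnergy_add_le (v : ℝ) (s : ℕ → Fin 2) {n m N M : ℕ} (hN : N ≤ n) (hM : M ≤ m) :
    lowEnergy v s (n + m) (N + M) ≤
      lowEnergy v s n N + lowEnergy v (fun k => s (n + k)) m M := by
  obtain ⟨S, hS, he, -⟩ := exists_lowEnergy v s hN
  obtain ⟨T, hT, hf, -⟩ := exists_lowEnergy v (fun k => s (n + k)) hM
  obtain ⟨R, hR, hg, hmin⟩ := exists_lowEnergy v s (Nat.add_le_add hN hM)
  rw [he, hf, hg]
  let t : ℕ → Fin 2 := fun k => s (n + k)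
  have H1 := isEigensystem_chain v s n
  have H2 := isEigensystem_chain v t m
  let w : S ⊕ T → Fin (n + m) → ℂ := Sum.elim
    (fun k => Fin.addCases (fun x => orbitals v s n k x) (fun _ => 0))
    (fun k => Fin.addCases (fun _ => 0) (fun x => orbitals v t m k x))
  have := (isEigensystem_chain v s (n + m)).sum_lowest_le_of_orthonormal R hmin w (by
    rintro (i | i) (j | j)
    · simp [w, Fin.sum_univ_add, H1.orth]
    · simp [w, Fin.sum_univ_add]
    · simp [w, Fin.sum_univ_add]
    · simp [w, Fin.sum_univ_add, H2.orth]) (by simp [hS, hT, hR])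
  refine this.trans (le_of_eq ?_)
  rw [Fintype.sum_sum_type]
  have c1 : ∀ x y : Fin n, chain v s (n + m) (Fin.castAdd m x) (Fin.castAdd m y) =
      chain v s n x y := by
    intro x y; simp [chain]
  have c2 : ∀ x y : Fin m, chain v s (n + m) (Fin.natAdd n x) (Fin.natAdd n y) =
      chain v t m x y := by
    intro x y
    simp only [chain, Fin.natAdd_inj, Fin.val_natAdd, t]
    congr 2
    simp only [eq_iff_iff]
    omega
  have q : ∀ {p : ℕ} (r : ℕ → Fin 2) (k : Fin p), ∑ x, ∑ y, (starRingEnd ℂ) (orbitals v r p k x) *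
      (chain v r p x y * orbitals v r p k y) = levels v r p k := by
    intro p r k
    simp only [← Finset.mul_sum, (isEigensystem_chain v r p).eig]
    have : ∀ x, (starRingEnd ℂ) (orbitals v r p k x) * (levels v r p k * orbitals v r p k x) =
        levels v r p k * ((starRingEnd ℂ) (orbitals v r p k x) * orbitals v r p k x) :=
      fun x => by ring
    simp only [this, ← Finset.mul_sum, (isEigensystem_chain v r p).orth]
    simp
  congr 1
  · rw [← Finset.sum_coe_sort S]
    refine Finset.sum_congr rfl fun k _ => ?_
    simp [w, Fin.sum_univ_add, c1, q]
  · rw [← Finset.sum_coe_sort T]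
    refine Finset.sum_congr rfl fun k _ => ?_
    simp [w, Fin.sum_univ_add, c2, q, t]

/-! ### Existence of the infinite volume limit -/

/-- The radii of the Gershgorin discs: a site has at most two neighbours. -/
theorem sum_norm_chain_le (v : ℝ) (s : ℕ → Fin 2) (n : ℕ) (k : Fin n) :
    ∑ j ∈ Finset.univ.erase k, ‖chain v s n k j‖ ≤ 2 := by
  have h1 : ∀ j ∈ Finset.univ.erase k, ‖chain v s n k j‖ ≤
      (if (k : ℕ) + 1 = j then 1 else 0) + if (j : ℕ) + 1 = k then 1 else 0 := by
    intro j hj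
    rw [chain, if_neg (Finset.ne_of_mem_erase hj).symm]
    by_cases h1 : (k : ℕ) + 1 = j
    · rw [if_pos (Or.inl h1), if_pos h1]; split_ifs <;> norm_num
    · by_cases h2 : (j : ℕ) + 1 = k
      · rw [if_pos (Or.inr h2), if_neg h1, if_pos h2]; norm_num
      · rw [if_neg (by tauto), if_neg h1, if_neg h2]; norm_num
  refine (Finset.sum_le_sum h1).trans ?_
  rw [Finset.sum_add_distrib, Finset.sum_boole, Finset.sum_boole]
  have c1 : (Finset.filter (fun j : Fin n => (k : ℕ) + 1 = j) (Finset.univ.erase k)).card ≤ 1 := by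
    refine Finset.card_le_one.mpr fun a ha b hb => ?_
    have := (Finset.mem_filter.mp ha).2
    have := (Finset.mem_filter.mp hb).2
    ext; omega
  have c2 : (Finset.filter (fun j : Fin n => (j : ℕ) + 1 = k) (Finset.univ.erase k)).card ≤ 1 := by
    refine Finset.card_le_one.mpr fun a ha b hb => ?_
    have := (Finset.mem_filter.mp ha).2
    have := (Finset.mem_filter.mp hb).2
    ext; omega
  have d1 : ((Finset.filter (fun j : Fin n => (k : ℕ) + 1 = j) (Finset.univ.erase k)).card : ℝ) ≤ 1 :=
    by exact_mod_cast c1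
  have d2 : ((Finset.filter (fun j : Fin n => (j : ℕ) + 1 = k) (Finset.univ.erase k)).card : ℝ) ≤ 1 :=
    by exact_mod_cast c2
  linarith

/-- Gershgorin: every level lies within distance 2 of a diagonal entry. -/
theorem levels_near (v : ℝ) (s : ℕ → Fin 2) (n : ℕ) (k : Fin n) :
    |levels v s n k - v| ≤ 2 ∨ |levels v s n k + v| ≤ 2 := by
  have hev : Module.End.HasEigenvalue (Matrix.toLin' (chain v s n)) (levels v s n k : ℂ) := by
    refine Module.End.hasEigenvalue_of_hasEigenvector
      (x := ((chain_isHermitian v s n).eigenvectorBasis k).ofLp) ⟨?_, ?_⟩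
    · rw [Module.End.mem_eigenspace_iff, Matrix.toLin'_apply]
      exact (chain_isHermitian v s n).mulVec_eigenvectorBasis k
    · intro h0
      apply (chain_isHermitian v s n).eigenvectorBasis.orthonormal.ne_zero k
      ext x
      exact congrFun h0 x
  obtain ⟨j, hj⟩ := eigenvalue_mem_ball hev
  rw [Metric.mem_closedBall, dist_eq_norm] at hj
  have h2 := hj.trans (sum_norm_chain_le v s n j)
  have hd : chain v s n j j = (siteEnergy v (s j) : ℂ) := by simp [chain]
  rw [hd, ← Complex.ofReal_sub, Complex.norm_real, Real.norm_eq_abs] at h2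
  unfold siteEnergy at h2
  split_ifs at h2
  · right; simpa using h2
  · left; exact h2

theorem abs_levels_le {v : ℝ} (hv : 0 ≤ v) (s : ℕ → Fin 2) (n : ℕ) (k : Fin n) :
    |levels v s n k| ≤ v + 2 := by
  rcases levels_near v s n k with h | h <;> rw [abs_le] at h ⊢ <;> constructor <;> linarith

theorem abs_lowEnergy_le {v : ℝ} (hv : 0 ≤ v) (s : ℕ → Fin 2) {n N : ℕ} (h : N ≤ n) :
    |lowEnergy v s n N| ≤ (v + 2) * n := by
  obtain ⟨S, hS, he, -⟩ := exists_lowEnergy v s h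
  rw [he]
  calc |∑ k ∈ S, levels v s n k| ≤ ∑ k ∈ S, |levels v s n k| := Finset.abs_sum_le_sum_abs _ _
    _ ≤ ∑ _k ∈ S, (v + 2) := Finset.sum_le_sum fun k _ => abs_levels_le hv s n k
    _ = (v + 2) * N := by rw [Finset.sum_const, hS, nsmul_eq_mul, mul_comm]
    _ ≤ (v + 2) * n := by gcongr

theorem lowEnergy_succ_le {v : ℝ} (hv : 0 ≤ v) (s : ℕ → Fin 2) {n N : ℕ} (h : N < n) :
    lowEnergy v s n (N + 1) ≤ lowEnergy v s n N + (v + 2) := by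
  obtain ⟨S, hS, he, -⟩ := exists_lowEnergy v s h.le
  obtain ⟨k, hk⟩ : ∃ k, k ∉ S := by
    by_contra! hall
    have : S = Finset.univ := Finset.eq_univ_of_forall hall
    rw [this, Finset.card_univ, Fintype.card_fin] at hS
    omega
  have := lowEnergy_le v s (insert k S)
  rw [Finset.card_insert_of_notMem hk, Finset.sum_insert hk, hS] at this
  rw [he]
  linarith [(abs_le.mp (abs_levels_le hv s n k)).2]

/-- A version of Fekete's lemma: an almost subadditive periodic function of intervals has a mean
value, uniformly in the position of the interval. -/
theorem exists_uniform_limit (G : ℤ → ℕ → ℝ) {L : ℕ} (hL : 0 < L) {C : ℝ}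
    (hper : ∀ a n, G (a + L) n = G a n)
    (hsub : ∀ a n m, G a (n + m) ≤ G a n + G (a + n) m + C)
    (hbd : ∀ a n, |G a n| ≤ C * n) :
    ∃ e : ℝ, ∀ ε > 0, ∃ n₀ : ℕ, ∀ a n, n₀ ≤ n → |G a n / n - e| ≤ ε := by
  have hC : 0 ≤ C := by have := hbd 0 1; simp at this; exact (abs_nonneg _).trans this
  have hperZ : ∀ (z : ℤ) a n, G (a + L * z) n = G a n := by
    intro z
    induction z using Int.induction_on with
    | zero => simp
    | succ i ih => intro a n; rw [← ih a n, ← hper (a + L * i)]; congr 1; ring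
    | pred i ih => intro a n; rw [← ih a n, ← hper (a + L * (-(i : ℤ) - 1))]; congr 1; ring
  have hL' : (0 : ℝ) < L := by exact_mod_cast hL
  have hL1 : (1 : ℝ) ≤ L := by exact_mod_cast hL
  let g : ℕ → ℝ := fun k => G 0 (k * L) + C
  have hg : Subadditive g := by
    intro k j
    have := hsub 0 (k * L) (j * L)
    have e : G (0 + ((k * L : ℕ) : ℤ)) (j * L) = G 0 (j * L) := by
      rw [← hperZ k 0]; congr 1; push_cast; ring
    rw [e] at this
    simp only [g, add_mul]
    linarith
  have hb : BddBelow (Set.range fun k => g k / k) := by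
    refine ⟨-(C * L), ?_⟩
    rintro _ ⟨k, rfl⟩
    rcases Nat.eq_zero_or_pos k with rfl | hk
    · simp; positivity
    · have hk' : (0 : ℝ) < k := by exact_mod_cast hk
      simp only
      rw [le_div_iff₀ hk']
      have := (abs_le.mp (hbd 0 (k * L))).1
      simp only [g]
      push_cast at this
      nlinarith
  -- Fekete's lemma applies to intervals made of whole periods; other intervals are compared with
  -- the whole periods that they contain, or that contain them
  set l := hg.lim with hl
  have hlim := hg.tendsto_lim hb
  have upper : ∀ a n, L ≤ n → ∃ k : ℕ, |(k : ℝ) * L - n| ≤ 2 * L ∧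
      G a n ≤ g k + (2 * C * L + 2 * C) := by
    intro a n hn
    set r := ((-a) % (L : ℤ)).toNat with hr
    have hLz : (0 : ℤ) < L := by exact_mod_cast hL
    have hr0 : (r : ℤ) = (-a) % L := Int.toNat_of_nonneg (Int.emod_nonneg _ hLz.ne')
    have hrL : (r : ℤ) < L := by rw [hr0]; exact Int.emod_lt_of_pos _ hLz
    have hrL' : r < L := by exact_mod_cast hrL
    have har : a + r = 0 + L * (-((-a) / L)) := by
      have := Int.mul_ediv_add_emod (-a) L
      rw [hr0]; linarith
    set k := (n - r) / L with hk
    set t := (n - r) % L with ht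
    have htL : t < L := Nat.mod_lt _ hL
    have hdm : k * L + t = n - r := by rw [mul_comm]; exact Nat.div_add_mod _ _
    have hn' : n = r + (k * L + t) := by omega
    refine ⟨k, ?_, ?_⟩
    · have hrR : (r : ℝ) < L := by exact_mod_cast hrL'
      have htR : (t : ℝ) < L := by exact_mod_cast htL
      have hr0' : (0 : ℝ) ≤ r := by positivity
      have ht0' : (0 : ℝ) ≤ t := by positivity
      rw [hn']
      push_cast
      rw [abs_le]
      constructor <;> linarith
    · have h1 := hsub a r (k * L + t)
      have h2 := hsub (a + r) (k * L) t
      have h3 : G (a + r) (k * L) = G 0 (k * L) := by rw [har, hperZ]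
      have h4 := (abs_le.mp (hbd a r)).2
      have h5 := (abs_le.mp (hbd (a + r + ((k * L : ℕ) : ℤ)) t)).2
      have hrR : C * (r : ℝ) ≤ C * L := by gcongr
      have htR : C * (t : ℝ) ≤ C * L := by gcongr
      rw [← hn'] at h1
      simp only [g]
      linarith
  have lower : ∀ a n, L ≤ n → ∃ k : ℕ, |(k : ℝ) * L - n| ≤ 2 * L ∧
      g k - (2 * C * L + 3 * C) ≤ G a n := by
    intro a n hn
    set r := (a % (L : ℤ)).toNat with hr
    have hLz : (0 : ℤ) < L := by exact_mod_cast hL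
    have hr0 : (r : ℤ) = a % L := Int.toNat_of_nonneg (Int.emod_nonneg _ hLz.ne')
    have hrL : (r : ℤ) < L := by rw [hr0]; exact Int.emod_lt_of_pos _ hLz
    have hrL' : r < L := by exact_mod_cast hrL
    have har : a - r = 0 + L * (a / L) := by
      have := Int.mul_ediv_add_emod a L
      rw [hr0]; linarith
    obtain ⟨k, t, htL, hn'⟩ : ∃ k t : ℕ, t ≤ L ∧ k * L = r + (n + t) := by
      refine ⟨(n + r) / L + 1, L - (n + r) % L, by omega, ?_⟩
      have h1 := Nat.mod_lt (n + r) hL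
      have h2 := Nat.div_add_mod (n + r) L
      rw [add_mul, mul_comm ((n + r) / L)]
      omega
    refine ⟨k, ?_, ?_⟩
    · have hrR : (r : ℝ) < L := by exact_mod_cast hrL'
      have htR : (t : ℝ) ≤ L := by exact_mod_cast htL
      have hr0' : (0 : ℝ) ≤ r := by positivity
      have ht0' : (0 : ℝ) ≤ t := by positivity
      have : (k : ℝ) * L = r + (n + t) := by exact_mod_cast hn'
      rw [this, abs_le]
      constructor <;> linarith
    · have h1 := hsub (a - r) r (n + t)
      rw [sub_add_cancel] at h1
      have h2 := hsub a n t
      have h3 : G (a - r) (k * L) = G 0 (k * L) := by rw [har, hperZ]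
      have h4 := (abs_le.mp (hbd (a - r) r)).2
      have h5 := (abs_le.mp (hbd (a + n) t)).2
      have hrR : C * (r : ℝ) ≤ C * L := by gcongr
      have htR : C * (t : ℝ) ≤ C * L := by gcongr
      rw [← hn', h3] at h1
      simp only [g]
      linarith
  refine ⟨l / L, fun ε hε => ?_⟩
  obtain ⟨k₀, hk₀⟩ := Metric.tendsto_atTop.mp hlim (ε / 2) (by positivity)
  -- `C2` collects the errors that do not grow with the length
  set C2 := 2 * C * L + 3 * C + 2 * |l| + ε with hC2
  obtain ⟨m, hm⟩ := exists_nat_gt (2 * C2 / ε)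
  refine ⟨m + (k₀ + 3) * L, fun a n hn => ?_⟩
  have hnm : (m : ℝ) ≤ n := by exact_mod_cast le_trans (Nat.le_add_right _ _) hn
  have hnk : ((k₀ : ℝ) + 3) * L ≤ n := by
    exact_mod_cast le_trans (Nat.le_add_left _ _) hn
  have hn0 : (0 : ℝ) < n := lt_of_lt_of_le (by positivity) hnk
  have hnL : L ≤ n := by
    have : (L : ℝ) ≤ n := by nlinarith [show (0 : ℝ) ≤ k₀ by positivity]
    exact_mod_cast this
  have close : ∀ k : ℕ, |(k : ℝ) * L - n| ≤ 2 * L → |g k - l * (n / L)| ≤ ε / 2 * n + ε + 2 * |l| := by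
    intro k hk
    have hkk : |(k : ℝ) - n / L| ≤ 2 := by
      have : (k : ℝ) - n / L = (k * L - n) / L := by field_simp
      rw [this, abs_div, abs_of_pos hL', div_le_iff₀ hL']
      exact hk
    have hk1 : (k₀ : ℝ) + 1 ≤ k := by
      have : (k₀ : ℝ) + 3 ≤ n / L := by rwa [le_div_iff₀ hL']
      linarith [(abs_le.mp hkk).1]
    have hkk0 : k₀ ≤ k := by
      have : (k₀ : ℝ) ≤ k := by linarith
      exact_mod_cast this
    have hkpos : (0 : ℝ) < k := lt_of_lt_of_le (by positivity) hk1
    have h1 := hk₀ k hkk0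
    rw [Real.dist_eq] at h1
    have h2 : |g k - l * k| ≤ ε / 2 * k := by
      have : g k - l * k = (g k / k - l) * k := by field_simp
      rw [this, abs_mul, abs_of_pos hkpos]
      exact mul_le_mul_of_nonneg_right h1.le hkpos.le
    have h3 : (k : ℝ) ≤ n + 2 := by
      have : (n : ℝ) / L ≤ n := div_le_self hn0.le hL1
      linarith [(abs_le.mp hkk).2]
    have h4 : |l * k - l * (n / L)| ≤ 2 * |l| := by
      rw [← mul_sub, abs_mul, mul_comm]
      exact mul_le_mul_of_nonneg_right hkk (abs_nonneg _)
    calc |g k - l * (n / L)| = |(g k - l * k) + (l * k - l * (n / L))| := by ring_nf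
      _ ≤ |g k - l * k| + |l * k - l * (n / L)| := abs_add_le _ _
      _ ≤ ε / 2 * k + 2 * |l| := add_le_add h2 h4
      _ ≤ ε / 2 * (n + 2) + 2 * |l| := by gcongr
      _ = _ := by ring
  obtain ⟨k, hk, hup⟩ := upper a n hnL
  obtain ⟨k', hk', hlow⟩ := lower a n hnL
  have hu := abs_le.mp (close k hk)
  have hd := abs_le.mp (close k' hk')
  have hC2n : C2 ≤ ε / 2 * n := by
    have := (div_lt_iff₀ hε).mp (hm.trans_le hnm)
    linarith
  have e : G a n / n - l / L = (G a n - l * (n / L)) / n := by field_simp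
  rw [e, abs_div, abs_of_pos hn0, div_le_iff₀ hn0, abs_le]
  constructor <;> linarith

theorem streamAt_add (ω : Config) (a : ℤ) (n : ℕ) :
    streamAt ω (a + n) = fun k => streamAt ω a (n + k) := by
  funext k
  simp only [streamAt]
  congr 1
  push_cast
  ring

theorem streamAt_add_period {ω : Config} {n : ℤ} (h : ∀ x, ω (x + n) = ω x) (a : ℤ) :
    streamAt ω (a + n) = streamAt ω a := by
  funext k
  simp only [streamAt]
  rw [← h (a + k)]
  congr 1
  ring

theorem floor_mul_le {ρ : ℝ} (hρ : ρ ∈ Set.Icc (0 : ℝ) 1) (n : ℕ) : ⌊ρ * n⌋₊ ≤ n := by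
  refine Nat.floor_le_of_le ?_
  have : (0 : ℝ) ≤ n := by positivity
  nlinarith [hρ.2]

theorem energyPerSite_box (v : ℝ) {ρ : ℝ} (hρ : ρ ∈ Set.Icc (0 : ℝ) 1) (ω : Config) (a : ℤ)
    (n : ℕ) : energyPerSite (2 * v) ρ ω (Finset.Icc a (a + n - 1)) =
      lowEnergy v (streamAt ω a) n ⌊ρ * n⌋₊ / n - v * (⌊ρ * n⌋₊ / n) := by
  have hc : (Finset.Icc a (a + n - 1)).card = n := by simp
  rw [energyPerSite, hc, groundEnergy_box v ω a (floor_mul_le hρ n)]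
  ring

theorem eventually_boxes_large (n₀ : ℕ) :
    ∀ᶠ ab : ℤ × ℤ in boxes, ∃ n : ℕ, n₀ ≤ n ∧ 0 < n ∧ ab.2 = ab.1 + n - 1 := by
  have h1 : ∀ᶠ a : ℤ in atBot, a ≤ 0 := eventually_le_atBot 0
  have h2 : ∀ᶠ b : ℤ in atTop, (n₀ : ℤ) ≤ b := eventually_ge_atTop _
  filter_upwards [h1.prod_mk h2] with ab hab
  exact ⟨(ab.2 - ab.1 + 1).toNat, by omega, by omega, by omega⟩

/-- Convergence along the boxes follows from convergence that is uniform in the position. -/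
theorem tendsto_boxes_of_uniform {F : Finset ℤ → ℝ} {e : ℝ}
    (h : ∀ ε > 0, ∃ n₀ : ℕ, ∀ (a : ℤ) (n : ℕ), n₀ ≤ n →
      |F (Finset.Icc a (a + n - 1)) - e| ≤ ε) :
    Tendsto (fun ab => F (box ab)) boxes (𝓝 e) := by
  rw [Metric.tendsto_nhds]
  intro ε hε
  obtain ⟨n₀, hn₀⟩ := h (ε / 2) (by positivity)
  filter_upwards [eventually_boxes_large n₀] with ab hab
  obtain ⟨n, hn, -, hab⟩ := hab
  rw [Real.dist_eq, box, hab]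
  exact (hn₀ ab.1 n hn).trans_lt (by linarith)

theorem floor_div_near {ρ : ℝ} (hρ : 0 ≤ ρ) {n : ℕ} (hn : 0 < n) :
    |(⌊ρ * n⌋₊ : ℝ) / n - ρ| ≤ 1 / n := by
  have hn' : (0 : ℝ) < n := by exact_mod_cast hn
  have h1 := Nat.floor_le (mul_nonneg hρ hn'.le)
  have h2 := Nat.lt_floor_add_one (ρ * n)
  have e : (⌊ρ * n⌋₊ : ℝ) / n - ρ = (⌊ρ * n⌋₊ - ρ * n) / n := by field_simp
  rw [e, abs_div, abs_of_pos hn', div_le_div_iff_of_pos_right hn', abs_le]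
  constructor <;> linarith

/-- The energy per site converges: up to a bounded error it is subadditive, the error coming from
the one electron that may be lost in rounding. -/
theorem exists_tendsto_energyPerSite {v : ℝ} (hv : 0 ≤ v) {ω : Config} (hω : IsPeriodic ω)
    {ρ : ℝ} (hρ : ρ ∈ Set.Icc (0 : ℝ) 1) :
    ∃ e, Tendsto (fun ab => energyPerSite (2 * v) ρ ω (box ab)) boxes (𝓝 e) := by
  obtain ⟨L, hL, hper⟩ := hω
  lift L to ℕ using hL.le
  have hL' : 0 < L := by exact_mod_cast hL
  obtain ⟨e, he⟩ := exists_uniform_limit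
    (fun a n => lowEnergy v (streamAt ω a) n ⌊ρ * n⌋₊) hL' (C := v + 2)
    (fun a n => by simp only [streamAt_add_period hper])
    (fun a n m => by
      have h1 := lowEnergy_add_le v (streamAt ω a) (floor_mul_le hρ n) (floor_mul_le hρ m)
      rw [← streamAt_add] at h1
      have f0 := floor_mul_le hρ (n + m)
      have hn : 0 ≤ ρ * n := mul_nonneg hρ.1 (by positivity)
      have hm : 0 ≤ ρ * m := mul_nonneg hρ.1 (by positivity)
      have f1 : ⌊ρ * n⌋₊ + ⌊ρ * m⌋₊ ≤ ⌊ρ * ((n + m : ℕ) : ℝ)⌋₊ := by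
        rw [Nat.le_floor_iff (mul_nonneg hρ.1 (by positivity))]
        push_cast
        linarith [Nat.floor_le hn, Nat.floor_le hm]
      have f2 : ⌊ρ * ((n + m : ℕ) : ℝ)⌋₊ < ⌊ρ * n⌋₊ + ⌊ρ * m⌋₊ + 2 := by
        rw [Nat.floor_lt (mul_nonneg hρ.1 (by positivity))]
        push_cast
        linarith [Nat.lt_floor_add_one (ρ * n), Nat.lt_floor_add_one (ρ * m)]
      rcases (show ⌊ρ * ((n + m : ℕ) : ℝ)⌋₊ = ⌊ρ * n⌋₊ + ⌊ρ * m⌋₊ ∨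
        ⌊ρ * ((n + m : ℕ) : ℝ)⌋₊ = ⌊ρ * n⌋₊ + ⌊ρ * m⌋₊ + 1 by omega) with h | h
      · rw [h]; linarith
      · rw [h]
        have := lowEnergy_succ_le hv (streamAt ω a) (n := n + m)
          (N := ⌊ρ * n⌋₊ + ⌊ρ * m⌋₊) (by omega)
        linarith)
    (fun a n => abs_lowEnergy_le hv _ (floor_mul_le hρ n))
  refine ⟨e - v * ρ, tendsto_boxes_of_uniform fun ε hε => ?_⟩
  obtain ⟨n₀, hn₀⟩ := he (ε / 2) (by positivity)
  obtain ⟨n₁, hn₁⟩ := exists_nat_gt (2 * v / ε)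
  refine ⟨max n₀ (n₁ + 1), fun a n hn => ?_⟩
  have hn0 : 0 < n := by omega
  have hn' : (0 : ℝ) < n := by exact_mod_cast hn0
  have h1 := hn₀ a n (le_trans (le_max_left _ _) hn)
  have h2 := floor_div_near hρ.1 hn0
  have h3 : (n₁ : ℝ) ≤ n := by exact_mod_cast (by omega : n₁ ≤ n)
  have h4 : v * (1 / n) ≤ ε / 2 := by
    rw [mul_one_div, div_le_iff₀ hn']
    have := (div_lt_iff₀ hε).mp (hn₁.trans_le h3)
    linarith
  rw [energyPerSite_box v hρ]
  have e1 : ∀ x y : ℝ, x - v * y - (e - v * ρ) = (x - e) - v * (y - ρ) := fun x y => by ring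
  rw [e1]
  refine (abs_sub _ _).trans ?_
  rw [abs_mul, abs_of_nonneg hv]
  have := mul_le_mul_of_nonneg_left h2 hv
  linarith

/-! ### Determinants of chains and the total energy of the filled band -/

/-- The configuration without its first site. -/
def shift (s : ℕ → Fin 2) : ℕ → Fin 2 := fun k => s (k + 1)

/-- The diagonal entry of the chain matrix at the imaginary spectral parameter `i y`. -/
def siteTerm (v y : ℝ) (a : Fin 2) : ℂ := siteEnergy v a + y * Complex.I

/-- The continuant: the determinant of the first `n` sites of the chain at the spectral
parameter `i y`, defined by its three term recursion. -/
def continuant (v y : ℝ) : ℕ → (ℕ → Fin 2) → ℂ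
  | 0, _ => 1
  | 1, s => siteTerm v y (s 0)
  | n + 2, s => siteTerm v y (s 0) * continuant v y (n + 1) (shift s) -
      continuant v y n (shift (shift s))

/-- Expansion of the determinant along the first row. -/
theorem det_chain (v y : ℝ) (n : ℕ) (s : ℕ → Fin 2) :
    (chain v s n + Matrix.scalar (Fin n) ((y : ℂ) * Complex.I)).det = continuant v y n s := by
  induction n using Nat.strong_induction_on generalizing s with
  | _ n ih =>
    match n, ih with
    | 0, _ => simp [continuant]
    | 1, _ => simp [continuant, chain, siteTerm]
    | n + 2, ih =>
      set B := chain v s (n + 2) + Matrix.scalar (Fin (n + 2)) ((y : ℂ) * Complex.I) with hB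
      have hsub : B.submatrix Fin.succ Fin.succ =
          chain v (shift s) (n + 1) + Matrix.scalar (Fin (n + 1)) ((y : ℂ) * Complex.I) := by
        ext i j
        simp [hB, chain, shift, Matrix.diagonal_apply]
      have hsub2 : (B.submatrix Fin.succ Fin.succ).submatrix Fin.succ Fin.succ =
          chain v (shift (shift s)) n + Matrix.scalar (Fin n) ((y : ℂ) * Complex.I) := by
        rw [hsub]
        ext i j
        simp [chain, shift, Matrix.diagonal_apply]
      rw [Matrix.det_succ_row_zero, Fin.sum_univ_succ, Fin.sum_univ_succ]
      have hz : ∀ j : Fin n, B 0 j.succ.succ = 0 := by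
        intro j
        simp [hB, chain, Fin.ext_iff]
      have h00 : B 0 0 = siteTerm v y (s 0) := by simp [hB, chain, siteTerm]
      have h01 : B 0 (Fin.succ 0) = -1 := by
        simp [hB, chain]
      have h1 : (B.submatrix Fin.succ (Fin.succAbove (Fin.succ 0))).det =
          -continuant v y n (shift (shift s)) := by
        rw [Matrix.det_succ_column_zero, Fin.sum_univ_succ]
        have hz' : ∀ i : Fin n, B i.succ.succ 0 = 0 := by
          intro i
          simp [hB, chain, Fin.ext_iff]
        have hm : B.submatrix Fin.succ (Fin.succAbove (Fin.succ 0)) 0 0 = -1 := by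
          simp [hB, chain, Fin.succAbove]
        have hs : (B.submatrix Fin.succ (Fin.succAbove (Fin.succ 0))).submatrix
            (Fin.succAbove 0) Fin.succ =
            (B.submatrix Fin.succ Fin.succ).submatrix Fin.succ Fin.succ := by
          ext i j
          simp
        rw [hs, hsub2, ih n (by omega), hm]
        simp [hz']
      rw [h1, h00, h01, Fin.succAbove_zero, hsub, ih (n + 1) (by omega)]
      simp [hz, continuant]
      ring

theorem continuant_eq_prod_levels (v y : ℝ) (n : ℕ) (s : ℕ → Fin 2) :
    continuant v y n s = ∏ k, ((levels v s n k : ℂ) + y * Complex.I) := by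
  have h := (chain_isHermitian v s n).charpoly_eq
  have h2 := congrArg (Polynomial.eval (-((y : ℂ) * Complex.I))) h
  rw [Matrix.eval_charpoly, Polynomial.eval_prod] at h2
  have e : Matrix.scalar (Fin n) (-((y : ℂ) * Complex.I)) - chain v s n =
      -(chain v s n + Matrix.scalar (Fin n) ((y : ℂ) * Complex.I)) := by
    rw [map_neg]; abel
  rw [e, Matrix.det_neg, det_chain] at h2
  have e2 : ∀ k, Polynomial.eval (-((y : ℂ) * Complex.I))
      (Polynomial.X - Polynomial.C (((chain_isHermitian v s n).eigenvalues k : ℝ) : ℂ)) =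
      (-1) * ((levels v s n k : ℂ) + y * Complex.I) := by
    intro k
    simp [levels]
    ring
  simp only [Complex.coe_algebraMap] at h2
  rw [Finset.prod_congr rfl fun k _ => e2 k, Finset.prod_mul_distrib] at h2
  simp only [Finset.prod_const, Finset.card_univ] at h2
  exact mul_left_cancel₀ (pow_ne_zero _ (by norm_num)) h2

theorem normSq_continuant (v y : ℝ) (n : ℕ) (s : ℕ → Fin 2) :
    Complex.normSq (continuant v y n s) = ∏ k, (levels v s n k ^ 2 + y ^ 2) := by
  rw [continuant_eq_prod_levels, map_prod]
  refine Finset.prod_congr rfl fun k _ => ?_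
  rw [Complex.normSq_add_mul_I]

theorem abs_log_sub_log_le {a b m : ℝ} (hm : 0 < m) (ha : m ≤ a) (hb : m ≤ b) :
    |Real.log a - Real.log b| ≤ |a - b| / m := by
  have ha0 : 0 < a := hm.trans_le ha
  have hb0 : 0 < b := hm.trans_le hb
  have key : ∀ {a b : ℝ}, m ≤ a → m ≤ b → Real.log a - Real.log b ≤ |a - b| / m := by
    intro a b ha hb
    have ha0 : 0 < a := hm.trans_le ha
    have hb0 : 0 < b := hm.trans_le hb
    rw [← Real.log_div ha0.ne' hb0.ne']
    refine (Real.log_le_sub_one_of_pos (div_pos ha0 hb0)).trans ?_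
    have : a / b - 1 = (a - b) / b := by field_simp
    rw [this]
    calc (a - b) / b ≤ |a - b| / b := by gcongr; exact le_abs_self _
      _ ≤ |a - b| / m := by gcongr
  rw [abs_le]
  constructor
  · have := key hb ha
    rw [abs_sub_comm] at this
    linarith
  · exact key ha hb

theorem integrable_inv_sq_add_sq {m : ℝ} (hm : 0 < m) :
    MeasureTheory.Integrable fun y : ℝ => (m ^ 2 + y ^ 2)⁻¹ := by
  have := (integrable_inv_one_add_sq.comp_mul_left' (inv_ne_zero hm.ne')).const_mul (m ^ 2)⁻¹
  refine this.congr (Filter.Eventually.of_forall fun y => ?_)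
  simp only
  field_simp

theorem abs_logRatio_le {l v : ℝ} (hl : 0 < l) (hv : 0 < v) (y : ℝ) :
    |Real.log (l ^ 2 + y ^ 2) - Real.log (v ^ 2 + y ^ 2)| ≤
      |l ^ 2 - v ^ 2| * ((min l v) ^ 2 + y ^ 2)⁻¹ := by
  have hm : 0 < min l v := lt_min hl hv
  have := abs_log_sub_log_le (a := l ^ 2 + y ^ 2) (b := v ^ 2 + y ^ 2)
    (m := (min l v) ^ 2 + y ^ 2) (by positivity)
    (by gcongr; exact min_le_left _ _) (by gcongr; exact min_le_right _ _)
  rw [← div_eq_mul_inv]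
  convert this using 3
  ring

theorem integrable_logRatio {l v : ℝ} (hl : 0 < l) (hv : 0 < v) :
    MeasureTheory.Integrable fun y : ℝ => Real.log (l ^ 2 + y ^ 2) - Real.log (v ^ 2 + y ^ 2) := by
  refine ((integrable_inv_sq_add_sq (lt_min hl hv)).const_mul |l ^ 2 - v ^ 2|).mono' ?_
    (Filter.Eventually.of_forall fun y => abs_logRatio_le hl hv y)
  refine Continuous.aestronglyMeasurable ?_
  refine Continuous.sub ?_ ?_ <;>
  · refine Continuous.log (by fun_prop) fun y => ?_
    positivity

/-- `∫ log ((l² + y²) / (v² + y²)) dy = 2 π (l - v)`, by an explicit primitive. -/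
theorem integral_logRatio {l v : ℝ} (hl : 0 < l) (hv : 0 < v) :
    ∫ y : ℝ, (Real.log (l ^ 2 + y ^ 2) - Real.log (v ^ 2 + y ^ 2)) = 2 * Real.pi * (l - v) := by
  let F : ℝ → ℝ := fun y => y * (Real.log (l ^ 2 + y ^ 2) - Real.log (v ^ 2 + y ^ 2)) +
    (2 * l * Real.arctan (y / l) - 2 * v * Real.arctan (y / v))
  have hF : ∀ y, HasDerivAt F (Real.log (l ^ 2 + y ^ 2) - Real.log (v ^ 2 + y ^ 2)) y := by
    intro y
    have d0 : ∀ c : ℝ, HasDerivAt (fun y : ℝ => c ^ 2 + y ^ 2) (2 * y) y := by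
      intro c
      simpa using (hasDerivAt_pow 2 y).const_add (c ^ 2)
    have d1 : ∀ c : ℝ, 0 < c → HasDerivAt (fun y : ℝ => Real.log (c ^ 2 + y ^ 2))
        (2 * y / (c ^ 2 + y ^ 2)) y := fun c hc => (d0 c).log (by positivity)
    have d2 : ∀ c : ℝ, 0 < c → HasDerivAt (fun y : ℝ => 2 * c * Real.arctan (y / c))
        (2 * c * (1 / (1 + (y / c) ^ 2) * (1 / c))) y := fun c hc =>
      (((hasDerivAt_id y).div_const c).arctan).const_mul _
    have := ((hasDerivAt_id y).mul ((d1 l hl).sub (d1 v hv))).add ((d2 l hl).sub (d2 v hv))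
    refine this.congr_deriv ?_
    simp only [id, Pi.sub_apply]
    field_simp
    ring
  -- the first term of the primitive vanishes at both ends, the arctangents give the value
  have hlim : ∀ f : Filter ℝ, Tendsto (fun y : ℝ => |y|) f atTop →
      Tendsto (fun y => y * (Real.log (l ^ 2 + y ^ 2) - Real.log (v ^ 2 + y ^ 2))) f (𝓝 0) := by
    intro f hf
    have h0 : Tendsto (fun y : ℝ => |l ^ 2 - v ^ 2| * |y|⁻¹) f (𝓝 0) := by
      simpa using (tendsto_inv_atTop_zero.comp hf).const_mul |l ^ 2 - v ^ 2|
    refine squeeze_zero_norm' ?_ h0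
    filter_upwards [hf.eventually_gt_atTop 0] with y hy
    rw [Real.norm_eq_abs, abs_mul]
    have hm : 0 < min l v := lt_min hl hv
    calc |y| * |Real.log (l ^ 2 + y ^ 2) - Real.log (v ^ 2 + y ^ 2)|
        ≤ |y| * (|l ^ 2 - v ^ 2| * ((min l v) ^ 2 + y ^ 2)⁻¹) := by
          gcongr; exact abs_logRatio_le hl hv y
      _ ≤ |y| * (|l ^ 2 - v ^ 2| * (y ^ 2)⁻¹) := by
          have : 0 < y ^ 2 := by rw [← sq_abs]; positivity
          gcongr
          linarith [sq_nonneg (min l v)]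
      _ = |l ^ 2 - v ^ 2| * |y|⁻¹ := by
          rw [← sq_abs y]; field_simp
  have atop : ∀ c : ℝ, 0 < c → Tendsto (fun y : ℝ => 2 * c * Real.arctan (y / c)) atTop
      (𝓝 (2 * c * (Real.pi / 2))) := fun c hc =>
    ((tendsto_nhds_of_tendsto_nhdsWithin Real.tendsto_arctan_atTop).comp
      (tendsto_id.atTop_div_const hc)).const_mul _
  have abot : ∀ c : ℝ, 0 < c → Tendsto (fun y : ℝ => 2 * c * Real.arctan (y / c)) atBot
      (𝓝 (2 * c * (-(Real.pi / 2)))) := fun c hc =>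
    ((tendsto_nhds_of_tendsto_nhdsWithin Real.tendsto_arctan_atBot).comp
      (tendsto_id.atBot_div_const hc)).const_mul _
  rw [MeasureTheory.integral_of_hasDerivAt_of_tendsto hF (integrable_logRatio hl hv)
    ((hlim _ tendsto_abs_atBot_atTop).add ((abot l hl).sub (abot v hv)))
    ((hlim _ tendsto_abs_atTop_atTop).add ((atop l hl).sub (atop v hv)))]
  ring

/-- `∑ |λ| - n v`, the shift of the absolute values of the levels caused by the hopping, as an
integral of the logarithm of the continuant. -/
noncomputable def bandShift (v : ℝ) (s : ℕ → Fin 2) (n : ℕ) : ℝ :=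
  (2 * Real.pi)⁻¹ * ∫ y : ℝ, (Real.log (Complex.normSq (continuant v y n s)) -
    n * Real.log (v ^ 2 + y ^ 2))

theorem abs_levels_pos {v : ℝ} (hv : 2 < v) (s : ℕ → Fin 2) (n : ℕ) (k : Fin n) :
    0 < |levels v s n k| := by
  rw [abs_pos]
  intro h0
  rcases levels_near v s n k with h | h <;> rw [h0, abs_le] at h <;> linarith

theorem log_normSq_continuant {v : ℝ} (hv : 2 < v) (s : ℕ → Fin 2) (n : ℕ) (y : ℝ) :
    Real.log (Complex.normSq (continuant v y n s)) - n * Real.log (v ^ 2 + y ^ 2) =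
      ∑ k, (Real.log (|levels v s n k| ^ 2 + y ^ 2) - Real.log (v ^ 2 + y ^ 2)) := by
  rw [normSq_continuant, Real.log_prod]
  · simp [sq_abs]
  · intro k _
    have := abs_levels_pos hv s n k
    rw [← sq_abs]
    positivity

theorem integrable_bandShift {v : ℝ} (hv : 2 < v) (s : ℕ → Fin 2) (n : ℕ) :
    MeasureTheory.Integrable fun y : ℝ => Real.log (Complex.normSq (continuant v y n s)) -
      n * Real.log (v ^ 2 + y ^ 2) := by
  simp only [log_normSq_continuant hv]
  exact MeasureTheory.integrable_finsetSum _ fun k _ =>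
    integrable_logRatio (abs_levels_pos hv s n k) (by linarith)

theorem bandShift_eq {v : ℝ} (hv : 2 < v) (s : ℕ → Fin 2) (n : ℕ) :
    bandShift v s n = ∑ k, |levels v s n k| - n * v := by
  unfold bandShift
  simp only [log_normSq_continuant hv]
  rw [MeasureTheory.integral_finsetSum _ fun k _ =>
    integrable_logRatio (abs_levels_pos hv s n k) (by linarith)]
  have : ∀ k, ∫ y : ℝ, (Real.log (|levels v s n k| ^ 2 + y ^ 2) - Real.log (v ^ 2 + y ^ 2)) =
      2 * Real.pi * (|levels v s n k| - v) := fun k =>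
    integral_logRatio (abs_levels_pos hv s n k) (by linarith)
  simp only [this]
  rw [← Finset.mul_sum, ← mul_assoc, inv_mul_cancel₀ (by positivity), one_mul,
    Finset.sum_sub_distrib]
  simp

/-- The number of classical particles on the first `n` sites. -/
def numOnes (s : ℕ → Fin 2) (n : ℕ) : ℕ := ∑ k ∈ Finset.range n, (s k : ℕ)

theorem siteEnergy_eq (v : ℝ) (a : Fin 2) : siteEnergy v a = v - 2 * v * (a : ℕ) := by
  unfold siteEnergy
  fin_cases a <;> simp
  ring

theorem sum_levels (v : ℝ) (s : ℕ → Fin 2) (n : ℕ) :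
    ∑ k, levels v s n k = n * v - 2 * v * numOnes s n := by
  have h := (chain_isHermitian v s n).trace_eq_sum_eigenvalues
  have e : (chain v s n).trace = ((n * v - 2 * v * numOnes s n : ℝ) : ℂ) := by
    have e1 : (n * v - 2 * v * numOnes s n : ℝ) = ∑ k : Fin n, siteEnergy v (s k) := by
      simp only [siteEnergy_eq, Finset.sum_sub_distrib, ← Finset.mul_sum, numOnes,
        Finset.sum_range]
      simp
    rw [e1]
    simp [Matrix.trace, chain]
  rw [e] at h
  have h' : ((n * v - 2 * v * numOnes s n : ℝ) : ℂ) =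
      ((∑ k, levels v s n k : ℝ) : ℂ) := by rw [h]; push_cast; rfl
  exact_mod_cast h'.symm

theorem sum_min_levels {v : ℝ} (hv : 2 < v) (s : ℕ → Fin 2) (n : ℕ) :
    ∑ k, min (levels v s n k) 0 = -v * numOnes s n - bandShift v s n / 2 := by
  have h : ∀ x : ℝ, min x 0 = (x - |x|) / 2 := by
    intro x
    rcases le_total x 0 with h | h
    · rw [min_eq_left h, abs_of_nonpos h]; ring
    · rw [min_eq_right h, abs_of_nonneg h]; ring
  simp only [h]
  rw [← Finset.sum_div, Finset.sum_sub_distrib, sum_levels, bandShift_eq hv]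
  ring

theorem le_lowEnergy {v : ℝ} (hv : 2 < v) (s : ℕ → Fin 2) {n N : ℕ} (h : N ≤ n) :
    -v * numOnes s n - bandShift v s n / 2 ≤ lowEnergy v s n N := by
  obtain ⟨S, -, he, -⟩ := exists_lowEnergy v s h
  rw [he, ← sum_min_levels hv, ← Finset.sum_add_sum_compl S]
  have h1 : ∑ k ∈ S, min (levels v s n k) 0 ≤ ∑ k ∈ S, levels v s n k :=
    Finset.sum_le_sum fun k _ => min_le_left _ _
  have h2 : ∑ k ∈ Sᶜ, min (levels v s n k) 0 ≤ 0 :=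
    Finset.sum_nonpos fun k _ => min_le_right _ _
  linarith

theorem card_le_of_combination_injective {ι κ : Type*} (v : κ → ι → ℂ) (T : Finset κ)
    (O : Finset ι) (hinj : ∀ c : T → ℂ, (∀ x ∈ O, ∑ k, c k * v k x = 0) → c = 0) :
    T.card ≤ O.card := by
  let f : (T → ℂ) →ₗ[ℂ] (O → ℂ) := (Matrix.of fun (x : O) (k : T) => v k x).mulVecLin
  have hf : Function.Injective f := by
    rw [← LinearMap.ker_eq_bot, LinearMap.ker_eq_bot']
    intro c hc
    refine hinj c fun x hx => ?_
    have := congrFun hc ⟨x, hx⟩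
    simpa [f, Matrix.mulVec, dotProduct, mul_comm] using this
  simpa using LinearMap.finrank_le_finrank_of_injective hf

/-- Hopping changes the quadratic form of the potential by at most `2 ‖w‖²`. -/
theorem abs_quadraticForm_sub_le (v : ℝ) (s : ℕ → Fin 2) (n : ℕ) (w : Fin n → ℂ) :
    |(∑ x, ∑ y, (starRingEnd ℂ) (w x) * (chain v s n x y * w y)).re -
      ∑ x : Fin n, siteEnergy v (s x) * Complex.normSq (w x)| ≤ 2 * ∑ x, Complex.normSq (w x) := by
  have e : (∑ x, ∑ y, (starRingEnd ℂ) (w x) * (chain v s n x y * w y)) =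
      (∑ x, ∑ y, (starRingEnd ℂ) (w x) * (chain 0 s n x y * w y)) +
        ((∑ x : Fin n, siteEnergy v (s x) * Complex.normSq (w x) : ℝ) : ℂ) := by
    push_cast
    rw [← Finset.sum_add_distrib]
    refine Finset.sum_congr rfl fun x _ => ?_
    have e1 : ∀ y, (starRingEnd ℂ) (w x) * (chain v s n x y * w y) =
        (starRingEnd ℂ) (w x) * (chain 0 s n x y * w y) +
          if x = y then siteEnergy v (s x) * ((starRingEnd ℂ) (w x) * w x) else 0 := by
      intro y
      by_cases h : x = y
      · subst h
        simp [chain, siteEnergy_eq 0]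
        ring
      · simp [chain, h]
    simp only [e1, Finset.sum_add_distrib, Finset.sum_ite_eq, Finset.mem_univ, if_true,
      Complex.normSq_eq_conj_mul_self]
  rw [e, Complex.add_re, Complex.ofReal_re, add_sub_cancel_right,
    (isEigensystem_chain 0 s n).quadraticForm, Complex.ofReal_re,
    ← (isEigensystem_chain 0 s n).parseval w, Finset.mul_sum]
  refine (Finset.abs_sum_le_sum_abs _ _).trans (Finset.sum_le_sum fun k _ => ?_)
  rw [abs_mul, abs_of_nonneg (Complex.normSq_nonneg _)]
  refine mul_le_mul_of_nonneg_right ?_ (Complex.normSq_nonneg _)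
  have := abs_levels_le le_rfl s n k
  simpa using this

theorem IsEigensystem.coeff_combination {ι κ : Type*} [Fintype ι] [Fintype κ] [DecidableEq ι]
    [DecidableEq κ] {h : Matrix ι ι ℂ} {v : κ → ι → ℂ} {ev : κ → ℝ} (H : IsEigensystem h v ev)
    (T : Finset κ) (c : T → ℂ) (k : κ) :
    ∑ x, (starRingEnd ℂ) (v k x) * ∑ l, c l * v l x = if h : k ∈ T then c ⟨k, h⟩ else 0 := by
  simp only [Finset.mul_sum]
  rw [Finset.sum_comm]
  have : ∀ l : T, ∑ x, (starRingEnd ℂ) (v k x) * (c l * v l x) = if k = l then c l else 0 := by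
    intro l
    have e : ∀ x, (starRingEnd ℂ) (v k x) * (c l * v l x) =
        c l * ((starRingEnd ℂ) (v k x) * v l x) := fun x => by ring
    simp only [e, ← Finset.mul_sum, H.orth]
    simp
  simp only [this]
  split_ifs with hk
  · rw [Finset.sum_eq_single ⟨k, hk⟩]
    · simp
    · intro l _ hl
      rw [if_neg]
      rintro rfl
      exact hl rfl
    · simp
  · refine Finset.sum_eq_zero fun l _ => if_neg ?_
    rintro rfl
    exact hk l.2

/-- There are at most as many negative levels as occupied sites, and at most as many positive
levels as empty sites. -/
theorem card_levels_le {v : ℝ} (hv : 2 < v) (s : ℕ → Fin 2) (n : ℕ) (a : Fin 2) (T : Finset (Fin n))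
    (hT : ∀ k ∈ T, siteEnergy 1 a * levels v s n k ≥ 0) :
    T.card ≤ (Finset.univ.filter fun x : Fin n => s x = a).card := by
  -- a combination of these levels that vanishes on the sites occupied by `a` would have a
  -- potential energy of the other sign and of size `v ‖w‖²`, which the hopping cannot compensate
  refine card_le_of_combination_injective (orbitals v s n) T _ fun c hc => ?_
  have H := isEigensystem_chain v s n
  set w : Fin n → ℂ := fun x => ∑ k, c k * orbitals v s n k x with hw
  have hq := abs_quadraticForm_sub_le v s n w
  rw [H.quadraticForm, Complex.ofReal_re] at hq
  have hco : ∀ k, ∑ y, (starRingEnd ℂ) (orbitals v s n k y) * w y =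
      if h : k ∈ T then c ⟨k, h⟩ else 0 := fun k => H.coeff_combination T c k
  have hpot : ∑ x : Fin n, siteEnergy v (s x) * Complex.normSq (w x) =
      -(siteEnergy 1 a) * v * ∑ x, Complex.normSq (w x) := by
    rw [Finset.mul_sum]
    refine Finset.sum_congr rfl fun x _ => ?_
    by_cases hx : s x = a
    · have : w x = 0 := hc x (by simp [hx])
      simp [this]
    · have hx' : siteEnergy v (s x) = -(siteEnergy 1 a) * v := by
        unfold siteEnergy
        have h01 : (s x = 0 ∧ a = 1) ∨ (s x = 1 ∧ a = 0) := by
          revert hx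
          generalize s x = t
          fin_cases t <;> fin_cases a <;> simp
        rcases h01 with ⟨h1, h2⟩ | ⟨h1, h2⟩ <;> simp [h1, h2]
      rw [hx']
  have hpos : 0 ≤ siteEnergy 1 a * ∑ k, levels v s n k *
      Complex.normSq (∑ y, (starRingEnd ℂ) (orbitals v s n k y) * w y) := by
    rw [Finset.mul_sum]
    refine Finset.sum_nonneg fun k _ => ?_
    rw [← mul_assoc, hco]
    split_ifs with hk
    · exact mul_nonneg (hT k hk) (Complex.normSq_nonneg _)
    · simp
  have hn0 : 0 ≤ ∑ x, Complex.normSq (w x) := Finset.sum_nonneg fun _ _ => Complex.normSq_nonneg _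
  have hzero : ∑ x, Complex.normSq (w x) = 0 := by
    rw [hpot] at hq
    have h1 := abs_le.mp hq
    have ha : siteEnergy 1 a = 1 ∨ siteEnergy 1 a = -1 := by
      unfold siteEnergy; split_ifs <;> simp
    rcases ha with ha | ha <;> rw [ha] at h1 hpos <;> nlinarith [h1.1, h1.2]
  have hw0 : ∀ x, w x = 0 := fun x =>
    Complex.normSq_eq_zero.mp ((Finset.sum_eq_zero_iff_of_nonneg
      fun _ _ => Complex.normSq_nonneg _).mp hzero x (Finset.mem_univ x))
  funext k
  have := hco k
  rw [dif_pos k.2] at this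
  simp only [hw0, mul_zero, Finset.sum_const_zero] at this
  exact this.symm

theorem card_filter_one (s : ℕ → Fin 2) (n : ℕ) :
    (Finset.univ.filter fun x : Fin n => s x = 1).card = numOnes s n := by
  rw [Finset.card_filter, numOnes, Finset.sum_range]
  refine Finset.sum_congr rfl fun x _ => ?_
  generalize s x = t
  fin_cases t <;> simp

theorem numOnes_le (s : ℕ → Fin 2) (n : ℕ) : numOnes s n ≤ n := by
  rw [← card_filter_one]
  simpa using Finset.card_le_univ (Finset.univ.filter fun x : Fin n => s x = 1)

/-- In a neutral chain the electrons fill exactly the negative levels. -/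
theorem lowEnergy_numOnes {v : ℝ} (hv : 2 < v) (s : ℕ → Fin 2) (n : ℕ) :
    lowEnergy v s n (numOnes s n) = -v * numOnes s n - bandShift v s n / 2 := by
  refine le_antisymm ?_ (le_lowEnergy hv s (numOnes_le s n))
  set T := Finset.univ.filter fun k : Fin n => levels v s n k < 0 with hT
  have h1 : T.card ≤ numOnes s n := by
    rw [← card_filter_one]
    refine card_levels_le hv s n 1 T fun k hk => ?_
    have := (Finset.mem_filter.mp hk).2
    simp only [siteEnergy, if_true]
    linarith
  have h2 : Tᶜ.card ≤ (Finset.univ.filter fun x : Fin n => s x = 0).card := by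
    refine card_levels_le hv s n 0 Tᶜ fun k hk => ?_
    have : ¬ levels v s n k < 0 := by simpa [hT] using hk
    simp only [siteEnergy, zero_ne_one, if_false]
    linarith
  have h3 : (Finset.univ.filter fun x : Fin n => s x = 0).card + numOnes s n = n := by
    rw [← card_filter_one]
    have : (Finset.univ.filter fun x : Fin n => s x = 1) =
        Finset.univ.filter fun x : Fin n => ¬ s x = 0 := by
      ext x
      simp only [Finset.mem_filter, Finset.mem_univ, true_and]
      generalize s x = t
      fin_cases t <;> simp
    rw [this, Finset.card_filter_add_card_filter_not]
    simp
  have h4 : T.card + Tᶜ.card = n := by rw [Finset.card_add_card_compl]; simp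
  have h5 : T.card = numOnes s n := by omega
  rw [← sum_min_levels hv, ← h5]
  refine (lowEnergy_le v s T).trans (le_of_eq ?_)
  rw [← Finset.sum_add_sum_compl T fun k => min (levels v s n k) 0]
  have e1 : ∑ k ∈ T, min (levels v s n k) 0 = ∑ k ∈ T, levels v s n k :=
    Finset.sum_congr rfl fun k hk => min_eq_left (Finset.mem_filter.mp hk).2.le
  have e2 : ∑ k ∈ Tᶜ, min (levels v s n k) 0 = 0 :=
    Finset.sum_eq_zero fun k hk => min_eq_right (by simpa [hT] using hk)
  rw [e1, e2, add_zero]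

/-! ### The effective interaction of a string -/

/-- The effective interaction of the string consisting of the first `j + 2` sites: the part of
the band shift that is not due to shorter strings. -/
noncomputable def stringTerm (v : ℝ) (s : ℕ → Fin 2) (j : ℕ) : ℝ :=
  bandShift v s (j + 2) + bandShift v (shift s) j - bandShift v s (j + 1) -
    bandShift v (shift s) (j + 1)

/-- Dodgson's identity for the continuants of a string. -/
theorem continuant_dodgson (v y : ℝ) (j : ℕ) (s : ℕ → Fin 2) :
    continuant v y (j + 2) s * continuant v y j (shift s) =
      continuant v y (j + 1) s * continuant v y (j + 1) (shift s) - 1 := by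
  induction j generalizing s with
  | zero => simp [continuant]
  | succ j ih =>
    have h1 := ih (shift s)
    have h2 : continuant v y (j + 3) s = siteTerm v y (s 0) * continuant v y (j + 2) (shift s) -
      continuant v y (j + 1) (shift (shift s)) := rfl
    have h3 : continuant v y (j + 2) s = siteTerm v y (s 0) * continuant v y (j + 1) (shift s) -
      continuant v y j (shift (shift s)) := rfl
    rw [show j + 1 + 2 = j + 3 from rfl, show j + 1 + 1 = j + 2 from rfl, h2, h3]
    linear_combination h1

theorem normSq_siteTerm (v y : ℝ) (a : Fin 2) : Complex.normSq (siteTerm v y a) = v ^ 2 + y ^ 2 := by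
  rw [siteTerm, Complex.normSq_add_mul_I]
  unfold siteEnergy
  split_ifs <;> ring

theorem norm_siteTerm (v y : ℝ) (a : Fin 2) : ‖siteTerm v y a‖ = Real.sqrt (v ^ 2 + y ^ 2) := by
  rw [← normSq_siteTerm v y a, Complex.normSq_eq_norm_sq, Real.sqrt_sq (norm_nonneg _)]

theorem le_radius {v : ℝ} (hv : 0 ≤ v) (y : ℝ) : v ≤ Real.sqrt (v ^ 2 + y ^ 2) := by
  rw [Real.le_sqrt hv (by positivity)]
  nlinarith [sq_nonneg y]

theorem norm_continuant_succ {v : ℝ} (hv : 2 ≤ v) (y : ℝ) (n : ℕ) (s : ℕ → Fin 2) :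
    (Real.sqrt (v ^ 2 + y ^ 2) - 1) * ‖continuant v y n (shift s)‖ ≤
      ‖continuant v y (n + 1) s‖ := by
  have hR := le_radius (by linarith : 0 ≤ v) y
  set R := Real.sqrt (v ^ 2 + y ^ 2) with hRdef
  induction n generalizing s with
  | zero => simp [continuant, norm_siteTerm, ← hRdef]
  | succ n ih =>
    have h1 := ih (shift s)
    have h2 : continuant v y (n + 2) s = siteTerm v y (s 0) * continuant v y (n + 1) (shift s) -
      continuant v y n (shift (shift s)) := rfl
    have h3 := norm_sub_norm_le (siteTerm v y (s 0) * continuant v y (n + 1) (shift s))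
      (continuant v y n (shift (shift s)))
    rw [norm_mul, norm_siteTerm, ← hRdef, ← h2] at h3
    nlinarith [norm_nonneg (continuant v y n (shift (shift s)))]

theorem pow_le_norm_continuant {v : ℝ} (hv : 2 ≤ v) (y : ℝ) (n : ℕ) (s : ℕ → Fin 2) :
    (Real.sqrt (v ^ 2 + y ^ 2) - 1) ^ n ≤ ‖continuant v y n s‖ := by
  have hR := le_radius (by linarith : 0 ≤ v) y
  induction n generalizing s with
  | zero => simp [continuant]
  | succ n ih =>
    refine le_trans ?_ (norm_continuant_succ hv y n s)
    rw [pow_succ']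
    exact mul_le_mul_of_nonneg_left (ih _) (by linarith)

theorem continuant_ne_zero {v : ℝ} (hv : 2 ≤ v) (y : ℝ) (n : ℕ) (s : ℕ → Fin 2) :
    continuant v y n s ≠ 0 := by
  have hR := le_radius (by linarith : 0 ≤ v) y
  have := pow_le_norm_continuant hv y n s
  have h2 : 0 < (Real.sqrt (v ^ 2 + y ^ 2) - 1) ^ n := pow_pos (by linarith) n
  exact norm_pos_iff.mp (h2.trans_le this)

/-- The ratio that measures the correlation of the two ends of a string. -/
noncomputable def stringRatio (v y : ℝ) (s : ℕ → Fin 2) (j : ℕ) : ℂ :=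
  (continuant v y (j + 1) s * continuant v y (j + 1) (shift s))⁻¹

theorem log_stringRatio {v : ℝ} (hv : 2 ≤ v) (y : ℝ) (s : ℕ → Fin 2) (j : ℕ) :
    Real.log (Complex.normSq (1 - stringRatio v y s j)) =
      Real.log (Complex.normSq (continuant v y (j + 2) s)) +
        Real.log (Complex.normSq (continuant v y j (shift s))) -
        Real.log (Complex.normSq (continuant v y (j + 1) s)) -
        Real.log (Complex.normSq (continuant v y (j + 1) (shift s))) := by
  have n1 := continuant_ne_zero hv y (j + 2) s
  have n2 := continuant_ne_zero hv y j (shift s)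
  have n3 := continuant_ne_zero hv y (j + 1) s
  have n4 := continuant_ne_zero hv y (j + 1) (shift s)
  have e : 1 - stringRatio v y s j = continuant v y (j + 2) s * continuant v y j (shift s) /
      (continuant v y (j + 1) s * continuant v y (j + 1) (shift s)) := by
    rw [continuant_dodgson, stringRatio]
    field_simp
  rw [e, map_div₀, map_mul, map_mul, Real.log_div, Real.log_mul, Real.log_mul]
  · ring
  all_goals simp [n1, n2, n3, n4]

theorem integrable_log_stringRatio {v : ℝ} (hv : 2 < v) (s : ℕ → Fin 2) (j : ℕ) :
    MeasureTheory.Integrable fun y => Real.log (Complex.normSq (1 - stringRatio v y s j)) := by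
  have := (((integrable_bandShift hv s (j + 2)).add (integrable_bandShift hv (shift s) j)).sub
    (integrable_bandShift hv s (j + 1))).sub (integrable_bandShift hv (shift s) (j + 1))
  refine this.congr (Filter.Eventually.of_forall fun y => ?_)
  simp only [Pi.add_apply, Pi.sub_apply]
  rw [log_stringRatio hv.le]
  push_cast
  ring

theorem stringTerm_eq {v : ℝ} (hv : 2 < v) (s : ℕ → Fin 2) (j : ℕ) :
    stringTerm v s j =
      (2 * Real.pi)⁻¹ * ∫ y, Real.log (Complex.normSq (1 - stringRatio v y s j)) := by
  let f : (ℕ → Fin 2) → ℕ → ℝ → ℝ := fun s n y =>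
    Real.log (Complex.normSq (continuant v y n s)) - n * Real.log (v ^ 2 + y ^ 2)
  have hf : ∀ s n, MeasureTheory.Integrable (f s n) := fun s n => integrable_bandShift hv s n
  have e : (fun y => Real.log (Complex.normSq (1 - stringRatio v y s j))) =
      f s (j + 2) + f (shift s) j - f s (j + 1) - f (shift s) (j + 1) := by
    funext y
    simp only [Pi.add_apply, Pi.sub_apply, f]
    rw [log_stringRatio hv.le]
    push_cast
    ring
  rw [e, MeasureTheory.integral_sub' (((hf _ _).add (hf _ _)).sub (hf _ _)) (hf _ _),
    MeasureTheory.integral_sub' ((hf _ _).add (hf _ _)) (hf _ _),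
    MeasureTheory.integral_add' (hf _ _) (hf _ _)]
  unfold stringTerm bandShift
  simp only [f]
  ring

/-- `log |1 - w|² = -2 Re w` to first order. -/
theorem abs_log_normSq_add_le {w : ℂ} (hw : ‖w‖ ≤ 1 / 2) :
    |Real.log (Complex.normSq (1 - w)) + 2 * w.re| ≤ 2 * ‖w‖ ^ 2 := by
  have h := Complex.norm_log_one_add_sub_self_le (z := -w) (by rw [norm_neg]; linarith)
  rw [norm_neg] at h
  have h2 := (Complex.abs_re_le_norm _).trans h
  have e : Real.log (Complex.normSq (1 - w)) + 2 * w.re =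
      2 * (Complex.log (1 + -w) - -w).re := by
    rw [Complex.normSq_eq_norm_sq, Real.log_pow, Complex.sub_re, Complex.log_re, Complex.neg_re,
      ← sub_eq_add_neg]
    push_cast
    ring
  rw [e, abs_mul, abs_two]
  have h3 : (1 - ‖w‖)⁻¹ ≤ 2 := by
    rw [inv_le_comm₀ (by linarith) (by norm_num)]
    linarith
  have h4 : ‖w‖ ^ 2 * (1 - ‖w‖)⁻¹ / 2 ≤ ‖w‖ ^ 2 := by
    nlinarith [sq_nonneg ‖w‖]
  linarith

theorem integral_inv_sq_add_sq {v : ℝ} (hv : 0 < v) :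
    ∫ y : ℝ, (v ^ 2 + y ^ 2)⁻¹ = Real.pi / v := by
  have hF : ∀ y : ℝ, HasDerivAt (fun y => v⁻¹ * Real.arctan (y / v)) ((v ^ 2 + y ^ 2)⁻¹) y := by
    intro y
    refine ((((hasDerivAt_id y).div_const v).arctan).const_mul v⁻¹).congr_deriv ?_
    simp only [id]
    field_simp
  rw [MeasureTheory.integral_of_hasDerivAt_of_tendsto hF (integrable_inv_sq_add_sq hv)
    (((tendsto_nhds_of_tendsto_nhdsWithin Real.tendsto_arctan_atBot).comp
      (tendsto_id.atBot_div_const hv)).const_mul _)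
    (((tendsto_nhds_of_tendsto_nhdsWithin Real.tendsto_arctan_atTop).comp
      (tendsto_id.atTop_div_const hv)).const_mul _)]
  field_simp
  ring

theorem inv_pow_le {v : ℝ} (hv : 0 < v) (y : ℝ) (j : ℕ) :
    ((v ^ 2 + y ^ 2)⁻¹) ^ (j + 1) ≤ ((v ^ 2)⁻¹) ^ j * (v ^ 2 + y ^ 2)⁻¹ := by
  rw [pow_succ]
  gcongr
  nlinarith [sq_nonneg y]

theorem norm_stringRatio_le {v : ℝ} (hv : 4 ≤ v) (y : ℝ) (s : ℕ → Fin 2) (j : ℕ) :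
    ‖stringRatio v y s j‖ ≤ (2 * (v ^ 2 + y ^ 2)⁻¹) ^ (j + 1) := by
  have hR := le_radius (by linarith : 0 ≤ v) y
  have hR2 : Real.sqrt (v ^ 2 + y ^ 2) ^ 2 = v ^ 2 + y ^ 2 := Real.sq_sqrt (by positivity)
  have h1 := pow_le_norm_continuant (by linarith : 2 ≤ v) y (j + 1) s
  have h2 := pow_le_norm_continuant (by linarith : 2 ≤ v) y (j + 1) (shift s)
  set R := Real.sqrt (v ^ 2 + y ^ 2) with hRdef
  have hpos : 0 < (R - 1) ^ (j + 1) := pow_pos (by linarith) _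
  rw [stringRatio, norm_inv, norm_mul, ← hR2]
  have h3 : (R ^ 2 / 2) ^ (j + 1) ≤ ‖continuant v y (j + 1) s‖ * ‖continuant v y (j + 1) (shift s)‖ :=
    calc (R ^ 2 / 2) ^ (j + 1) ≤ ((R - 1) * (R - 1)) ^ (j + 1) := by
          gcongr
          nlinarith
      _ = (R - 1) ^ (j + 1) * (R - 1) ^ (j + 1) := mul_pow _ _ _
      _ ≤ _ := mul_le_mul h1 h2 hpos.le (norm_nonneg _)
  have h4 : 0 < R := by linarith
  calc _ ≤ ((R ^ 2 / 2) ^ (j + 1))⁻¹ := by gcongr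
    _ = _ := by rw [← inv_pow, inv_div, div_eq_mul_inv]

theorem norm_stringRatio_le_half {v : ℝ} (hv : 4 ≤ v) (y : ℝ) (s : ℕ → Fin 2) (j : ℕ) :
    ‖stringRatio v y s j‖ ≤ 1 / 2 := by
  refine (norm_stringRatio_le hv y s j).trans ?_
  have h : 2 * (v ^ 2 + y ^ 2)⁻¹ ≤ 1 / 2 := by
    have h1 : (v ^ 2 + y ^ 2)⁻¹ ≤ (4 : ℝ)⁻¹ := by
      gcongr
      nlinarith [sq_nonneg y]
    linarith
  have h0 : 0 ≤ 2 * (v ^ 2 + y ^ 2)⁻¹ := by positivity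
  exact (pow_le_of_le_one h0 (by linarith) (by omega)).trans h

/-- The interaction of strings decays exponentially with their length. -/
theorem abs_stringTerm_le {v : ℝ} (hv : 4 ≤ v) (s : ℕ → Fin 2) (j : ℕ) :
    |stringTerm v s j| ≤ 4 / v * (2 / v ^ 2) ^ j := by
  have hv0 : 0 < v := by linarith
  rw [stringTerm_eq (by linarith), abs_mul, abs_of_pos (by positivity)]
  have hb : ∀ y, ‖Real.log (Complex.normSq (1 - stringRatio v y s j))‖ ≤
      (4 * 2 ^ (j + 1) * ((v ^ 2)⁻¹) ^ j) * (v ^ 2 + y ^ 2)⁻¹ := by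
    intro y
    have h1 := norm_stringRatio_le_half hv y s j
    have h2 := abs_log_normSq_add_le h1
    have h3 := Complex.abs_re_le_norm (stringRatio v y s j)
    have h4 := norm_stringRatio_le hv y s j
    have h5 := norm_nonneg (stringRatio v y s j)
    have h6 : |Real.log (Complex.normSq (1 - stringRatio v y s j))| ≤
        4 * ‖stringRatio v y s j‖ := by
      rw [abs_le] at h2 h3 ⊢
      constructor <;> nlinarith [h2.1, h2.2, h3.1, h3.2]
    rw [Real.norm_eq_abs]
    refine h6.trans ?_
    rw [mul_pow] at h4
    have h7 := inv_pow_le hv0 y j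
    have h8 : (2 : ℝ) ^ (j + 1) * ((v ^ 2 + y ^ 2)⁻¹) ^ (j + 1) ≤
        2 ^ (j + 1) * (((v ^ 2)⁻¹) ^ j * (v ^ 2 + y ^ 2)⁻¹) := by gcongr
    linarith
  have h := MeasureTheory.norm_integral_le_of_norm_le
    ((integrable_inv_sq_add_sq hv0).const_mul (4 * 2 ^ (j + 1) * ((v ^ 2)⁻¹) ^ j))
    (Filter.Eventually.of_forall hb)
  rw [MeasureTheory.integral_const_mul, integral_inv_sq_add_sq hv0, Real.norm_eq_abs] at h
  calc _ ≤ (2 * Real.pi)⁻¹ * (4 * 2 ^ (j + 1) * ((v ^ 2)⁻¹) ^ j * (Real.pi / v)) := by gcongr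
    _ = 4 / v * (2 / v ^ 2) ^ j := by
      rw [div_eq_mul_inv 2 (v ^ 2), mul_pow, pow_succ]
      have := Real.pi_pos
      field_simp

/-! ### The leading order of the interaction -/

/-- To leading order a continuant is the product of its diagonal entries. Each removed pair of
neighbours costs a factor of modulus `(v² + y²)⁻¹`. -/
theorem norm_continuant_sub_prod_le {v : ℝ} (hv : 0 < v) (y : ℝ) (n : ℕ) (s : ℕ → Fin 2) :
    ‖continuant v y n s - ∏ i ∈ Finset.range n, siteTerm v y (s i)‖ ≤
      ((1 + (v ^ 2 + y ^ 2)⁻¹) ^ n - 1) * Real.sqrt (v ^ 2 + y ^ 2) ^ n := by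
  have hR0 : 0 < Real.sqrt (v ^ 2 + y ^ 2) := Real.sqrt_pos.mpr (by positivity)
  have hR2 : Real.sqrt (v ^ 2 + y ^ 2) ^ 2 = v ^ 2 + y ^ 2 := Real.sq_sqrt (by positivity)
  have hnorm : ∀ a, ‖siteTerm v y a‖ = Real.sqrt (v ^ 2 + y ^ 2) := norm_siteTerm v y
  rw [show (v ^ 2 + y ^ 2)⁻¹ = (Real.sqrt (v ^ 2 + y ^ 2) ^ 2)⁻¹ by rw [hR2]]
  set R := Real.sqrt (v ^ 2 + y ^ 2) with hR
  set t := (R ^ 2)⁻¹ with ht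
  have ht0 : 0 < t := by positivity
  have htR : t * R ^ 2 = 1 := inv_mul_cancel₀ (by positivity)
  induction n using Nat.strong_induction_on generalizing s with
  | _ n ih =>
    match n, ih with
    | 0, _ => simp [continuant]
    | 1, _ => simp [continuant]; positivity
    | n + 2, ih =>
      have h1 := ih (n + 1) (by omega) (shift s)
      have h2 := ih n (by omega) (shift (shift s))
      have h3 : ‖∏ i ∈ Finset.range n, siteTerm v y (shift (shift s) i)‖ = R ^ n := by
        rw [norm_prod]; simp [hnorm]
      have h4 : ‖continuant v y n (shift (shift s))‖ ≤ (1 + t) ^ n * R ^ n := by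
        have := norm_le_norm_sub_add (continuant v y n (shift (shift s)))
          (∏ i ∈ Finset.range n, siteTerm v y (shift (shift s) i))
        rw [h3] at this
        linarith
      have e : continuant v y (n + 2) s - ∏ i ∈ Finset.range (n + 2), siteTerm v y (s i) =
          siteTerm v y (s 0) * (continuant v y (n + 1) (shift s) -
            ∏ i ∈ Finset.range (n + 1), siteTerm v y (shift s i)) -
            continuant v y n (shift (shift s)) := by
        rw [Finset.prod_range_succ']
        simp only [continuant, shift]
        ring
      rw [e]
      refine (norm_sub_le _ _).trans ?_
      rw [norm_mul, hnorm]
      have h5 : R * ‖continuant v y (n + 1) (shift s) -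
            ∏ i ∈ Finset.range (n + 1), siteTerm v y (shift s i)‖ ≤
          R * (((1 + t) ^ (n + 1) - 1) * R ^ (n + 1)) := by gcongr
      have h6 : (1 + t) ^ n * R ^ n = t * (1 + t) ^ n * R ^ (n + 2) := by
        rw [pow_add R n 2]
        linear_combination -((1 + t) ^ n * R ^ n) * htR
      have h7 : t * (1 + t) ^ n ≤ t * (1 + t) ^ (n + 1) := by
        gcongr
        · linarith
        · omega
      calc _ ≤ R * (((1 + t) ^ (n + 1) - 1) * R ^ (n + 1)) + t * (1 + t) ^ n * R ^ (n + 2) := by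
            linarith
        _ ≤ R * (((1 + t) ^ (n + 1) - 1) * R ^ (n + 1)) + t * (1 + t) ^ (n + 1) * R ^ (n + 2) := by
            gcongr
        _ = _ := by ring

/-- The leading order of `stringRatio`: hopping from one end of the string to the other and
back. -/
noncomputable def stringLead (v y : ℝ) (s : ℕ → Fin 2) (j : ℕ) : ℂ :=
  (siteTerm v y (s 0))⁻¹ * (siteTerm v y (s (j + 1)))⁻¹ *
    ∏ i ∈ Finset.range j, (siteTerm v y (s (i + 1)))⁻¹ ^ 2

theorem stringLead_eq (v y : ℝ) (s : ℕ → Fin 2) (j : ℕ) : stringLead v y s j =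
    ((∏ i ∈ Finset.range (j + 1), siteTerm v y (s i)) *
      ∏ i ∈ Finset.range (j + 1), siteTerm v y (shift s i))⁻¹ := by
  rw [Finset.prod_range_succ', Finset.prod_range_succ _ j]
  simp only [stringLead, shift, inv_pow, Finset.prod_inv_distrib, Finset.prod_pow]
  rw [mul_inv, mul_inv, mul_inv, pow_two, mul_inv]
  ring

theorem norm_stringLead {v : ℝ} (y : ℝ) (s : ℕ → Fin 2) (j : ℕ) :
    ‖stringLead v y s j‖ = ((v ^ 2 + y ^ 2)⁻¹) ^ (j + 1) := by
  have hR2 : Real.sqrt (v ^ 2 + y ^ 2) ^ 2 = v ^ 2 + y ^ 2 := Real.sq_sqrt (by positivity)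
  rw [stringLead_eq, norm_inv, norm_mul, norm_prod, norm_prod]
  simp only [norm_siteTerm, Finset.prod_const, Finset.card_range]
  rw [← mul_pow, ← pow_two, hR2, inv_pow]

theorem norm_stringRatio_sub_le {v : ℝ} (hv : 4 ≤ v) (y : ℝ) (s : ℕ → Fin 2) (j : ℕ)
    (hj : 8 * ((j : ℝ) + 1) ≤ v ^ 2) :
    ‖stringRatio v y s j - stringLead v y s j‖ ≤
      8 * (j + 1) * (v ^ 2 + y ^ 2)⁻¹ * ((v ^ 2 + y ^ 2)⁻¹) ^ (j + 1) := by
  have hv0 : 0 < v := by linarith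
  have hR0 : 0 < Real.sqrt (v ^ 2 + y ^ 2) := Real.sqrt_pos.mpr (by positivity)
  have hR2 : Real.sqrt (v ^ 2 + y ^ 2) ^ 2 = v ^ 2 + y ^ 2 := Real.sq_sqrt (by positivity)
  have hK0 := continuant_ne_zero (by linarith : 2 ≤ v) y (j + 1) s
  have hK0' := continuant_ne_zero (by linarith : 2 ≤ v) y (j + 1) (shift s)
  have h1 := norm_continuant_sub_prod_le hv0 y (j + 1) s
  have h2 := norm_continuant_sub_prod_le hv0 y (j + 1) (shift s)
  have hP : ∀ r : ℕ → Fin 2, ‖∏ i ∈ Finset.range (j + 1), siteTerm v y (r i)‖ =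
      Real.sqrt (v ^ 2 + y ^ 2) ^ (j + 1) := by
    intro r
    rw [norm_prod]
    simp [norm_siteTerm]
  have hPs := hP s
  have hPs' := hP (shift s)
  have hP0 : (∏ i ∈ Finset.range (j + 1), siteTerm v y (s i)) ≠ 0 := by
    rw [← norm_pos_iff, hP]; positivity
  have hP0' : (∏ i ∈ Finset.range (j + 1), siteTerm v y (shift s i)) ≠ 0 := by
    rw [← norm_pos_iff, hP]; positivity
  have ht : (v ^ 2 + y ^ 2)⁻¹ = (Real.sqrt (v ^ 2 + y ^ 2) ^ 2)⁻¹ := by rw [hR2]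
  have htv : (v ^ 2 + y ^ 2)⁻¹ ≤ (v ^ 2)⁻¹ := by
    gcongr
    nlinarith [sq_nonneg y]
  rw [stringLead_eq, stringRatio]
  set K := continuant v y (j + 1) s
  set K' := continuant v y (j + 1) (shift s)
  set P := ∏ i ∈ Finset.range (j + 1), siteTerm v y (s i)
  set P' := ∏ i ∈ Finset.range (j + 1), siteTerm v y (shift s i)
  set t := (v ^ 2 + y ^ 2)⁻¹ with htdef
  set R := Real.sqrt (v ^ 2 + y ^ 2)
  set Q := R ^ (j + 1) with hQ
  have hQ0 : 0 < Q := by positivity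
  have ht0 : 0 < t := by positivity
  set x := (1 + t) ^ (j + 1) with hx
  have hx1 : 1 ≤ x := one_le_pow₀ (by linarith)
  have hnt : ((j : ℝ) + 1) * t ≤ 1 / 8 := by
    calc ((j : ℝ) + 1) * t ≤ (v ^ 2 / 8) * (v ^ 2)⁻¹ := by gcongr; linarith
      _ = 1 / 8 := by field_simp
  -- the relative error of a product of two continuants is of order `(j + 1) t`
  have heta : x ^ 2 - 1 ≤ 4 * ((j + 1) * t) := by
    have e1 : x ^ 2 ≤ Real.exp (2 * ((j + 1) * t)) := by
      have : x ≤ Real.exp ((j + 1) * t) := by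
        have e2 : 1 + t ≤ Real.exp t := by linarith [Real.add_one_le_exp t]
        calc x ≤ Real.exp t ^ (j + 1) := by rw [hx]; gcongr
          _ = Real.exp ((j + 1) * t) := by rw [← Real.exp_nat_mul]; push_cast; rfl
      calc x ^ 2 ≤ Real.exp ((j + 1) * t) ^ 2 := by gcongr
        _ = _ := by rw [← Real.exp_nat_mul]; push_cast; rfl
    have hnt0 : 0 ≤ ((j : ℝ) + 1) * t := by positivity
    have e3 := Real.abs_exp_sub_one_le (x := 2 * ((j + 1) * t)) (by
      rw [abs_of_nonneg (by linarith)]; linarith)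
    rw [abs_of_nonneg (show (0 : ℝ) ≤ 2 * ((j + 1) * t) by linarith)] at e3
    linarith [(abs_le.mp e3).2]
  have hK'n : ‖K'‖ ≤ x * Q := by
    have := norm_le_norm_sub_add K' P'
    rw [hPs'] at this
    linarith
  have hdiff : ‖P * P' - K * K'‖ ≤ (x ^ 2 - 1) * Q ^ 2 := by
    have e : P * P' - K * K' = -(P * (K' - P')) - (K - P) * K' := by ring
    rw [e]
    refine (norm_sub_le _ _).trans ?_
    rw [norm_neg, norm_mul, norm_mul, hPs]
    have := mul_le_mul_of_nonneg_left h2 hQ0.le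
    have := mul_le_mul h1 hK'n (norm_nonneg _) (mul_nonneg (by linarith) hQ0.le)
    nlinarith
  have hKK : Q ^ 2 / 2 ≤ ‖K * K'‖ := by
    have e1 := norm_sub_norm_le (P * P') (K * K')
    rw [norm_mul P, hPs, hPs'] at e1
    nlinarith [mul_le_mul_of_nonneg_right heta (sq_nonneg Q),
      mul_le_mul_of_nonneg_right hnt (sq_nonneg Q)]
  have e : (K * K')⁻¹ - (P * P')⁻¹ = (P * P' - K * K') / ((K * K') * (P * P')) := by
    field_simp
  have htQ : t ^ (j + 1) = (Q ^ 2)⁻¹ := by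
    rw [ht, hQ, inv_pow, ← pow_mul, ← pow_mul, mul_comm]
  rw [e, norm_div, norm_mul (K * K'), norm_mul P, hPs, hPs', htQ]
  have hx0 : 0 ≤ (x ^ 2 - 1) * Q ^ 2 := mul_nonneg (by nlinarith) (sq_nonneg Q)
  have hKpos : 0 < ‖K * K'‖ := lt_of_lt_of_le (by positivity) hKK
  calc _ ≤ ((x ^ 2 - 1) * Q ^ 2) / (Q ^ 2 / 2 * (Q * Q)) := by gcongr
    _ = 2 * (x ^ 2 - 1) * (Q ^ 2)⁻¹ := by field_simp
    _ ≤ 2 * (4 * ((j + 1) * t)) * (Q ^ 2)⁻¹ := by gcongr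
    _ = _ := by ring

theorem continuous_siteTerm (v : ℝ) (a : Fin 2) : Continuous fun y => siteTerm v y a := by
  unfold siteTerm
  fun_prop

theorem siteTerm_ne_zero {v : ℝ} (hv : 0 < v) (y : ℝ) (a : Fin 2) : siteTerm v y a ≠ 0 := by
  rw [← norm_pos_iff, norm_siteTerm]
  positivity

theorem integrable_stringLead {v : ℝ} (hv : 0 < v) (s : ℕ → Fin 2) (j : ℕ) :
    MeasureTheory.Integrable fun y => stringLead v y s j := by
  refine ((integrable_inv_sq_add_sq hv).const_mul (((v ^ 2)⁻¹) ^ j)).mono' ?_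
    (Filter.Eventually.of_forall fun y => ?_)
  · refine Continuous.aestronglyMeasurable ?_
    unfold stringLead
    have hc : ∀ a, Continuous fun y => (siteTerm v y a)⁻¹ := fun a =>
      (continuous_siteTerm v a).inv₀ fun y => siteTerm_ne_zero hv y a
    exact ((hc _).mul (hc _)).mul (continuous_finsetProd _ fun i _ => (hc _).pow 2)
  · rw [norm_stringLead]
    exact inv_pow_le hv y j

/-- The interaction of a string to leading order, with a relative error of order `j / v²`. -/
theorem abs_stringTerm_add_lead_le {v : ℝ} (hv : 4 ≤ v) (s : ℕ → Fin 2) (j : ℕ)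
    (hj : 8 * ((j : ℝ) + 1) ≤ v ^ 2) :
    |stringTerm v s j + Real.pi⁻¹ * (∫ y, stringLead v y s j).re| ≤
      12 * (j + 1) * (v ^ 2)⁻¹ * (v⁻¹ * ((v ^ 2)⁻¹) ^ j) := by
  have hv0 : 0 < v := by linarith
  have hI := integrable_stringLead hv0 s j
  have hIre : MeasureTheory.Integrable fun y => (stringLead v y s j).re := hI.re
  have hre : ∫ y, (stringLead v y s j).re = (∫ y, stringLead v y s j).re := integral_re hI
  have e : stringTerm v s j + Real.pi⁻¹ * (∫ y, stringLead v y s j).re =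
      (2 * Real.pi)⁻¹ * ∫ y, (Real.log (Complex.normSq (1 - stringRatio v y s j)) +
        2 * (stringLead v y s j).re) := by
    rw [MeasureTheory.integral_add (integrable_log_stringRatio (by linarith) s j)
      (hIre.const_mul 2), MeasureTheory.integral_const_mul, stringTerm_eq (by linarith), ← hre]
    have := Real.pi_pos
    field_simp
  rw [e, abs_mul, abs_of_pos (by positivity)]
  have hb : ∀ y, ‖Real.log (Complex.normSq (1 - stringRatio v y s j)) +
      2 * (stringLead v y s j).re‖ ≤
      (24 * (j + 1) * (v ^ 2)⁻¹ * ((v ^ 2)⁻¹) ^ j) * (v ^ 2 + y ^ 2)⁻¹ := by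
    intro y
    have h1 := norm_stringRatio_le_half hv y s j
    have h2 := abs_log_normSq_add_le h1
    have h3 := norm_stringRatio_sub_le hv y s j hj
    have h4 := (Complex.abs_re_le_norm _).trans h3
    rw [Complex.sub_re] at h4
    have h5 := norm_le_norm_sub_add (stringRatio v y s j) (stringLead v y s j)
    rw [norm_stringLead] at h5
    have htv : (v ^ 2 + y ^ 2)⁻¹ ≤ (v ^ 2)⁻¹ := by
      gcongr
      nlinarith [sq_nonneg y]
    have h6 := inv_pow_le hv0 y j
    set t := (v ^ 2 + y ^ 2)⁻¹ with ht
    have ht0 : 0 < t := by positivity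
    set T := t ^ (j + 1) with hT
    have hT0 : 0 < T := by positivity
    have hTt : T ≤ t := by
      rw [hT]
      refine pow_le_of_le_one ht0.le (htv.trans ?_) (by omega)
      refine inv_le_one_of_one_le₀ ?_
      nlinarith
    have hjt : 8 * ((j : ℝ) + 1) * t ≤ 1 := by
      calc 8 * ((j : ℝ) + 1) * t ≤ v ^ 2 * (v ^ 2)⁻¹ := by gcongr
        _ = 1 := by field_simp
    have h7 : ‖stringRatio v y s j‖ ≤ 2 * T := by nlinarith
    have h8 : ‖stringRatio v y s j‖ ^ 2 ≤ 4 * (t * T) := by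
      nlinarith [norm_nonneg (stringRatio v y s j)]
    have h9 : ‖Real.log (Complex.normSq (1 - stringRatio v y s j)) +
        2 * (stringLead v y s j).re‖ ≤ 24 * (j + 1) * t * T := by
      rw [Real.norm_eq_abs]
      have hj0 : 0 ≤ (j : ℝ) * (t * T) := by positivity
      rw [abs_le] at h2 h4 ⊢
      constructor <;> nlinarith [h2.1, h2.2, h4.1, h4.2]
    calc _ ≤ 24 * (j + 1) * t * T := h9
      _ ≤ 24 * (j + 1) * (v ^ 2)⁻¹ * (((v ^ 2)⁻¹) ^ j * t) := by gcongr
      _ = _ := by ring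
  have h := MeasureTheory.norm_integral_le_of_norm_le
    ((integrable_inv_sq_add_sq hv0).const_mul (24 * (j + 1) * (v ^ 2)⁻¹ * ((v ^ 2)⁻¹) ^ j))
    (Filter.Eventually.of_forall hb)
  rw [MeasureTheory.integral_const_mul, integral_inv_sq_add_sq hv0, Real.norm_eq_abs] at h
  calc _ ≤ (2 * Real.pi)⁻¹ * (24 * (j + 1) * (v ^ 2)⁻¹ * ((v ^ 2)⁻¹) ^ j * (Real.pi / v)) := by
        gcongr
    _ = _ := by
      have := Real.pi_pos
      field_simp
      ring

/-! ### The beta integrals -/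

/-- The integral `∫ (v + i y)⁻ᵃ (v - i y)⁻ᵇ dy`. -/
noncomputable def betaIntegral (v : ℝ) (a b : ℕ) : ℂ :=
  ∫ y : ℝ, ((v + y * Complex.I : ℂ)⁻¹) ^ a * ((v - y * Complex.I : ℂ)⁻¹) ^ b

theorem add_mul_I_ne_zero {v : ℝ} (hv : 0 < v) (y : ℝ) : (v + y * Complex.I : ℂ) ≠ 0 := by
  intro h
  have := congrArg Complex.re h
  simp at this
  exact hv.ne' this

theorem sub_mul_I_ne_zero {v : ℝ} (hv : 0 < v) (y : ℝ) : (v - y * Complex.I : ℂ) ≠ 0 := by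
  intro h
  have := congrArg Complex.re h
  simp at this
  exact hv.ne' this

theorem mul_conj_inv {v : ℝ} (y : ℝ) :
    (v + y * Complex.I : ℂ)⁻¹ * (v - y * Complex.I : ℂ)⁻¹ = (((v ^ 2 + y ^ 2)⁻¹ : ℝ) : ℂ) := by
  rw [← mul_inv]
  push_cast
  congr 1
  linear_combination -(y : ℂ) ^ 2 * Complex.I_sq

theorem integrable_beta {v : ℝ} (hv : 0 < v) {a b : ℕ} (hab : 2 ≤ a + b) :
    MeasureTheory.Integrable fun y : ℝ =>
      ((v + y * Complex.I : ℂ)⁻¹) ^ a * ((v - y * Complex.I : ℂ)⁻¹) ^ b := by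
  have n1 : ∀ y : ℝ, ‖(v + y * Complex.I : ℂ)‖ = Real.sqrt (v ^ 2 + y ^ 2) :=
    fun y => by rw [Complex.norm_add_mul_I]
  have n2 : ∀ y : ℝ, ‖(v - y * Complex.I : ℂ)‖ = Real.sqrt (v ^ 2 + y ^ 2) := fun y => by
    have := Complex.norm_add_mul_I v (-y)
    rw [neg_sq] at this
    rw [← this]
    push_cast
    ring_nf
  refine ((integrable_inv_sq_add_sq hv).const_mul ((v⁻¹) ^ (a + b - 2))).mono' ?_
    (Filter.Eventually.of_forall fun y => ?_)
  · refine Continuous.aestronglyMeasurable ?_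
    refine Continuous.mul ?_ ?_
    · exact (Continuous.inv₀ (by fun_prop) fun y => add_mul_I_ne_zero hv y).pow a
    · exact (Continuous.inv₀ (by fun_prop) fun y => sub_mul_I_ne_zero hv y).pow b
  · have hR := le_radius hv.le y
    have hR2 : Real.sqrt (v ^ 2 + y ^ 2) ^ 2 = v ^ 2 + y ^ 2 := Real.sq_sqrt (by positivity)
    rw [norm_mul, norm_pow, norm_pow, norm_inv, norm_inv, n1, n2, ← pow_add,
      show (v ^ 2 + y ^ 2)⁻¹ = (Real.sqrt (v ^ 2 + y ^ 2))⁻¹ ^ 2 by rw [inv_pow, hR2]]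
    obtain ⟨m, hm⟩ : ∃ m, a + b = m + 2 := ⟨a + b - 2, by omega⟩
    rw [hm, Nat.add_sub_cancel, pow_add]
    have : 0 < Real.sqrt (v ^ 2 + y ^ 2) := by positivity
    gcongr

/-- Pascal's recursion. -/
theorem betaIntegral_succ_succ {v : ℝ} (hv : 0 < v) {a b : ℕ} (hab : 1 ≤ a + b) :
    2 * v * betaIntegral v (a + 1) (b + 1) =
      betaIntegral v (a + 1) b + betaIntegral v a (b + 1) := by
  unfold betaIntegral
  rw [← MeasureTheory.integral_add (integrable_beta hv (by omega)) (integrable_beta hv (by omega)),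
    ← MeasureTheory.integral_const_mul]
  congr 1
  funext y
  have h1 := add_mul_I_ne_zero hv y
  have h2 := sub_mul_I_ne_zero hv y
  have e : (2 * v : ℂ) * ((v + y * Complex.I : ℂ)⁻¹ * (v - y * Complex.I : ℂ)⁻¹) =
      (v + y * Complex.I : ℂ)⁻¹ + (v - y * Complex.I : ℂ)⁻¹ := by
    field_simp
    ring
  rw [pow_succ, pow_succ]
  linear_combination ((v + y * Complex.I : ℂ)⁻¹) ^ a * ((v - y * Complex.I : ℂ)⁻¹) ^ b * e

/-- The integrand has a primitive that vanishes at infinity. -/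
theorem betaIntegral_zero_right {v : ℝ} (hv : 0 < v) (a : ℕ) : betaIntegral v (a + 2) 0 = 0 := by
  have hF : ∀ y : ℝ, HasDerivAt
      (fun y : ℝ => Complex.I / (a + 1) * ((v + y * Complex.I : ℂ)⁻¹) ^ (a + 1))
      (((v + y * Complex.I : ℂ)⁻¹) ^ (a + 2) * ((v - y * Complex.I : ℂ)⁻¹) ^ 0) y := by
    intro y
    have h0 := add_mul_I_ne_zero hv y
    have h1 : HasDerivAt (fun y : ℝ => (v + y * Complex.I : ℂ)) Complex.I y := by
      simpa using ((Complex.ofRealCLM.hasDerivAt (x := y)).mul_const Complex.I).const_add (v : ℂ)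
    have h2 := ((h1.inv h0).pow (a + 1)).const_mul (Complex.I / (a + 1))
    refine h2.congr_deriv ?_
    have h3 : (a + 1 : ℂ) ≠ 0 := by exact_mod_cast Nat.succ_ne_zero a
    simp only [Nat.add_sub_cancel, Pi.inv_apply]
    rw [div_eq_mul_inv (-Complex.I), ← inv_pow]
    generalize (v + y * Complex.I : ℂ)⁻¹ = P
    push_cast
    field_simp
    linear_combination -P ^ (a + 2) * Complex.I_sq
  have hlim : ∀ f : Filter ℝ, Tendsto (fun y : ℝ => |y|) f atTop →
      Tendsto (fun y : ℝ => Complex.I / (a + 1) * ((v + y * Complex.I : ℂ)⁻¹) ^ (a + 1)) f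
        (𝓝 0) := by
    intro f hf
    have h0 : Tendsto (fun y : ℝ => (v + y * Complex.I : ℂ)⁻¹) f (𝓝 0) := by
      refine squeeze_zero_norm' ?_ (tendsto_inv_atTop_zero.comp hf)
      filter_upwards [hf.eventually_gt_atTop 0] with y hy
      rw [norm_inv, Complex.norm_add_mul_I, Function.comp_apply]
      gcongr
      rw [← Real.sqrt_sq_eq_abs]
      gcongr
      nlinarith
    have := (h0.pow (a + 1)).const_mul (Complex.I / (a + 1 : ℂ))
    simpa using this
  have := MeasureTheory.integral_of_hasDerivAt_of_tendsto hF (integrable_beta hv (by omega))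
    (hlim _ tendsto_abs_atBot_atTop) (hlim _ tendsto_abs_atTop_atTop)
  rw [sub_zero] at this
  exact this

theorem betaIntegral_comm (v : ℝ) (a b : ℕ) : betaIntegral v a b = betaIntegral v b a := by
  unfold betaIntegral
  rw [← MeasureTheory.integral_neg_eq_self]
  congr 1
  funext y
  push_cast
  rw [neg_mul, sub_neg_eq_add, ← sub_eq_add_neg, mul_comm]

theorem betaIntegral_one_one {v : ℝ} (hv : 0 < v) : betaIntegral v 1 1 = ((Real.pi / v : ℝ) : ℂ) := by
  unfold betaIntegral
  rw [← integral_inv_sq_add_sq hv]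
  simp only [pow_one, mul_conj_inv]
  exact integral_ofReal

/-- In fact `betaIntegral v (a + 1) (b + 1) = 2 π (a + b).choose a (2 v) ^ (-(a + b + 1))`. -/
theorem le_betaIntegral {v : ℝ} (hv : 0 < v) (n : ℕ) (a b : ℕ) (hab : a + b = n) :
    2 * Real.pi * ((2 * v)⁻¹) ^ (n + 1) ≤ (betaIntegral v (a + 1) (b + 1)).re := by
  induction n generalizing a b with
  | zero =>
    obtain ⟨rfl, rfl⟩ : a = 0 ∧ b = 0 := by omega
    rw [betaIntegral_one_one hv, Complex.ofReal_re]
    refine le_of_eq ?_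
    rw [zero_add, pow_one]
    field_simp
  | succ n ih =>
    have hrec := congrArg Complex.re (betaIntegral_succ_succ hv (a := a) (b := b) (by omega))
    have e : (2 * (v : ℂ) * betaIntegral v (a + 1) (b + 1)).re =
        2 * v * (betaIntegral v (a + 1) (b + 1)).re := by
      rw [← Complex.re_ofReal_mul]; push_cast; rfl
    rw [e, Complex.add_re] at hrec
    have hpos : 0 ≤ 2 * Real.pi * ((2 * v)⁻¹) ^ (n + 1) := by
      have := Real.pi_pos
      positivity
    have key : 2 * Real.pi * ((2 * v)⁻¹) ^ (n + 1) ≤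
        (betaIntegral v (a + 1) b).re + (betaIntegral v a (b + 1)).re := by
      rcases a with _ | a
      · obtain ⟨b, rfl⟩ : ∃ b', b = b' + 1 := ⟨b - 1, by omega⟩
        have h1 := ih 0 b (by omega)
        rw [betaIntegral_comm v 0, betaIntegral_zero_right hv]
        simpa using h1
      · rcases b with _ | b
        · have h1 := ih a 0 (by omega)
          rw [betaIntegral_zero_right hv]
          simpa using h1
        · have h1 := ih (a + 1) b (by omega)
          have h2 := ih a (b + 1) (by omega)
          linarith
    rw [← hrec] at key
    have h2v : 0 < 2 * v := by linarith
    rw [pow_succ, ← mul_assoc, ← div_eq_mul_inv, div_le_iff₀ h2v]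
    linarith

/-! ### Exchanging the ends of two strings -/

theorem siteTerm_zero (v y : ℝ) : siteTerm v y 0 = v + y * Complex.I := by
  simp [siteTerm, siteEnergy]

theorem siteTerm_one (v y : ℝ) : siteTerm v y 1 = -(v - y * Complex.I) := by
  simp [siteTerm, siteEnergy]
  ring

/-- The inner sites of a string enter its leading term only through the numbers `k` and `m` of
empty and occupied ones; the signs drop out. -/
theorem exists_prod_siteTerm_sq (v : ℝ) (s : ℕ → Fin 2) (j : ℕ) : ∃ k m : ℕ, k + m = j ∧
    ∀ y : ℝ, ∏ i ∈ Finset.range j, (siteTerm v y (s (i + 1)))⁻¹ ^ 2 =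
      ((v + y * Complex.I : ℂ)⁻¹) ^ (2 * k) * ((v - y * Complex.I : ℂ)⁻¹) ^ (2 * m) := by
  induction j with
  | zero => exact ⟨0, 0, rfl, fun y => by simp⟩
  | succ j ih =>
    obtain ⟨k, m, hkm, h⟩ := ih
    have h01 : s (j + 1) = 0 ∨ s (j + 1) = 1 := by
      generalize s (j + 1) = t
      fin_cases t <;> simp
    rcases h01 with h0 | h1
    · refine ⟨k + 1, m, by omega, fun y => ?_⟩
      rw [Finset.prod_range_succ, h, h0, siteTerm_zero]
      ring
    · refine ⟨k, m + 1, by omega, fun y => ?_⟩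
      rw [Finset.prod_range_succ, h, h1, siteTerm_one, inv_neg, neg_sq]
      ring

/-- Exchanging the right ends of the strings `0u0` and `1u1`, where `u` has length `j`,
raises the band shift. -/
theorem stringTerm_exchange {v : ℝ} (hv : 4 ≤ v) {j : ℕ} (hj : 8 * ((j : ℝ) + 1) ≤ v ^ 2)
    {s t p r : ℕ → Fin 2} (hs : s 0 = 0) (hs' : s (j + 1) = 0) (ht : t 0 = 1) (ht' : t (j + 1) = 1)
    (hp : p 0 = 0) (hp' : p (j + 1) = 1) (hr : r 0 = 1) (hr' : r (j + 1) = 0)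
    (hts : ∀ i < j, t (i + 1) = s (i + 1)) (hps : ∀ i < j, p (i + 1) = s (i + 1))
    (hrs : ∀ i < j, r (i + 1) = s (i + 1)) :
    2 * ((2 * v)⁻¹) ^ (2 * j + 1) - 48 * (j + 1) * (v ^ 2)⁻¹ * (v⁻¹ * ((v ^ 2)⁻¹) ^ j) ≤
      stringTerm v p j + stringTerm v r j - stringTerm v s j - stringTerm v t j := by
  have hv0 : 0 < v := by linarith
  obtain ⟨k, m, hkm, hprod⟩ := exists_prod_siteTerm_sq v s j
  have e1 : ∀ (w : ℕ → Fin 2), (∀ i < j, w (i + 1) = s (i + 1)) → ∀ y,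
      stringLead v y w j = (siteTerm v y (w 0))⁻¹ * (siteTerm v y (w (j + 1)))⁻¹ *
        (((v + y * Complex.I : ℂ)⁻¹) ^ (2 * k) * ((v - y * Complex.I : ℂ)⁻¹) ^ (2 * m)) := by
    intro w hw y
    rw [← hprod, stringLead]
    congr 1
    exact Finset.prod_congr rfl fun i hi => by rw [hw i (Finset.mem_range.mp hi)]
  -- the ends contribute `1 / (v + i y)` or `-1 / (v - i y)`, so the exchange produces the square of
  -- their difference, which is `2 v / (v² + y²)`
  have hlead : (∫ y, stringLead v y s j) + (∫ y, stringLead v y t j) - (∫ y, stringLead v y p j) -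
      (∫ y, stringLead v y r j) = 4 * v ^ 2 * betaIntegral v (2 * k + 1 + 1) (2 * m + 1 + 1) := by
    have is := integrable_stringLead hv0 s j
    have it := integrable_stringLead hv0 t j
    have ip := integrable_stringLead hv0 p j
    have ir := integrable_stringLead hv0 r j
    rw [← MeasureTheory.integral_add' is it, ← MeasureTheory.integral_sub' (is.add it) ip,
      ← MeasureTheory.integral_sub' ((is.add it).sub ip) ir, betaIntegral,
      ← MeasureTheory.integral_const_mul]
    congr 1
    funext y
    simp only [Pi.add_apply, Pi.sub_apply]
    rw [e1 s (fun _ _ => rfl), e1 t hts, e1 p hps, e1 r hrs, hs, hs', ht, ht', hp, hp', hr, hr',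
      siteTerm_zero, siteTerm_one, inv_neg]
    have h1 := add_mul_I_ne_zero hv0 y
    have h2 := sub_mul_I_ne_zero hv0 y
    have e : (2 * v : ℂ) * ((v + y * Complex.I : ℂ)⁻¹ * (v - y * Complex.I : ℂ)⁻¹) =
        (v + y * Complex.I : ℂ)⁻¹ + (v - y * Complex.I : ℂ)⁻¹ := by
      field_simp
      ring
    set P := (v + y * Complex.I : ℂ)⁻¹
    set Q := (v - y * Complex.I : ℂ)⁻¹
    linear_combination -(P ^ (2 * k) * Q ^ (2 * m)) * (P + Q + 2 * v * (P * Q)) * e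
  have hbeta := le_betaIntegral hv0 (2 * j + 2) (2 * k + 1) (2 * m + 1) (by omega)
  have hre := congrArg Complex.re hlead
  have e2 : (4 * (v : ℂ) ^ 2 * betaIntegral v (2 * k + 1 + 1) (2 * m + 1 + 1)).re =
      4 * v ^ 2 * (betaIntegral v (2 * k + 1 + 1) (2 * m + 1 + 1)).re := by
    rw [← Complex.re_ofReal_mul]; push_cast; rfl
  rw [e2, Complex.sub_re, Complex.sub_re, Complex.add_re] at hre
  have bs := abs_le.mp (abs_stringTerm_add_lead_le hv s j hj)
  have bt := abs_le.mp (abs_stringTerm_add_lead_le hv t j hj)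
  have bp := abs_le.mp (abs_stringTerm_add_lead_le hv p j hj)
  have br := abs_le.mp (abs_stringTerm_add_lead_le hv r j hj)
  have hmain : 2 * ((2 * v)⁻¹) ^ (2 * j + 1) ≤ Real.pi⁻¹ * (4 * v ^ 2 *
      (betaIntegral v (2 * k + 1 + 1) (2 * m + 1 + 1)).re) := by
    have hpi := Real.pi_pos
    calc 2 * ((2 * v)⁻¹) ^ (2 * j + 1) = Real.pi⁻¹ * (4 * v ^ 2 *
          (2 * Real.pi * ((2 * v)⁻¹) ^ (2 * j + 2 + 1))) := by
          rw [show 2 * j + 2 + 1 = 2 * j + 1 + 2 by ring, pow_add _ (2 * j + 1) 2]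
          generalize ((2 * v)⁻¹) ^ (2 * j + 1) = Z
          field_simp
          ring
      _ ≤ _ := by gcongr
  rw [← hre] at hmain
  simp only [mul_sub, mul_add] at hmain
  linarith [bs.1, bs.2, bt.1, bt.2, bp.1, bp.2, br.1, br.2]

/-! ### Systems of cycles and the exchange of their tails -/

theorem continuant_congr (v y : ℝ) (n : ℕ) {s t : ℕ → Fin 2} (h : ∀ i < n, s i = t i) :
    continuant v y n s = continuant v y n t := by
  induction n using Nat.strong_induction_on generalizing s t with
  | _ n ih =>
    match n, ih, h with
    | 0, _, _ => rfl
    | 1, _, h => simp [continuant, h 0 (by omega)]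
    | n + 2, ih, h =>
      simp only [continuant]
      rw [h 0 (by omega), ih (n + 1) (by omega) (s := shift s) (t := shift t)
        (fun i hi => h (i + 1) (by omega)), ih n (by omega) (s := shift (shift s))
        (t := shift (shift t)) (fun i hi => h (i + 2) (by omega))]

theorem stringTerm_congr (v : ℝ) (j : ℕ) {s t : ℕ → Fin 2} (h : ∀ i < j + 2, s i = t i) :
    stringTerm v s j = stringTerm v t j := by
  have h' : ∀ n ≤ j + 2, bandShift v s n = bandShift v t n := fun n hn => by
    unfold bandShift
    simp only [continuant_congr v _ n fun i hi => h i (by omega)]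
  have h'' : ∀ n ≤ j + 1, bandShift v (shift s) n = bandShift v (shift t) n := fun n hn => by
    unfold bandShift
    simp only [continuant_congr v _ n (s := shift s) (t := shift t)
      fun i hi => h (i + 1) (by omega)]
  unfold stringTerm
  rw [h' _ le_rfl, h' (j + 1) (by omega), h'' j (by omega), h'' (j + 1) le_rfl]

theorem summable_stringTerm {v : ℝ} (hv : 4 ≤ v) (s : ℕ → Fin 2) :
    Summable fun j => stringTerm v s j := by
  refine Summable.of_norm_bounded (g := fun j => 4 / v * (2 / v ^ 2) ^ j) ?_
    (fun j => abs_stringTerm_le hv s j)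
  refine (summable_geometric_of_lt_one (by positivity) ?_).mul_left _
  rw [div_lt_one (by positivity)]
  nlinarith

/-- The contribution to the band shift of all strings that start at the first site of `s`. -/
noncomputable def siteShift (v : ℝ) (s : ℕ → Fin 2) : ℝ := ∑' j, stringTerm v s j

section Cycles

variable {V : Type*} (π : Equiv.Perm V) (σ : V → Fin 2)

/-- The configuration read along the cycle of `π` through `w`, starting at `w`. A permutation `π`
of a finite set `V` of sites, together with the occupation numbers `σ`, stands for a finite
collection of periodic configurations, one for each cycle. -/
def cycleStream (w : V) : ℕ → Fin 2 := fun k => σ ((π ^ k) w)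

theorem cycleStream_succ (w : V) (k : ℕ) :
    cycleStream π σ w (k + 1) = cycleStream π σ (π w) k := by
  simp only [cycleStream, pow_succ, Equiv.Perm.mul_apply]

theorem cycleStream_add (w : V) (i : ℕ) :
    (fun k => cycleStream π σ w (i + k)) = cycleStream π σ ((π ^ i) w) := by
  funext k
  simp only [cycleStream, add_comm i, pow_add, Equiv.Perm.mul_apply]

/-- The total band shift of a system of cycles. -/
noncomputable def totalShift [Fintype V] (v : ℝ) (π : Equiv.Perm V) (σ : V → Fin 2) : ℝ :=
  ∑ w, siteShift v (cycleStream π σ w)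

variable [DecidableEq V] {π σ} {a b : V} {j : ℕ}

/-- Exchanging the successors of two sites does not affect short strings if the configurations
that follow these sites agree. -/
theorem cycleStream_exchange_eq
    (hag : ∀ i < j, cycleStream π σ (π a) i = cycleStream π σ (π b) i) :
    ∀ k ≤ j + 1, ∀ w, ∀ i < k,
      cycleStream (π * Equiv.swap a b) σ w i = cycleStream π σ w i := by
  intro k
  induction k with
  | zero => intro _ _ i hi; omega
  | succ k ih =>
    intro hk w i hi
    rcases i with _ | i
    · rfl
    · rw [cycleStream_succ, cycleStream_succ, ih (by omega) _ i (by omega)]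
      by_cases ha : w = a
      · subst ha
        simp [hag i (by omega)]
      · by_cases hb : w = b
        · subst hb
          simp [hag i (by omega)]
        · rw [Equiv.Perm.mul_apply, Equiv.swap_apply_of_ne_of_ne ha hb]

/-- The number of strings of length `k` that are affected by an exchange grows linearly. -/
theorem card_cycleStream_ne_le [Fintype V]
    (hag : ∀ i < j, cycleStream π σ (π a) i = cycleStream π σ (π b) i) (m : ℕ) :
    (Finset.univ.filter fun w => ∃ i < j + 1 + m,
      cycleStream (π * Equiv.swap a b) σ w i ≠ cycleStream π σ w i).card ≤ 2 * m := by
  induction m with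
  | zero =>
    refine (Finset.card_eq_zero.mpr (Finset.filter_eq_empty_iff.mpr fun w _ => ?_)).le
    rintro ⟨i, hi, hne⟩
    exact hne (cycleStream_exchange_eq hag _ le_rfl w i (by omega))
  | succ m ih =>
    set B := Finset.univ.filter fun w => ∃ i < j + 1 + m,
      cycleStream (π * Equiv.swap a b) σ w i ≠ cycleStream π σ w i with hB
    have hsub : (Finset.univ.filter fun w => ∃ i < j + 1 + (m + 1),
        cycleStream (π * Equiv.swap a b) σ w i ≠ cycleStream π σ w i) ⊆
        B.image π.symm ∪ {a, b} := by
      intro w hw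
      obtain ⟨i, hi, hne⟩ := (Finset.mem_filter.mp hw).2
      rw [Finset.mem_union]
      by_cases ha : w = a
      · right; simp [ha]
      by_cases hb : w = b
      · right; simp [hb]
      left
      rcases i with _ | i
      · exact absurd rfl hne
      rw [cycleStream_succ, cycleStream_succ, Equiv.Perm.mul_apply,
        Equiv.swap_apply_of_ne_of_ne ha hb] at hne
      rw [Finset.mem_image]
      exact ⟨π w, by rw [hB, Finset.mem_filter]; exact ⟨Finset.mem_univ _, i, by omega, hne⟩,
        by simp⟩
    calc _ ≤ (B.image π.symm ∪ {a, b}).card := Finset.card_le_card hsub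
      _ ≤ (B.image π.symm).card + ({a, b} : Finset V).card := Finset.card_union_le _ _
      _ ≤ 2 * m + 2 := add_le_add (Finset.card_image_le.trans ih) Finset.card_le_two
      _ = 2 * (m + 1) := by ring

/-- A pair of strings `0u0` and `1u1` can be exchanged with a gain. -/
theorem totalShift_lt_exchange [Fintype V] {v : ℝ} (hv : 4 ≤ v) (hj : 176 * 8 ^ j < v ^ 2)
    (ha : σ a = 0) (hb : σ b = 1)
    (hag : ∀ i < j, cycleStream π σ (π a) i = cycleStream π σ (π b) i)
    (ha' : cycleStream π σ (π a) j = 0) (hb' : cycleStream π σ (π b) j = 1) :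
    totalShift v π σ < totalShift v (π * Equiv.swap a b) σ := by
  have hv0 : 0 < v := by linarith
  set π' := π * Equiv.swap a b with hπ'
  have hne : a ≠ b := by rintro rfl; rw [ha] at hb; exact absurd hb (by decide)
  set ε : ℝ := 2 / v ^ 2 with hε
  have hε0 : 0 < ε := by positivity
  have hε8 : ε ≤ 1 / 8 := by
    rw [hε, div_le_div_iff₀ (by positivity) (by norm_num)]
    nlinarith
  -- `D l` is the change of all interactions of strings of length `l + 2`
  let D : ℕ → ℝ := fun l =>
    ∑ w, (stringTerm v (cycleStream π' σ w) l - stringTerm v (cycleStream π σ w) l)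
  have hsum : ∀ w, Summable fun l =>
      stringTerm v (cycleStream π' σ w) l - stringTerm v (cycleStream π σ w) l :=
    fun w => (summable_stringTerm hv _).sub (summable_stringTerm hv _)
  have hD : totalShift v π' σ - totalShift v π σ = ∑' l, D l := by
    rw [totalShift, totalShift, ← Finset.sum_sub_distrib]
    simp only [D]
    rw [Summable.tsum_finsetSum fun w _ => hsum w]
    exact Finset.sum_congr rfl fun w _ =>
      ((summable_stringTerm hv _).tsum_sub (summable_stringTerm hv _)).symm
  have hDs : Summable D := summable_sum fun w _ => hsum w
  -- strings shorter than `0u0` are unaffected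
  have hlow : ∀ l < j, D l = 0 := fun l hl => Finset.sum_eq_zero fun w _ => by
    rw [stringTerm_congr v l fun i hi =>
      cycleStream_exchange_eq hag (j + 1) le_rfl w i (by omega), sub_self]
  -- among the strings of the same length, only the two exchanged ones change
  have hmid : 2 * ((2 * v)⁻¹) ^ (2 * j + 1) - 48 * (j + 1) * (v ^ 2)⁻¹ * (v⁻¹ * ((v ^ 2)⁻¹) ^ j) ≤
      D j := by
    have h0 : ∀ w, w ≠ a ∧ w ≠ b →
        stringTerm v (cycleStream π' σ w) j - stringTerm v (cycleStream π σ w) j = 0 := by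
      rintro w ⟨hwa, hwb⟩
      rw [sub_eq_zero]
      refine stringTerm_congr v j fun i hi => ?_
      rcases i with _ | i
      · rfl
      rw [cycleStream_succ, cycleStream_succ, hπ', Equiv.Perm.mul_apply,
        Equiv.swap_apply_of_ne_of_ne hwa hwb]
      exact cycleStream_exchange_eq hag (j + 1) le_rfl _ i (by omega)
    have e : D j = (stringTerm v (cycleStream π' σ a) j - stringTerm v (cycleStream π σ a) j) +
        (stringTerm v (cycleStream π' σ b) j - stringTerm v (cycleStream π σ b) j) :=
      Fintype.sum_eq_add a b hne h0
    have hπa : π' a = π b := by simp [hπ']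
    have hπb : π' b = π a := by simp [hπ']
    have hex : ∀ w, ∀ i < j + 1, cycleStream π' σ w i = cycleStream π σ w i := fun w i hi =>
      cycleStream_exchange_eq hag (j + 1) le_rfl w i hi
    have hj8 : 8 * ((j : ℝ) + 1) ≤ v ^ 2 := by
      have h1 : (j : ℝ) + 1 ≤ 8 ^ j := by
        have : j + 1 ≤ 8 ^ j := Nat.lt_pow_self (by norm_num)
        exact_mod_cast this
      linarith [show (0 : ℝ) < 8 ^ j by positivity]
    have hx := stringTerm_exchange hv hj8 (s := cycleStream π σ a) (t := cycleStream π σ b)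
      (p := cycleStream π' σ a) (r := cycleStream π' σ b) ha
      (by rw [cycleStream_succ, ha']) hb (by rw [cycleStream_succ, hb']) ha
      (by rw [cycleStream_succ, hπa, hex _ _ (by omega), hb']) hb
      (by rw [cycleStream_succ, hπb, hex _ _ (by omega), ha'])
      (fun i hi => by rw [cycleStream_succ, cycleStream_succ, hag i hi])
      (fun i hi => by
        rw [cycleStream_succ, cycleStream_succ, hπa, hex _ _ (by omega), hag i hi])
      (fun i hi => by rw [cycleStream_succ, cycleStream_succ, hπb, hex _ _ (by omega)])
    rw [e]
    linarith
  -- the number of longer strings that change grows linearly, their interaction decays geometrically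
  have hhigh : ∀ m, ‖D (m + (j + 1))‖ ≤ (8 * (4 / v * ε ^ j) * ε) * (2 * ε) ^ m := by
    intro m
    set l := m + (j + 1) with hl
    set B := Finset.univ.filter fun w => ∃ i < j + 1 + (m + 2),
      cycleStream π' σ w i ≠ cycleStream π σ w i with hB
    have hBc : B.card ≤ 2 * (m + 2) := card_cycleStream_ne_le hag (m + 2)
    have e : D l = ∑ w ∈ B,
        (stringTerm v (cycleStream π' σ w) l - stringTerm v (cycleStream π σ w) l) := by
      refine (Finset.sum_subset (Finset.subset_univ B) fun w _ hw => ?_).symm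
      rw [sub_eq_zero]
      refine stringTerm_congr v l fun i hi => ?_
      by_contra hne
      exact hw (Finset.mem_filter.mpr ⟨Finset.mem_univ w, i, by omega, hne⟩)
    rw [e]
    have hterm : ∀ w ∈ B,
        ‖stringTerm v (cycleStream π' σ w) l - stringTerm v (cycleStream π σ w) l‖ ≤
          2 * (4 / v * ε ^ l) := by
      intro w _
      refine (norm_sub_le _ _).trans ?_
      have h1 := abs_stringTerm_le hv (cycleStream π' σ w) l
      have h2 := abs_stringTerm_le hv (cycleStream π σ w) l
      rw [Real.norm_eq_abs, Real.norm_eq_abs]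
      linarith
    refine (norm_sum_le_of_le B hterm).trans ?_
    rw [Finset.sum_const, nsmul_eq_mul]
    have hm : (m : ℝ) + 2 ≤ 2 * 2 ^ m := by
      have : m + 1 ≤ 2 ^ m := Nat.lt_two_pow_self
      have h2 : (m : ℝ) + 1 ≤ 2 ^ m := by exact_mod_cast this
      have h3 : (1 : ℝ) ≤ 2 ^ m := one_le_pow₀ (by norm_num)
      linarith
    have hc : (B.card : ℝ) ≤ 4 * 2 ^ m := by
      have : (B.card : ℝ) ≤ 2 * (m + 2) := by exact_mod_cast hBc
      linarith
    calc (B.card : ℝ) * (2 * (4 / v * ε ^ l)) ≤ (4 * 2 ^ m) * (2 * (4 / v * ε ^ l)) := by gcongr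
      _ = _ := by
        rw [hl, pow_add, pow_add, pow_one, mul_pow]
        ring
  have htail : ‖∑' m, D (m + (j + 1))‖ ≤ 16 * (4 / v * ε ^ j) * ε := by
    have hg : HasSum (fun m => (8 * (4 / v * ε ^ j) * ε) * (2 * ε) ^ m)
        ((8 * (4 / v * ε ^ j) * ε) * (1 - 2 * ε)⁻¹) :=
      (hasSum_geometric_of_lt_one (by positivity) (by linarith)).mul_left _
    refine (tsum_of_norm_bounded hg hhigh).trans ?_
    have h1 : (1 - 2 * ε)⁻¹ ≤ 2 := by
      rw [inv_le_comm₀ (by linarith) (by norm_num)]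
      linarith
    calc _ ≤ (8 * (4 / v * ε ^ j) * ε) * 2 := by gcongr
      _ = _ := by ring
  have hsplit : ∑' l, D l = D j + ∑' m, D (m + (j + 1)) := by
    rw [← hDs.sum_add_tsum_nat_add (j + 1), Finset.sum_range_succ,
      Finset.sum_eq_zero fun l hl => hlow l (Finset.mem_range.mp hl), zero_add]
  have htail' := (abs_le.mp htail).1
  set z : ℝ := v⁻¹ * ((v ^ 2)⁻¹) ^ j with hz
  have hz0 : 0 < z := by positivity
  have e1 : ((2 * v)⁻¹) ^ (2 * j + 1) = (1 / 2) * (4 ^ j)⁻¹ * z := by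
    rw [hz, pow_succ, pow_mul, mul_inv, mul_pow, mul_pow, ← inv_pow, ← inv_pow]
    norm_num
    ring
  have e2 : 16 * (4 / v * ε ^ j) * ε = 128 * 2 ^ j * (v ^ 2)⁻¹ * z := by
    rw [hz, hε, div_eq_mul_inv 2 (v ^ 2), mul_pow]
    ring
  rw [e1] at hmid
  rw [e2] at htail'
  -- `48 (j + 1) + 128 * 2 ^ j ≤ 176 * 2 ^ j`, and `2 ^ j * 4 ^ j = 8 ^ j`
  have hfin : (48 * ((j : ℝ) + 1) + 128 * 2 ^ j) * (v ^ 2)⁻¹ < (4 ^ j)⁻¹ := by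
    have h1 : (j : ℝ) + 1 ≤ 2 ^ j := by
      have : j + 1 ≤ 2 ^ j := Nat.lt_two_pow_self
      exact_mod_cast this
    rw [← div_eq_mul_inv, div_lt_iff₀ (by positivity), inv_mul_eq_div, lt_div_iff₀ (by positivity)]
    have h2 : (8 : ℝ) ^ j = 2 ^ j * 4 ^ j := by rw [← mul_pow]; norm_num
    have h3 : (0 : ℝ) < 4 ^ j := by positivity
    rw [h2] at hj
    nlinarith
  have := mul_lt_mul_of_pos_right hfin hz0
  linarith

/-! ### Optimal systems are balanced -/

theorem numOnes_add (s : ℕ → Fin 2) (n m : ℕ) :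
    numOnes s (n + m) = numOnes s n + numOnes (fun k => s (n + k)) m := by
  simp only [numOnes, Finset.sum_range_add]

theorem numOnes_succ (s : ℕ → Fin 2) (n : ℕ) : numOnes s (n + 1) = numOnes s n + s n := by
  simp only [numOnes, Finset.sum_range_succ]

/-- In an optimal system of cycles the numbers of particles in two intervals of the same length
`k ≤ q` differ by at most one. -/
theorem numOnes_le_of_forall_totalShift_le [Fintype V] {v : ℝ} (hv : 4 ≤ v) {q : ℕ}
    (hq : 176 * 8 ^ q < v ^ 2) (hmax : ∀ π' : Equiv.Perm V, totalShift v π' σ ≤ totalShift v π σ)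
    (k : ℕ) (hk : k ≤ q) (w w' : V) :
    numOnes (cycleStream π σ w') k ≤ numOnes (cycleStream π σ w) k + 1 := by
  induction k using Nat.strong_induction_on generalizing w w' with
  | _ k ih =>
    by_contra! hcon
    set s := cycleStream π σ w with hs
    set t := cycleStream π σ w' with ht
    have hk2 : 2 ≤ k := by
      have := numOnes_le t k
      omega
    -- in a shortest pair that violates the claim the counts differ by exactly one at every
    -- intermediate length, so the two intervals are `0u0` and `1u1` with the same `u`
    have hmid : ∀ i, 0 < i → i < k → numOnes t i = numOnes s i + 1 := by
      intro i h0 hi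
      have h1 := ih i hi (by omega) w w'
      have h2 := ih (k - i) (by omega) (by omega) ((π ^ i) w) ((π ^ i) w')
      rw [← cycleStream_add, ← cycleStream_add] at h2
      have h3 := numOnes_add t i (k - i)
      have h4 := numOnes_add s i (k - i)
      rw [Nat.add_sub_cancel' hi.le] at h3 h4
      simp only [← hs, ← ht] at h1 h2
      omega
    have hlt : ∀ x : Fin 2, (x : ℕ) < 2 := fun x => x.2
    obtain ⟨j, rfl⟩ : ∃ j, k = j + 2 := ⟨k - 2, by omega⟩
    have f1 := hmid 1 (by omega) (by omega)
    rw [numOnes_succ, numOnes_succ] at f1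
    simp only [numOnes, Finset.range_zero, Finset.sum_empty, zero_add] at f1
    have s0 : s 0 = 0 := by have := hlt (s 0); have := hlt (t 0); omega
    have t0 : t 0 = 1 := by have := hlt (s 0); have := hlt (t 0); omega
    have f2 := hmid (j + 1) (by omega) (by omega)
    have f3 : numOnes t (j + 1 + 1) = _ := numOnes_succ t (j + 1)
    have f4 : numOnes s (j + 1 + 1) = _ := numOnes_succ s (j + 1)
    have s1 : s (j + 1) = 0 := by
      have := hlt (s (j + 1)); have := hlt (t (j + 1))
      rw [show j + 2 = j + 1 + 1 from rfl] at hcon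
      omega
    have t1 : t (j + 1) = 1 := by
      have := hlt (s (j + 1)); have := hlt (t (j + 1))
      rw [show j + 2 = j + 1 + 1 from rfl] at hcon
      omega
    refine absurd (totalShift_lt_exchange (a := w) (b := w') (j := j) hv ?_ s0 t0 ?_ ?_ ?_)
      (not_lt.mpr (hmax _))
    · refine lt_of_le_of_lt ?_ hq
      gcongr
      · norm_num
      · omega
    · intro i hi
      rw [← cycleStream_succ, ← cycleStream_succ]
      have g1 := hmid (i + 1) (by omega) (by omega)
      have g2 := hmid (i + 1 + 1) (by omega) (by omega)
      have g3 : numOnes t (i + 1 + 1) = _ := numOnes_succ t (i + 1)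
      have g4 : numOnes s (i + 1 + 1) = _ := numOnes_succ s (i + 1)
      ext
      simp only [← hs, ← ht]
      omega
    · rw [← cycleStream_succ]; exact s1
    · rw [← cycleStream_succ]; exact t1

end Cycles

/-! ### Balanced periodic configurations -/

theorem fin_two_eq (a : Fin 2) : a = 0 ∨ a = 1 := by
  fin_cases a <;> simp

theorem formulaConfig_eq_one_iff {p q : ℕ} (hq : 0 < q) (hpq : p ≤ q) (k : ℤ) :
    formulaConfig p q k = 1 ↔ ((p : ℤ) * k) % q < p := by
  have hq' : (0 : ℤ) < q := by exact_mod_cast hq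
  have h1 : formulaConfig p q k = 1 ↔ ∃ j : ℕ, j < p ∧ (p : ℤ) * k ≡ (j : ℤ) [ZMOD (q : ℤ)] := by
    unfold formulaConfig
    split_ifs with h <;> simp [h]
  rw [h1]
  constructor
  · rintro ⟨j, hj, hmod⟩
    rw [Int.ModEq, Int.emod_eq_of_lt (a := (j : ℤ)) (by omega) (by omega)] at hmod
    omega
  · intro h
    have h0 := Int.emod_nonneg ((p : ℤ) * k) hq'.ne'
    refine ⟨(((p : ℤ) * k) % q).toNat, by omega, ?_⟩
    rw [Int.toNat_of_nonneg h0]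
    exact (Int.mod_modEq _ _).symm

theorem formulaConfig_eq_iff {p q : ℕ} (hq : 0 < q) (hpq : p ≤ q) {k : ℤ} {a : Fin 2} :
    a = formulaConfig p q k ↔ (a = 1 ↔ ((p : ℤ) * k) % q < p) := by
  rw [← formulaConfig_eq_one_iff hq hpq]
  rcases fin_two_eq a with rfl | rfl <;> rcases fin_two_eq (formulaConfig p q k) with h | h <;>
    simp [h]

theorem formulaConfig_add_period (p q : ℕ) (k : ℤ) :
    formulaConfig p q (k + q) = formulaConfig p q k := by
  unfold formulaConfig
  have : ∀ j : ℕ, ((p : ℤ) * (k + q) ≡ (j : ℤ) [ZMOD (q : ℤ)]) ↔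
      ((p : ℤ) * k ≡ (j : ℤ) [ZMOD (q : ℤ)]) := by
    intro j
    simp only [Int.ModEq, mul_add, Int.add_mul_emod_self_right]
  simp only [this]

/-- Reflection of the block of occupied residues. -/
theorem emod_lt_iff_reflect {p q : ℤ} (hp : 0 ≤ p) (hq : 0 < q) (hpq : p ≤ q) (x : ℤ) :
    x % q < p ↔ (p - 1 - x) % q < p := by
  have h0 := Int.emod_nonneg x hq.ne'
  have h1 := Int.emod_lt_of_pos x hq
  have hx := Int.mul_ediv_add_emod x q
  set r := x % q
  constructor
  · intro h
    have e : p - 1 - x = (p - 1 - r) + q * (-(x / q)) := by linarith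
    rw [e, Int.add_mul_emod_self_left, Int.emod_eq_of_lt (by omega) (by omega)]
    omega
  · intro h
    by_contra hr
    have e : p - 1 - x = (p - 1 - r + q) + q * (-(x / q) - 1) := by linarith
    rw [e, Int.add_mul_emod_self_left, Int.emod_eq_of_lt (by omega) (by omega)] at h
    omega

theorem exists_mul_modEq {p q : ℕ} (hpq : Nat.Coprime p q) (C : ℤ) :
    ∃ c z : ℤ, (p : ℤ) * c = C + q * z := by
  obtain ⟨u, w, huw⟩ := Nat.isCoprime_iff_coprime.mpr hpq
  exact ⟨C * u, -(C * w), by linear_combination C * huw⟩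

/-- The mirror images of the configuration given by the formula are translates of it. -/
theorem mem_orbit_iff {p q : ℕ} (hq : 0 < q) (hpq : p ≤ q) (hc : Nat.Coprime p q) (η : Config) :
    η ∈ orbit (formulaConfig p q) ↔ ∃ c : ℤ, ∀ k, η k = formulaConfig p q (k + c) := by
  constructor
  · rintro ⟨a, h | h⟩
    · exact ⟨a, h⟩
    · obtain ⟨b, z, hb⟩ := exists_mul_modEq hc (p - 1 - p * a)
      refine ⟨b, fun k => ?_⟩
      rw [h, formulaConfig_eq_iff hq hpq, formulaConfig_eq_one_iff hq hpq,
        emod_lt_iff_reflect (Int.natCast_nonneg p) (by exact_mod_cast hq) (by exact_mod_cast hpq)]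
      have e : (p : ℤ) * (k + b) = (p - 1 - p * (a - k)) + q * z := by
        rw [mul_add, hb]; ring
      rw [e, Int.add_mul_emod_self_left]
  · rintro ⟨c, h⟩
    exact ⟨c, Or.inl h⟩

/-- The occupied sites are the places where `⌊p k / q⌋` increases. -/
theorem formulaConfig_eq_sub {p q : ℕ} (hq : 0 < q) (hpq : p ≤ q) (k : ℤ) :
    ((formulaConfig p q k : ℕ) : ℤ) = (p * k) / q - (p * (k - 1)) / q := by
  have hq' : (0 : ℤ) < q := by exact_mod_cast hq
  have hpq' : (p : ℤ) ≤ q := by exact_mod_cast hpq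
  have h0 := Int.emod_nonneg ((p : ℤ) * k) hq'.ne'
  have h1 := Int.emod_lt_of_pos ((p : ℤ) * k) hq'
  have hx := Int.mul_ediv_add_emod ((p : ℤ) * k) q
  have hiff := formulaConfig_eq_one_iff hq hpq k
  set r := ((p : ℤ) * k) % q
  set d := ((p : ℤ) * k) / q
  by_cases h : r < p
  · have e : (p : ℤ) * (k - 1) = (r - p + q) + q * (d - 1) := by linarith
    rw [hiff.mpr h, e, Int.add_mul_ediv_left _ _ hq'.ne',
      Int.ediv_eq_zero_of_lt (by omega) (by omega)]
    simp
  · have e : (p : ℤ) * (k - 1) = (r - p) + q * d := by linarith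
    rw [(fin_two_eq (formulaConfig p q k)).resolve_right (fun h' => h (hiff.mp h')), e,
      Int.add_mul_ediv_left _ _ hq'.ne', Int.ediv_eq_zero_of_lt (by omega) (by omega)]
    simp

theorem numOnes_formulaConfig {p q : ℕ} (hq : 0 < q) (hpq : p ≤ q) (a : ℤ) :
    numOnes (streamAt (formulaConfig p q) a) q = p := by
  have hq' : (0 : ℤ) < q := by exact_mod_cast hq
  have key : ∀ n : ℕ, (numOnes (streamAt (formulaConfig p q) a) n : ℤ) =
      (p * (a + n - 1)) / q - (p * (a - 1)) / q := by
    intro n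
    induction n with
    | zero => simp [numOnes]
    | succ n ih =>
      rw [numOnes_succ]
      push_cast
      rw [ih, streamAt, formulaConfig_eq_sub hq hpq]
      ring_nf
  have := key q
  have e : (p : ℤ) * (a + q - 1) = p * (a - 1) + q * p := by ring
  rw [e, Int.add_mul_ediv_left _ _ hq'.ne'] at this
  omega

/-- A configuration in which every interval of length `q` contains `p` particles, and in which
the numbers of particles in shorter intervals of equal length differ by at most one, is a
translate of the configuration given by the formula. The reason is that the discrepancy
`q N(k) - p k`, with `N(k)` the number of particles on the first `k` sites, takes values in an
interval of length less than `q` and is determined modulo `q`. -/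
theorem exists_eq_formulaConfig {p q : ℕ} (hq : 0 < q) (hpq : p ≤ q) (hc : Nat.Coprime p q)
    {s : ℕ → Fin 2} (hcount : ∀ i, numOnes (fun k => s (i + k)) q = p)
    (hbal : ∀ k ≤ q, ∀ i i', numOnes (fun l => s (i' + l)) k ≤ numOnes (fun l => s (i + l)) k + 1) :
    ∃ c : ℤ, ∀ k : ℕ, s k = formulaConfig p q (k + c) := by
  have hq' : (0 : ℤ) < q := by exact_mod_cast hq
  -- the mean number of particles in an interval of length `k` is `k p / q`; every count is within
  -- one of every other, hence differs from the mean by less than one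
  have havg : ∀ i k : ℕ, ∑ l ∈ Finset.range q, numOnes (fun m => s (i + l + m)) k = k * p := by
    intro i k
    have e : ∀ m ∈ Finset.range k, ∑ l ∈ Finset.range q, (s (i + l + m) : ℕ) = p := by
      intro m _
      rw [← hcount (i + m), numOnes]
      exact Finset.sum_congr rfl fun l _ => by rw [add_right_comm]
    simp only [numOnes]
    rw [Finset.sum_comm, Finset.sum_congr rfl e]
    simp
  have hnear : ∀ i k : ℕ, k ≤ q →
      (q : ℤ) * numOnes (fun m => s (i + m)) k < k * p + q ∧
      (k : ℤ) * p - q < q * numOnes (fun m => s (i + m)) k := by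
    intro i k hk
    set c := numOnes (fun m => s (i + m)) k with hcdef
    have hmem : 0 ∈ Finset.range q := Finset.mem_range.mpr hq
    constructor
    · have h : ∑ _l ∈ Finset.range q, ((c : ℤ) - 1) <
          ∑ l ∈ Finset.range q, (numOnes (fun m => s (i + l + m)) k : ℤ) := by
        refine Finset.sum_lt_sum (fun l _ => ?_) ⟨0, hmem, ?_⟩
        · have := hbal k hk (i + l) i
          omega
        · simp only [add_zero, ← hcdef]
          omega
      rw [← Nat.cast_sum, havg, Finset.sum_const, Finset.card_range, nsmul_eq_mul] at h
      push_cast at h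
      linarith
    · have h : ∑ l ∈ Finset.range q, (numOnes (fun m => s (i + l + m)) k : ℤ) <
          ∑ _l ∈ Finset.range q, ((c : ℤ) + 1) := by
        refine Finset.sum_lt_sum (fun l _ => ?_) ⟨0, hmem, ?_⟩
        · have := hbal k hk i (i + l)
          omega
        · simp only [add_zero, ← hcdef]
          omega
      rw [← Nat.cast_sum, havg, Finset.sum_const, Finset.card_range, nsmul_eq_mul] at h
      push_cast at h
      linarith
  let f : ℕ → ℤ := fun k => q * numOnes s k - p * k
  have hfadd : ∀ i k, f (i + k) = f i + (q * numOnes (fun m => s (i + m)) k - p * k) := by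
    intro i k
    simp only [f, numOnes_add]
    push_cast
    ring
  have hfper : Function.Periodic f q := by
    intro k
    rw [hfadd, hcount]
    ring
  have hflt : ∀ i i', f i < f i' + q := by
    have aux : ∀ i i', i < q → i' < q → f i < f i' + q := by
      intro i i' hi hi'
      rcases le_total i i' with h | h
      · have h1 := hfadd i (i' - i)
        rw [Nat.add_sub_cancel' h] at h1
        have := (hnear i (i' - i) (by omega)).2
        linarith
      · have h1 := hfadd i' (i - i')
        rw [Nat.add_sub_cancel' h] at h1
        have := (hnear i' (i - i') (by omega)).1
        linarith
    intro i i'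
    rw [← hfper.map_mod_nat i, ← hfper.map_mod_nat i']
    exact aux _ _ (Nat.mod_lt _ hq) (Nat.mod_lt _ hq)
  obtain ⟨m, -, hmin⟩ := Finset.exists_min_image (Finset.range q) f ⟨0, Finset.mem_range.mpr hq⟩
  have hmin' : ∀ k, f m ≤ f k := by
    intro k
    rw [← hfper.map_mod_nat k]
    exact hmin _ (Finset.mem_range.mpr (Nat.mod_lt _ hq))
  -- the discrepancy lies in `[f m, f m + q)`, and a site is occupied where it can rise by `q - p`
  -- within this interval; the translation matches this rule with the one of the formula
  obtain ⟨c, z, hcz⟩ := exists_mul_modEq hc (f m + p - 1)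
  refine ⟨c, fun k => ?_⟩
  have hstep : f (k + 1) = f k + q * (s k : ℕ) - p := by
    simp only [f, numOnes_succ]
    push_cast
    ring
  have g0 := hmin' k
  have g1 := hflt k m
  have g0' := hmin' (k + 1)
  have g1' := hflt (k + 1) m
  have e : (p : ℤ) * (k + c) = (p - 1 - (f k - f m)) + q * (numOnes s k + z) := by
    rw [mul_add, hcz]
    simp only [f]
    ring
  rw [formulaConfig_eq_iff hq hpq, e, Int.add_mul_emod_self_left,
    ← emod_lt_iff_reflect (Int.natCast_nonneg p) hq' (by exact_mod_cast hpq),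
    Int.emod_eq_of_lt (by omega) (by omega)]
  rcases fin_two_eq (s k) with h | h
  · rw [h] at hstep ⊢
    simp at hstep ⊢
    omega
  · rw [h] at hstep ⊢
    simp at hstep ⊢
    omega

/-! ### Derivatives of the configurations given by the formula -/

/-- The occupied sites are the `k` for which `p k + t` has a residue less than `p` modulo `q`. -/
def codingConfig (p q t : ℤ) : Config := fun k => if (p * k + t) % q < p then 1 else 0

theorem codingConfig_eq_one_iff (p q t k : ℤ) :
    codingConfig p q t k = 1 ↔ (p * k + t) % q < p := by
  unfold codingConfig
  split_ifs with h <;> simp [h]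

/-- Up to a shift of the index, the `i`-th occupied site of `codingConfig p q t` is
`⌈(q i - t) / p⌉`, so the distances are
governed by the residues modulo `p`: one step of Euclid's algorithm. -/
theorem isDerivative_codingConfig {p q : ℤ} (hp : 0 < p) (hpq : p < q) (t : ℤ) :
    ∃ t', IsDerivative (codingConfig p q t) (codingConfig (p - q % p) p t') := by
  have hq : 0 < q := hp.trans hpq
  -- the shift `i₀` is chosen such that the site with index 0 is the first nonnegative one
  set i₀ : ℤ := -((p - 1 - t) / q) with hi₀
  have hi1 := Int.mul_ediv_add_emod (p - 1 - t) q
  have hi2 := Int.emod_nonneg (p - 1 - t) hq.ne'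
  have hi3 := Int.emod_lt_of_pos (p - 1 - t) hq
  have hi4 : q * i₀ = (p - 1 - t) % q - (p - 1 - t) := by
    rw [hi₀, mul_neg]; linarith
  let y : ℤ → ℤ := fun i => t - q * (i + i₀)
  let x : ℤ → ℤ := fun i => -(y i / p)
  have hxy : ∀ i, p * x i = y i % p - y i := by
    intro i
    have := Int.mul_ediv_add_emod (y i) p
    simp only [x, mul_neg]
    linarith
  have hr0 := Int.emod_nonneg q hp.ne'
  have hr1 := Int.emod_lt_of_pos q hp
  have hql := Int.mul_ediv_add_emod q p
  have hl1 : 1 ≤ q / p := by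
    rw [Int.le_ediv_iff_mul_le hp]; linarith
  have hdiff : ∀ i, (y i % p < p - q % p ∧ x i - x (i - 1) = q / p) ∨
      (p - q % p ≤ y i % p ∧ x i - x (i - 1) = q / p + 1) := by
    intro i
    have h1 := hxy i
    have h2 := hxy (i - 1)
    have h3 : y (i - 1) = y i + q := by simp only [y]; ring
    have m0 := Int.emod_nonneg (y i) hp.ne'
    have m1 := Int.emod_lt_of_pos (y i) hp
    have m2 := Int.emod_nonneg (y (i - 1)) hp.ne'
    have m3 := Int.emod_lt_of_pos (y (i - 1)) hp
    have h4 : p * (x i - x (i - 1) - q / p) = y i % p + q % p - y (i - 1) % p := by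
      rw [mul_sub, mul_sub, h1, h2, h3]; linarith
    set d := x i - x (i - 1) - q / p with hd
    have hd0 : -1 < d := by
      by_contra hcon
      nlinarith
    have hd2 : d < 2 := by
      by_contra hcon
      nlinarith
    have hd01 : d = 0 ∨ d = 1 := by omega
    rcases hd01 with h | h
    · left
      rw [h] at h4
      constructor
      · linarith
      · omega
    · right
      rw [h] at h4
      constructor
      · linarith
      · omega
  have hmono : StrictMono x := by
    refine strictMono_int_of_lt_succ fun i => ?_
    have := hdiff (i + 1)
    rw [add_sub_cancel_right] at this
    rcases this with h | h <;> linarith [h.2]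
  refine ⟨t - q * i₀, q / p, x, hl1, hmono, ?_, ?_, ?_, ?_⟩
  · ext k
    simp only [Set.mem_range, Set.mem_ofPred_eq, codingConfig_eq_one_iff]
    constructor
    · rintro ⟨i, rfl⟩
      have m0 := Int.emod_nonneg (y i) hp.ne'
      have m1 := Int.emod_lt_of_pos (y i) hp
      have e : p * x i + t = y i % p + q * (i + i₀) := by rw [hxy]; simp only [y]; ring
      rw [e, Int.add_mul_emod_self_left, Int.emod_eq_of_lt m0 (by linarith)]
      exact m1
    · intro h
      have m0 := Int.emod_nonneg (p * k + t) hq.ne'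
      have hk := Int.mul_ediv_add_emod (p * k + t) q
      refine ⟨(p * k + t) / q - i₀, ?_⟩
      have e : y ((p * k + t) / q - i₀) = (p * k + t) % q + p * (-k) := by
        simp only [y]; linarith
      simp only [x]
      rw [e, Int.add_mul_ediv_left _ _ hp.ne', Int.ediv_eq_zero_of_lt m0 h]
      ring
  · have h1 := hxy (-1)
    have m1 := Int.emod_lt_of_pos (y (-1)) hp
    have e : y (-1) = t - q * i₀ + q := by simp only [y]; ring
    rw [e] at h1 m1
    by_contra hcon
    nlinarith
  · have h1 := hxy 0
    have m0 := Int.emod_nonneg (y 0) hp.ne'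
    have e : y 0 = t - q * i₀ := by simp only [y]; ring
    rw [e] at h1 m0
    by_contra hcon
    have : x 0 ≤ -1 := by omega
    nlinarith
  · intro i
    have e : (p - q % p) * i + (t - q * i₀) = y i + p * (i * (1 + q / p)) := by
      simp only [y]
      linear_combination (-i) * hql
    have hone := codingConfig_eq_one_iff (p - q % p) p (t - q * i₀) i
    rw [e, Int.add_mul_emod_self_left] at hone
    rcases hdiff i with h | h
    · exact Or.inl ⟨h.2, hone.mpr h.1⟩
    · refine Or.inr ⟨h.2, (fin_two_eq _).resolve_right fun h' => ?_⟩
      have := hone.mp h'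
      linarith [h.1]

/-- Euclid's algorithm ends at `p = 0` or at `p = q = 1`, the empty and the full configuration. -/
theorem isMostHomogeneous_codingConfig (q : ℕ) : ∀ (p : ℕ) (t : ℤ), 0 < q → p ≤ q →
    Nat.Coprime p q → IsMostHomogeneous (codingConfig p q t) := by
  induction q using Nat.strong_induction_on with
  | _ q ih =>
    intro p t hq hpq hc
    rcases Nat.eq_zero_or_pos p with rfl | hp
    · have : codingConfig (0 : ℕ) q t = fun _ => 0 := by
        funext k
        refine (fin_two_eq _).resolve_right fun h => ?_
        rw [codingConfig_eq_one_iff] at h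
        have := Int.emod_nonneg ((0 : ℕ) * k + t) (show (q : ℤ) ≠ 0 by omega)
        push_cast at h this
        omega
      rw [this]
      exact IsMostHomogeneous.empty
    rcases hpq.eq_or_lt with rfl | hlt
    · have : codingConfig p p t = fun _ => 1 := by
        funext k
        rw [codingConfig_eq_one_iff]
        exact Int.emod_lt_of_pos _ (by omega)
      rw [this]
      exact IsMostHomogeneous.full
    · obtain ⟨t', ht'⟩ := isDerivative_codingConfig (p := p) (q := q) (by omega) (by omega) t
      have hr := Nat.mod_lt q hp
      have e : (p : ℤ) - (q : ℤ) % p = ((p - q % p : ℕ) : ℤ) := by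
        rw [Nat.cast_sub hr.le]; simp
      rw [e] at ht'
      refine IsMostHomogeneous.step ht' (ih p hlt (p - q % p) t' hp (Nat.sub_le _ _) ?_)
      have h1 : Nat.Coprime (q % p) p := by
        rw [Nat.Coprime, ← Nat.gcd_rec]
        exact hc
      exact (Nat.coprime_self_sub_left hr.le).mpr h1

theorem isMostHomogeneous_formulaConfig {p q : ℕ} (hq : 0 < q) (hpq : p ≤ q)
    (hc : Nat.Coprime p q) : IsMostHomogeneous (formulaConfig p q) := by
  have : formulaConfig p q = codingConfig p q 0 := by
    funext k
    symm
    rw [formulaConfig_eq_iff hq hpq, codingConfig_eq_one_iff, add_zero]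
  rw [this]
  exact isMostHomogeneous_codingConfig q p 0 hq hpq hc

/-! ### The energy density of periodic configurations -/

theorem bandShift_zero (v : ℝ) (s : ℕ → Fin 2) : bandShift v s 0 = 0 := by
  simp [bandShift, continuant]

theorem bandShift_one (v : ℝ) (s : ℕ → Fin 2) : bandShift v s 1 = 0 := by
  simp [bandShift, continuant, normSq_siteTerm]

/-- The first site of a chain contributes the strings that start there. -/
theorem bandShift_succ_sub (v : ℝ) (s : ℕ → Fin 2) (n : ℕ) :
    bandShift v s (n + 2) - bandShift v (shift s) (n + 1) =
      ∑ j ∈ Finset.range (n + 1), stringTerm v s j := by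
  induction n with
  | zero => simp [stringTerm, bandShift_zero, bandShift_one]
  | succ n ih =>
    rw [Finset.sum_range_succ, ← ih, stringTerm]
    ring

theorem abs_stringTerm_le_half_pow {v : ℝ} (hv : 4 ≤ v) (s : ℕ → Fin 2) (j : ℕ) :
    |stringTerm v s j| ≤ (1 / 2) ^ j := by
  refine (abs_stringTerm_le hv s j).trans ?_
  have h1 : 4 / v ≤ 1 := by rw [div_le_one (by linarith)]; exact hv
  have h2 : 2 / v ^ 2 ≤ 1 / 2 := by
    rw [div_le_div_iff₀ (by positivity) (by norm_num)]; nlinarith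
  calc 4 / v * (2 / v ^ 2) ^ j ≤ 1 * (1 / 2) ^ j := by gcongr
    _ = _ := one_mul _

theorem abs_siteShift_sub_le {v : ℝ} (hv : 4 ≤ v) (s : ℕ → Fin 2) (n : ℕ) :
    |∑ j ∈ Finset.range n, stringTerm v s j - siteShift v s| ≤ 2 * (1 / 2) ^ n := by
  have h : siteShift v s - ∑ j ∈ Finset.range n, stringTerm v s j =
      ∑' j, stringTerm v s (j + n) := by
    rw [siteShift, ← (summable_stringTerm hv s).sum_add_tsum_nat_add n]
    ring
  rw [abs_sub_comm, h, ← Real.norm_eq_abs]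
  have hg : HasSum (fun j : ℕ => (1 / 2 : ℝ) ^ n * (1 / 2) ^ j) ((1 / 2) ^ n * 2) :=
    hasSum_geometric_two.mul_left _
  rw [mul_comm]
  refine tsum_of_norm_bounded hg fun j => ?_
  rw [Real.norm_eq_abs, ← pow_add, add_comm n]
  exact abs_stringTerm_le_half_pow hv s _

theorem abs_bandShift_succ_sub_le {v : ℝ} (hv : 4 ≤ v) (s : ℕ → Fin 2) (n : ℕ) :
    |bandShift v s (n + 1) - bandShift v (shift s) n - siteShift v s| ≤ 2 * (1 / 2) ^ n := by
  rcases n with _ | n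
  · have := abs_siteShift_sub_le hv s 0
    simpa [bandShift_zero, bandShift_one] using this
  · rw [bandShift_succ_sub]
    exact abs_siteShift_sub_le hv s (n + 1)

/-- Up to a boundary term the band shift is the sum of the shifts of the sites. -/
theorem abs_bandShift_sub_le {v : ℝ} (hv : 4 ≤ v) (s : ℕ → Fin 2) (n : ℕ) :
    |bandShift v s n - ∑ i ∈ Finset.range n, siteShift v fun k => s (i + k)| ≤
      4 - 4 * (1 / 2) ^ n := by
  induction n generalizing s with
  | zero => simp [bandShift_zero]
  | succ n ih =>
    have h1 := ih (shift s)
    have h2 := abs_bandShift_succ_sub_le hv s n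
    rw [Finset.sum_range_succ']
    have e : ∀ i, (fun k => shift s (i + k)) = fun k => s (i + 1 + k) := by
      intro i; funext k; simp only [shift]; congr 1; ring
    simp only [e] at h1
    simp only [zero_add]
    rw [pow_succ]
    rw [abs_le] at h1 h2 ⊢
    constructor <;> linarith [h1.1, h1.2, h2.1, h2.2]

/-- The sum of a periodic function over a period does not depend on the starting point. -/
theorem sum_add_int_eq (f : ℤ → ℝ) {L : ℕ} (hf : ∀ x, f (x + L) = f x) (a : ℤ) :
    ∑ i ∈ Finset.range L, f (a + i) = ∑ i ∈ Finset.range L, f i := by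
  have step : ∀ a : ℤ,
      ∑ i ∈ Finset.range L, f (a + 1 + i) = ∑ i ∈ Finset.range L, f (a + i) := by
    intro a
    have h1 := Finset.sum_range_succ (fun i : ℕ => f (a + i)) L
    have h2 := Finset.sum_range_succ' (fun i : ℕ => f (a + i)) L
    rw [h1] at h2
    simp only [hf, Nat.cast_zero, add_zero, Nat.cast_add, Nat.cast_one] at h2
    have e : ∀ i : ℕ, f (a + 1 + i) = f (a + (i + 1)) := fun i => by congr 1; ring
    simp only [e]
    linarith
  induction a using Int.induction_on with
  | zero => simp
  | succ i ih => rw [step, ih]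
  | pred i ih => rw [← ih, ← step (-(i : ℤ) - 1), sub_add_cancel]

theorem sum_range_mul_eq (f : ℤ → ℝ) {L : ℕ} (hf : ∀ x, f (x + L) = f x) (a : ℤ) (m : ℕ) :
    ∑ i ∈ Finset.range (m * L), f (a + i) = m * ∑ i ∈ Finset.range L, f i := by
  induction m with
  | zero => simp
  | succ m ih =>
    rw [Nat.succ_mul, Finset.sum_range_add, ih]
    have := sum_add_int_eq f hf (a + (m * L : ℕ))
    simp only [Nat.cast_add, ← add_assoc] at this ⊢
    rw [this]
    push_cast
    ring

theorem cast_numOnes_streamAt (ω : Config) (a : ℤ) (n : ℕ) :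
    (numOnes (streamAt ω a) n : ℝ) = ∑ i ∈ Finset.range n, ((ω (a + i) : ℕ) : ℝ) := by
  simp only [numOnes, streamAt, Nat.cast_sum]

theorem numOnes_streamAt_mul {ω : Config} {L : ℕ} (hper : ∀ x, ω (x + L) = ω x) (a : ℤ) (m : ℕ) :
    numOnes (streamAt ω a) (m * L) = m * numOnes (streamAt ω 0) L := by
  have h := sum_range_mul_eq (fun x => ((ω x : ℕ) : ℝ)) (fun x => by rw [hper]) a m
  rw [← cast_numOnes_streamAt] at h
  have h0 := cast_numOnes_streamAt ω 0 L
  simp only [zero_add] at h0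
  rw [← h0] at h
  exact_mod_cast h

theorem particlesPerSite_box (ω : Config) (a : ℤ) (n : ℕ) :
    particlesPerSite ω (Finset.Icc a (a + n - 1)) = numOnes (streamAt ω a) n / n := by
  have hc : (Finset.Icc a (a + n - 1)).card = n := by simp
  rw [particlesPerSite, hc, cast_numOnes_streamAt]
  congr 1
  refine (Finset.sum_bij (fun (i : ℕ) _ => a + (i : ℤ)) ?_ ?_ ?_ fun _ _ => rfl).symm
  · intro i hi
    rw [Finset.mem_range] at hi
    rw [Finset.mem_Icc]
    omega
  · intro i _ j _ h
    omega
  · intro x hx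
    rw [Finset.mem_Icc] at hx
    exact ⟨(x - a).toNat, Finset.mem_range.mpr (by omega), by omega⟩

theorem tendsto_particlesPerSite_of_period {ω : Config} {L : ℕ} (hL : 0 < L)
    (hper : ∀ x, ω (x + L) = ω x) :
    Tendsto (fun ab => particlesPerSite ω (box ab)) boxes
      (𝓝 ((numOnes (streamAt ω 0) L : ℝ) / L)) := by
  have hL' : (0 : ℝ) < L := by exact_mod_cast hL
  refine tendsto_boxes_of_uniform fun ε hε => ?_
  obtain ⟨m, hm⟩ := exists_nat_gt ((L : ℝ) / ε)
  refine ⟨m + 1, fun a n hn => ?_⟩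
  have hn0 : (0 : ℝ) < n := by
    have : 0 < n := by omega
    exact_mod_cast this
  have hmn : (m : ℝ) ≤ n := by
    have : m ≤ n := by omega
    exact_mod_cast this
  rw [particlesPerSite_box]
  set N := numOnes (streamAt ω 0) L with hN
  have hNL : (N : ℝ) ≤ L := by exact_mod_cast numOnes_le _ _
  have hd : L * (n / L) + n % L = n := Nat.div_add_mod n L
  have hr : n % L < L := Nat.mod_lt _ hL
  set d := n / L
  set r := n % L
  have h1 : numOnes (streamAt ω a) n = d * N + numOnes (fun k => streamAt ω a (d * L + k)) r := by
    rw [hN, ← numOnes_streamAt_mul hper a, ← numOnes_add]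
    congr 1
    linarith
  have h2 := numOnes_le (fun k => streamAt ω a (d * L + k)) r
  set t := numOnes (fun k => streamAt ω a (d * L + k)) r
  have hnR : (n : ℝ) = L * d + r := by exact_mod_cast hd.symm
  have htR : (t : ℝ) ≤ r := by exact_mod_cast h2
  have hrR : (r : ℝ) ≤ L := by exact_mod_cast hr.le
  have ht0 : (0 : ℝ) ≤ t := by positivity
  have hr0 : (0 : ℝ) ≤ r := by positivity
  rw [h1]
  have e : ((d * N + t : ℕ) : ℝ) / n - N / L = (t - N / L * r) / n := by
    rw [div_sub' hn0.ne', hnR]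
    push_cast
    congr 1
    field_simp
    ring
  rw [e, abs_div, abs_of_pos hn0, div_le_iff₀ hn0]
  have hf : (N : ℝ) / L ≤ 1 := by rw [div_le_one hL']; exact hNL
  have hf0 : (0 : ℝ) ≤ N / L := by positivity
  have hb : (L : ℝ) ≤ ε * n := by
    have := (div_lt_iff₀ hε).mp (hm.trans_le hmn)
    linarith
  refine le_trans ?_ hb
  rw [abs_le]
  constructor <;> nlinarith

instance : boxes.NeBot := by unfold boxes; infer_instance

theorem particleDensity_of_period {ω : Config} {L : ℕ} (hL : 0 < L)
    (hper : ∀ x, ω (x + L) = ω x) :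
    particleDensity ω = (numOnes (streamAt ω 0) L : ℝ) / L :=
  (tendsto_particlesPerSite_of_period hL hper).limUnder_eq

theorem tendsto_energyPerSite {v : ℝ} (hv : 0 ≤ v) {ω : Config} (hω : IsPeriodic ω)
    {ρ : ℝ} (hρ : ρ ∈ Set.Icc (0 : ℝ) 1) :
    Tendsto (fun ab => energyPerSite (2 * v) ρ ω (box ab)) boxes
      (𝓝 (energyDensity (2 * v) ρ ω)) :=
  tendsto_nhds_limUnder (exists_tendsto_energyPerSite hv hω hρ)

/-- The shift per period of a configuration of period `L`. -/
noncomputable def periodShift (v : ℝ) (ω : Config) (L : ℕ) : ℝ :=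
  ∑ i ∈ Finset.range L, siteShift v (streamAt ω i)

theorem abs_bandShift_periodic_le {v : ℝ} (hv : 4 ≤ v) {ω : Config} {L : ℕ}
    (hper : ∀ x, ω (x + L) = ω x) (a : ℤ) (m : ℕ) :
    |bandShift v (streamAt ω a) (m * L) - m * periodShift v ω L| ≤ 4 := by
  have h := abs_bandShift_sub_le hv (streamAt ω a) (m * L)
  have e := sum_range_mul_eq (fun x => siteShift v (streamAt ω x))
    (fun x => by rw [streamAt_add_period hper]) a m
  simp only [streamAt_add] at e
  rw [e] at h
  exact h.trans (by linarith [show (0 : ℝ) < (1 / 2) ^ (m * L) by positivity])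

/-- The energy density can be computed along symmetric boxes made of whole periods. -/
theorem tendsto_energy_of_period {v : ℝ} (hv : 0 ≤ v) {ω : Config} {L : ℕ} (hL : 0 < L)
    (hper : ∀ x, ω (x + L) = ω x) {ρ : ℝ} (hρ : ρ ∈ Set.Icc (0 : ℝ) 1) :
    Tendsto (fun n : ℕ => lowEnergy v (streamAt ω (-(n * L : ℕ))) (2 * n * L)
        ⌊ρ * (2 * n * L : ℕ)⌋₊ / (2 * n * L : ℕ) -
        v * (⌊ρ * (2 * n * L : ℕ)⌋₊ / (2 * n * L : ℕ))) atTop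
      (𝓝 (energyDensity (2 * v) ρ ω)) := by
  have hω : IsPeriodic ω := ⟨L, by exact_mod_cast hL, hper⟩
  have hbox : Tendsto (fun n : ℕ => ((-(n * L : ℕ) : ℤ), (-(n * L : ℕ) : ℤ) + (2 * n * L : ℕ) - 1))
      atTop boxes := by
    have h1 : Tendsto (fun n : ℕ => ((n * L : ℕ) : ℤ)) atTop atTop :=
      tendsto_natCast_atTop_atTop.comp (tendsto_id.atTop_mul_const' hL)
    refine (tendsto_neg_atTop_atBot.comp h1).prodMk ?_
    refine (tendsto_atTop_add_const_right _ (-1) h1).congr fun n => ?_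
    push_cast
    ring
  refine ((tendsto_energyPerSite hv hω hρ).comp hbox).congr fun n => ?_
  exact energyPerSite_box v hρ ω _ _

theorem tendsto_floor_period {L : ℕ} (hL : 0 < L) {ρ : ℝ} (hρ : 0 ≤ ρ) :
    Tendsto (fun n : ℕ => (⌊ρ * (2 * n * L : ℕ)⌋₊ : ℝ) / (2 * n * L : ℕ)) atTop (𝓝 ρ) := by
  rw [tendsto_iff_norm_sub_tendsto_zero]
  have h1 : Tendsto (fun n : ℕ => 1 / ((2 * n * L : ℕ) : ℝ)) atTop (𝓝 0) := by
    refine tendsto_const_nhds.div_atTop (tendsto_natCast_atTop_atTop.comp ?_)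
    exact tendsto_atTop_mono (fun n => by simp only [id]; nlinarith) tendsto_id
  refine squeeze_zero' (Eventually.of_forall fun _ => norm_nonneg _) ?_ h1
  filter_upwards [eventually_gt_atTop 0] with n hn
  exact floor_div_near hρ (by positivity)

theorem tendsto_bandShift_period {v : ℝ} (hv : 4 ≤ v) {ω : Config} {L : ℕ} (hL : 0 < L)
    (hper : ∀ x, ω (x + L) = ω x) :
    Tendsto (fun n : ℕ => bandShift v (streamAt ω (-(n * L : ℕ))) (2 * n * L) / (2 * n * L : ℕ))
      atTop (𝓝 (periodShift v ω L / L)) := by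
  have hL' : (0 : ℝ) < L := by exact_mod_cast hL
  rw [tendsto_iff_norm_sub_tendsto_zero]
  have h1 : Tendsto (fun n : ℕ => 4 / ((2 * n * L : ℕ) : ℝ)) atTop (𝓝 0) := by
    refine tendsto_const_nhds.div_atTop (tendsto_natCast_atTop_atTop.comp ?_)
    exact tendsto_atTop_mono (fun n => by simp only [id]; nlinarith) tendsto_id
  refine squeeze_zero' (Eventually.of_forall fun _ => norm_nonneg _) ?_ h1
  filter_upwards [eventually_gt_atTop 0] with n hn
  have hn' : (0 : ℝ) < n := by exact_mod_cast hn
  have h := abs_bandShift_periodic_le hv hper (-(n * L : ℕ)) (2 * n)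
  have e : bandShift v (streamAt ω (-(n * L : ℕ))) (2 * n * L) / (2 * n * L : ℕ) -
      periodShift v ω L / L = (bandShift v (streamAt ω (-(n * L : ℕ))) (2 * n * L) -
        (2 * n : ℕ) * periodShift v ω L) / (2 * n * L : ℕ) := by
    push_cast
    field_simp
  have hp : (0 : ℝ) < (2 * n * L : ℕ) := by exact_mod_cast (by positivity : 0 < 2 * n * L)
  rw [e, norm_div, Real.norm_eq_abs, Real.norm_eq_abs, abs_of_pos hp]
  gcongr

/-- Lower bound on the energy density: at best all the negative levels are filled. -/
theorem le_energyDensity {v : ℝ} (hv : 4 ≤ v) {ω : Config} {L : ℕ} (hL : 0 < L)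
    (hper : ∀ x, ω (x + L) = ω x) {ρ : ℝ} (hρ : ρ ∈ Set.Icc (0 : ℝ) 1) :
    -v * ρ - v * particleDensity ω - periodShift v ω L / L / 2 ≤ energyDensity (2 * v) ρ ω := by
  have hL' : (0 : ℝ) < L := by exact_mod_cast hL
  have h1 := tendsto_energy_of_period (by linarith : (0 : ℝ) ≤ v) hL hper hρ
  have h2 := (((tendsto_floor_period hL hρ.1).const_mul (-v)).sub
    (tendsto_const_nhds (x := v * particleDensity ω))).sub
    ((tendsto_bandShift_period hv hL hper).div_const 2)
  refine le_of_tendsto_of_tendsto h2 h1 ?_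
  filter_upwards [eventually_gt_atTop 0] with n hn
  have hn' : (0 : ℝ) < n := by exact_mod_cast hn
  have hp : (0 : ℝ) < (2 * n * L : ℕ) := by exact_mod_cast (by positivity : 0 < 2 * n * L)
  have h3 := le_lowEnergy (by linarith : 2 < v) (streamAt ω (-(n * L : ℕ)))
    (floor_mul_le hρ (2 * n * L))
  rw [numOnes_streamAt_mul hper] at h3
  have h4 := div_le_div_of_nonneg_right h3 hp.le
  have e : particleDensity ω =
      ((2 * n * numOnes (streamAt ω 0) L : ℕ) : ℝ) / (2 * n * L : ℕ) := by
    rw [particleDensity_of_period hL hper]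
    push_cast
    field_simp
  rw [e]
  rw [sub_div, mul_div_assoc] at h4
  have e2 : bandShift v (streamAt ω (-(n * L : ℕ))) (2 * n * L) / 2 / (2 * n * L : ℕ) =
    bandShift v (streamAt ω (-(n * L : ℕ))) (2 * n * L) / (2 * n * L : ℕ) / 2 := div_right_comm _ _ _
  rw [e2] at h4
  linarith

/-- At half filling of the two bands, all the negative levels are filled. -/
theorem energyDensity_particleDensity {v : ℝ} (hv : 4 ≤ v) {ω : Config} {L : ℕ} (hL : 0 < L)
    (hper : ∀ x, ω (x + L) = ω x) :
    energyDensity (2 * v) (particleDensity ω) ω =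
      -(2 * v) * particleDensity ω - periodShift v ω L / L / 2 := by
  have hL' : (0 : ℝ) < L := by exact_mod_cast hL
  have hρe := particleDensity_of_period hL hper
  have hρ : particleDensity ω ∈ Set.Icc (0 : ℝ) 1 := by
    rw [hρe]
    refine ⟨by positivity, ?_⟩
    rw [div_le_one hL']
    exact_mod_cast numOnes_le _ _
  have h1 := tendsto_energy_of_period (by linarith : (0 : ℝ) ≤ v) hL hper hρ
  have h2 := ((tendsto_const_nhds (x := -(2 * v) * particleDensity ω))).sub
    ((tendsto_bandShift_period hv hL hper).div_const 2)
  refine tendsto_nhds_unique h1 (h2.congr' ?_)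
  filter_upwards [eventually_gt_atTop 0] with n hn
  have hn' : (0 : ℝ) < n := by exact_mod_cast hn
  have hp : (0 : ℝ) < (2 * n * L : ℕ) := by exact_mod_cast (by positivity : 0 < 2 * n * L)
  have hm : particleDensity ω * (2 * n * L : ℕ) =
      ((2 * n * numOnes (streamAt ω 0) L : ℕ) : ℝ) := by
    rw [hρe]
    push_cast
    field_simp
  have hfl : ⌊particleDensity ω * (2 * n * L : ℕ)⌋₊ = 2 * n * numOnes (streamAt ω 0) L := by
    rw [hm, Nat.floor_natCast]
  have h3 := lowEnergy_numOnes (by linarith : 2 < v) (streamAt ω (-(n * L : ℕ))) (2 * n * L)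
  rw [numOnes_streamAt_mul hper] at h3
  have e : ((2 * n * numOnes (streamAt ω 0) L : ℕ) : ℝ) / (2 * n * L : ℕ) =
      particleDensity ω := by
    rw [← hm]; field_simp
  rw [hfl, h3, sub_div, mul_div_assoc, e]
  rw [div_right_comm _ (2 : ℝ)]
  ring

theorem streamAt_translate {η ω : Config} {c : ℤ} (h : ∀ k, η k = ω (k + c)) (a : ℤ) :
    streamAt η a = streamAt ω (a + c) := by
  funext k
  simp only [streamAt, h]
  congr 1
  ring

theorem periodShift_translate (v : ℝ) {η ω : Config} {c : ℤ} (h : ∀ k, η k = ω (k + c)) {L : ℕ}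
    (hper : ∀ x, ω (x + L) = ω x) : periodShift v η L = periodShift v ω L := by
  have := sum_add_int_eq (fun x => siteShift v (streamAt ω x))
    (fun x => by rw [streamAt_add_period hper]) c
  unfold periodShift
  rw [← this]
  refine Finset.sum_congr rfl fun i _ => ?_
  rw [streamAt_translate h, add_comm]

/-! ### Optimality of the configuration given by the formula -/

section Optimal

variable {V : Type*} [Fintype V] {π : Equiv.Perm V} {σ : V → Fin 2} {p q : ℕ} {v : ℝ}

theorem sum_numOnes_cycleStream (π : Equiv.Perm V) (σ : V → Fin 2) (n : ℕ) :
    ∑ w, numOnes (cycleStream π σ w) n = n * ∑ w, (σ w : ℕ) := by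
  simp only [numOnes, cycleStream]
  rw [Finset.sum_comm]
  rw [Finset.sum_congr rfl fun k _ => Equiv.sum_comp (π ^ k) fun w => (σ w : ℕ)]
  rw [Finset.sum_const, Finset.card_range, smul_eq_mul]

/-- A system of cycles that all carry the configuration given by the formula. -/
theorem totalShift_eq_of_formulaConfig
    (h : ∀ w, ∃ c : ℤ, ∀ k : ℕ, cycleStream π σ w k = formulaConfig p q (k + c)) :
    q * totalShift v π σ = Fintype.card V * periodShift v (formulaConfig p q) q := by
  have h1 : ∀ i : ℕ, totalShift v π σ = ∑ w, siteShift v fun k => cycleStream π σ w (i + k) := by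
    intro i
    simp only [cycleStream_add]
    exact (Equiv.sum_comp (π ^ i) fun w => siteShift v (cycleStream π σ w)).symm
  have h2 : q * totalShift v π σ =
      ∑ w, ∑ i ∈ Finset.range q, siteShift v fun k => cycleStream π σ w (i + k) := by
    rw [Finset.sum_comm, ← Finset.sum_congr rfl fun i _ => h1 i, Finset.sum_const,
      Finset.card_range, nsmul_eq_mul]
  have h3 : ∀ w, ∑ i ∈ Finset.range q, siteShift v (fun k => cycleStream π σ w (i + k)) =
      periodShift v (formulaConfig p q) q := by
    intro w
    obtain ⟨c, hc⟩ := h w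
    rw [periodShift, ← sum_add_int_eq (fun x => siteShift v (streamAt (formulaConfig p q) x))
      (fun x => by rw [streamAt_add_period (formulaConfig_add_period p q)]) c]
    refine Finset.sum_congr rfl fun i _ => ?_
    congr 1
    funext k
    rw [hc, streamAt]
    congr 1
    push_cast
    ring
  rw [h2, Finset.sum_congr rfl fun w _ => h3 w, Finset.sum_const, Finset.card_univ, nsmul_eq_mul]

/-- Numbers within one of each other whose mean is the integer `p` are all equal to `p`. -/
theorem eq_of_forall_le_succ {f : V → ℕ} (hsum : ∑ w, f w = p * Fintype.card V)
    (hf : ∀ w w', f w' ≤ f w + 1) (w : V) : f w = p := by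
  have hc : ∑ _w : V, p = p * Fintype.card V := by
    rw [Finset.sum_const, Finset.card_univ, smul_eq_mul, mul_comm]
  rw [← hc] at hsum
  rcases lt_trichotomy (f w) p with h | h | h
  · refine absurd hsum (Finset.sum_lt_sum (fun w' _ => ?_) ⟨w, Finset.mem_univ w, h⟩).ne
    have := hf w w'
    omega
  · exact h
  · refine absurd hsum (Finset.sum_lt_sum (fun w' _ => ?_) ⟨w, Finset.mem_univ w, h⟩).ne'
    have := hf w' w
    omega

variable [DecidableEq V]

/-- Every cycle of an optimal system carries the configuration given by the formula. -/
theorem exists_eq_formulaConfig_of_maximal (hq : 0 < q) (hpq : p ≤ q) (hc : Nat.Coprime p q)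
    (hv : 4 ≤ v) (hqv : 176 * 8 ^ q < v ^ 2) (hN : q * ∑ w, (σ w : ℕ) = p * Fintype.card V)
    (hmax : ∀ π' : Equiv.Perm V, totalShift v π' σ ≤ totalShift v π σ) (w : V) :
    ∃ c : ℤ, ∀ k : ℕ, cycleStream π σ w k = formulaConfig p q (k + c) := by
  have hbal := numOnes_le_of_forall_totalShift_le hv hqv hmax
  refine exists_eq_formulaConfig hq hpq hc (fun i => ?_) fun k hk i i' => ?_
  · rw [cycleStream_add]
    refine eq_of_forall_le_succ (f := fun w => numOnes (cycleStream π σ w) q) ?_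
      (fun w w' => hbal q le_rfl w w') _
    rw [sum_numOnes_cycleStream, hN]
  · rw [cycleStream_add, cycleStream_add]
    exact hbal k hk _ _

/-- Among all systems of cycles of density `p / q`, those made of the configuration given by the
formula have the largest shift. -/
theorem totalShift_le (hq : 0 < q) (hpq : p ≤ q) (hc : Nat.Coprime p q)
    (hv : 4 ≤ v) (hqv : 176 * 8 ^ q < v ^ 2) (hN : q * ∑ w, (σ w : ℕ) = p * Fintype.card V)
    (π : Equiv.Perm V) :
    q * totalShift v π σ ≤ Fintype.card V * periodShift v (formulaConfig p q) q ∧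
      (q * totalShift v π σ = Fintype.card V * periodShift v (formulaConfig p q) q →
        ∀ w, ∃ c : ℤ, ∀ k : ℕ, cycleStream π σ w k = formulaConfig p q (k + c)) := by
  obtain ⟨π₀, hπ₀⟩ := Finite.exists_max fun π : Equiv.Perm V => totalShift v π σ
  have h0 := totalShift_eq_of_formulaConfig (v := v)
    (exists_eq_formulaConfig_of_maximal hq hpq hc hv hqv hN hπ₀)
  have hq' : (0 : ℝ) < q := by exact_mod_cast hq
  rw [← h0]
  refine ⟨mul_le_mul_of_nonneg_left (hπ₀ π) hq'.le, fun h => ?_⟩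
  refine exists_eq_formulaConfig_of_maximal hq hpq hc hv hqv hN fun π' => ?_
  rw [mul_left_cancel₀ hq'.ne' h]
  exact hπ₀ π'

end Optimal

theorem apply_emod_period {ω : Config} {L : ℕ} (hper : ∀ x, ω (x + L) = ω x) (x : ℤ) :
    ω (x % L) = ω x := by
  have hmul : ∀ (z : ℤ) x, ω (x + L * z) = ω x := by
    intro z
    induction z using Int.induction_on with
    | zero => simp
    | succ i ih => intro x; rw [← ih x, ← hper (x + L * i)]; congr 1; ring
    | pred i ih => intro x; rw [← ih x, ← hper (x + L * (-(i : ℤ) - 1))]; congr 1; ring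
  rw [← hmul (x / L), Int.emod_add_mul_ediv]

theorem sum_zmod_val {M : Type*} [AddCommMonoid M] (L : ℕ) [NeZero L] (f : ℕ → M) :
    ∑ x : ZMod L, f x.val = ∑ k ∈ Finset.range L, f k := by
  refine Finset.sum_bij (fun x _ => x.val) (fun x _ => Finset.mem_range.mpr x.val_lt)
    (fun x _ y _ h => ZMod.val_injective L h) (fun k hk => ?_) fun _ _ => rfl
  exact ⟨(k : ZMod L), Finset.mem_univ _, ZMod.val_cast_of_lt (Finset.mem_range.mp hk)⟩

section Families

variable {ι : Type*} [Fintype ι] {ω : ι → Config} {L : ι → ℕ} {p q : ℕ} {v : ℝ}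

/-- Finitely many periodic configurations, each wound up on a number of circles of the length of
its period. -/
theorem sum_periodShift_le (hL : ∀ i, 0 < L i) (hper : ∀ i x, ω i (x + L i) = ω i x)
    (hq : 0 < q) (hpq : p ≤ q) (hc : Nat.Coprime p q) (hv : 4 ≤ v) (hqv : 176 * 8 ^ q < v ^ 2)
    (a : ι → ℕ) (hN : q * ∑ i, a i * numOnes (streamAt (ω i) 0) (L i) = p * ∑ i, a i * L i) :
    q * ∑ i, a i * periodShift v (ω i) (L i) ≤
        (∑ i, a i * L i : ℕ) * periodShift v (formulaConfig p q) q ∧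
      (q * ∑ i, a i * periodShift v (ω i) (L i) =
        (∑ i, a i * L i : ℕ) * periodShift v (formulaConfig p q) q →
          ∀ i, 0 < a i → ω i ∈ orbit (formulaConfig p q)) := by
  classical
  have : ∀ i, NeZero (L i) := fun i => ⟨(hL i).ne'⟩
  -- `a i` copies of a circle of `L i` sites, and `π` moves every site to its right neighbour
  let V := Σ i, Fin (a i) × ZMod (L i)
  let π : Equiv.Perm V :=
    Equiv.sigmaCongrRight fun i => (Equiv.refl (Fin (a i))).prodCongr (Equiv.addRight 1)
  let σ : V → Fin 2 := fun w => ω w.1 (w.2.2.val : ℤ)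
  have hπ : ∀ w : V, π w = ⟨w.1, w.2.1, w.2.2 + 1⟩ := fun _ => rfl
  have hpow : ∀ (k : ℕ) (w : V), (π ^ k) w = ⟨w.1, w.2.1, w.2.2 + k⟩ := by
    intro k
    induction k with
    | zero => intro w; simp
    | succ k ih =>
      intro w
      rw [pow_succ', Equiv.Perm.mul_apply, ih, hπ, Nat.cast_succ, ← add_assoc]
  have hstream : ∀ w : V, cycleStream π σ w = streamAt (ω w.1) (w.2.2.val : ℤ) := by
    intro w
    funext k
    rw [cycleStream, hpow, streamAt]
    simp only [σ]
    rw [← apply_emod_period (hper w.1) ((w.2.2.val : ℤ) + k), ZMod.val_add, ZMod.val_natCast]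
    congr 1
    push_cast
    simp
  have hcard : Fintype.card V = ∑ i, a i * L i := by
    simp [V, Fintype.card_sigma, ZMod.card]
  have hsumσ : ∑ w, (σ w : ℕ) = ∑ i, a i * numOnes (streamAt (ω i) 0) (L i) := by
    rw [Fintype.sum_sigma]
    refine Finset.sum_congr rfl fun i _ => ?_
    rw [Fintype.sum_prod_type]
    change ∑ _x : Fin (a i), ∑ y : ZMod (L i), (ω i (y.val : ℤ) : ℕ) = _
    rw [Finset.sum_const, Finset.card_univ, Fintype.card_fin, smul_eq_mul]
    congr 1
    rw [sum_zmod_val (L i) fun k => (ω i (k : ℤ) : ℕ)]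
    simp [numOnes, streamAt]
  have htot : totalShift v π σ = ∑ i, a i * periodShift v (ω i) (L i) := by
    simp only [totalShift, hstream]
    rw [Fintype.sum_sigma]
    refine Finset.sum_congr rfl fun i _ => ?_
    rw [Fintype.sum_prod_type]
    change ∑ _x : Fin (a i), ∑ y : ZMod (L i), siteShift v (streamAt (ω i) (y.val : ℤ)) = _
    rw [Finset.sum_const, Finset.card_univ, Fintype.card_fin, nsmul_eq_mul]
    congr 1
    exact sum_zmod_val (L i) fun k => siteShift v (streamAt (ω i) (k : ℤ))
  rw [← hcard, ← hsumσ] at hN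
  have h := totalShift_le hq hpq hc hv hqv hN π
  rw [htot, hcard] at h
  refine ⟨h.1, fun he i hi => ?_⟩
  obtain ⟨c, hcc⟩ := h.2 he ⟨i, ⟨0, hi⟩, 0⟩
  rw [hstream] at hcc
  rw [mem_orbit_iff hq hpq hc]
  refine ⟨c, fun k => ?_⟩
  -- move `k` to the right by a common period
  have h1 := apply_emod_period (L := L i * q) (ω := ω i) (fun x => by
    have := apply_emod_period (hper i) (x + (L i * q : ℕ))
    rw [← this, ← apply_emod_period (hper i) x]
    push_cast
    rw [Int.add_mul_emod_self_left]) k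
  have h2 := apply_emod_period (L := L i * q) (ω := fun x => formulaConfig p q (x + c)) (fun x => by
    have := apply_emod_period (formulaConfig_add_period p q) (x + (L i * q : ℕ) + c)
    rw [← this, ← apply_emod_period (formulaConfig_add_period p q) (x + c)]
    have e : x + ((L i * q : ℕ) : ℤ) + c = x + c + L i * q := by push_cast; ring
    rw [e, Int.add_mul_emod_self_right]) k
  rw [← h1]
  rw [← h2]
  have hpos : (0 : ℤ) < (L i * q : ℕ) := by exact_mod_cast Nat.mul_pos (hL i) hq
  obtain ⟨m, hm⟩ := Int.eq_ofNat_of_zero_le (Int.emod_nonneg k hpos.ne')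
  have h3 := hcc m
  simp only [streamAt, ZMod.val_zero, Nat.cast_zero, zero_add] at h3
  rw [hm]
  exact h3

end Families

/-- From integral to real weights: if all integral solutions of `∑ a d = 0` have a nonpositive
gain, then so do the real ones. -/
theorem sum_mul_nonpos_of_integral {ι : Type*} [Fintype ι] {d : ι → ℤ} {g : ι → ℝ}
    {Good : ι → Prop} (hgood : ∀ i, Good i → d i = 0)
    (H : ∀ a : ι → ℕ, ∑ i, a i * d i = 0 → ∑ i, a i * g i ≤ 0 ∧
      (∑ i, a i * g i = 0 → ∀ i, 0 < a i → Good i))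
    {β : ι → ℝ} (hβ : ∀ i, 0 ≤ β i) (hd : ∑ i, β i * d i = 0) :
    ∑ i, β i * g i ≤ 0 ∧ (∑ i, β i * g i = 0 → ∀ i, 0 < β i → Good i) := by
  classical
  have hzero : ∀ i, d i = 0 → g i ≤ 0 ∧ (g i = 0 → Good i) := by
    intro i hi
    have := H (Pi.single i 1) (by simp [Pi.single_apply, hi])
    simp only [Pi.single_apply, Nat.cast_ite, Nat.cast_one, Nat.cast_zero, ite_mul, one_mul,
      zero_mul, Finset.sum_ite_eq', Finset.mem_univ, if_true] at this
    exact ⟨this.1, fun h => this.2 h i (by simp)⟩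
  -- `d j` copies of `i` and `-d i` copies of `j` balance
  have hpair : ∀ i j, d i < 0 → 0 < d j → d j * g i - d i * g j < 0 := by
    intro i j hi hj
    have hij : i ≠ j := by rintro rfl; omega
    obtain ⟨m, hm⟩ := Int.eq_ofNat_of_zero_le hj.le
    obtain ⟨n, hn⟩ := Int.eq_ofNat_of_zero_le (neg_nonneg.mpr hi.le)
    have hsum : ∀ f : ι → ℝ, ∑ k, ((Pi.single i m + Pi.single j n : ι → ℕ) k : ℝ) * f k =
        m * f i + n * f j := by
      intro f
      rw [Fintype.sum_eq_add i j hij]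
      · simp [hij, hij.symm]
      · rintro k ⟨h1, h2⟩
        simp [h1, h2]
    have hmR : (m : ℝ) = d j := by exact_mod_cast hm.symm
    have hnR : (n : ℝ) = -d i := by exact_mod_cast hn.symm
    have h0 := H (Pi.single i m + Pi.single j n) (by
      have := hsum fun k => (d k : ℝ)
      rw [hmR, hnR] at this
      have h' : ∑ k, ((Pi.single i m + Pi.single j n : ι → ℕ) k : ℝ) * (d k : ℝ) = 0 := by
        rw [this]; ring
      exact_mod_cast h')
    rw [hsum, hmR, hnR] at h0
    refine lt_of_le_of_ne (by linarith [h0.1]) fun he => ?_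
    have := hgood i (h0.2 (by linarith) i (by simp; omega))
    omega
  -- `μ` is the largest ratio `g j / d j` with `d j > 0`, or anything very negative
  obtain ⟨μ, hpos, hneg⟩ : ∃ μ : ℝ, (∀ i, 0 < d i → g i ≤ μ * d i) ∧
      ∀ i, d i < 0 → g i < μ * d i := by
    by_cases hne : (Finset.univ.filter fun j => 0 < d j).Nonempty
    · obtain ⟨j, hj, hmax⟩ := Finset.exists_max_image _ (fun j => g j / d j) hne
      have hj0 : 0 < d j := (Finset.mem_filter.mp hj).2
      have hjR : (0 : ℝ) < d j := by exact_mod_cast hj0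
      refine ⟨g j / d j, fun i hi => ?_, fun i hi => ?_⟩
      · have := hmax i (Finset.mem_filter.mpr ⟨Finset.mem_univ i, hi⟩)
        have hiR : (0 : ℝ) < d i := by exact_mod_cast hi
        rwa [div_le_iff₀ hiR] at this
      · have := hpair i j hi hj0
        rw [div_mul_eq_mul_div, lt_div_iff₀ hjR]
        linarith
    · refine ⟨-(∑ k, |g k| + 1), fun i hi => ?_, fun i hi => ?_⟩
      · exact absurd ⟨i, Finset.mem_filter.mpr ⟨Finset.mem_univ i, hi⟩⟩ hne
      · have h1 : |g i| ≤ ∑ k, |g k| :=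
          Finset.single_le_sum (fun k _ => abs_nonneg (g k)) (Finset.mem_univ i)
        have h2 : (d i : ℝ) ≤ -1 := by exact_mod_cast (by omega : d i ≤ -1)
        have h3 := le_abs_self (g i)
        have h4 := abs_nonneg (g i)
        nlinarith
  have hle : ∀ i, g i ≤ μ * d i := by
    intro i
    rcases lt_trichotomy (d i) 0 with h | h | h
    · exact (hneg i h).le
    · rw [h]; simpa using (hzero i h).1
    · exact hpos i h
  have hμ : ∑ i, β i * (μ * d i) = 0 := by
    have : ∑ i, β i * (μ * d i) = μ * ∑ i, β i * d i := by
      rw [Finset.mul_sum]; exact Finset.sum_congr rfl fun i _ => by ring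
    rw [this, hd, mul_zero]
  have hterm : ∀ i ∈ Finset.univ, β i * g i ≤ β i * (μ * d i) := fun i _ =>
    mul_le_mul_of_nonneg_left (hle i) (hβ i)
  refine ⟨(Finset.sum_le_sum hterm).trans_eq hμ, fun he i hi => ?_⟩
  have heq : ∀ i, 0 < β i → g i = μ * d i := fun i hi =>
    mul_left_cancel₀ hi.ne' ((Finset.sum_eq_sum_iff_of_le hterm).mp (he.trans hμ.symm) i
      (Finset.mem_univ i))
  have hd0 : ∀ i, 0 < β i → 0 ≤ d i := fun i hi => by
    by_contra! h
    exact (hneg i h).ne (heq i hi)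
  have hnn : ∀ i ∈ Finset.univ, 0 ≤ β i * d i := fun i _ => by
    rcases (hβ i).eq_or_lt with h | h
    · rw [← h, zero_mul]
    · exact mul_nonneg h.le (by exact_mod_cast hd0 i h)
  have hdi : d i = 0 := by
    have := (Finset.sum_eq_zero_iff_of_nonneg hnn).mp hd i (Finset.mem_univ i)
    exact_mod_cast (mul_eq_zero.mp this).resolve_left hi.ne'
  exact (hzero i hdi).2 (by rw [heq i hi, hdi, Int.cast_zero, mul_zero])

/-! ### Ground states -/

theorem IsPeriodic.exists_nat {ω : Config} (h : IsPeriodic ω) :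
    ∃ L : ℕ, 0 < L ∧ ∀ x, ω (x + L) = ω x := by
  obtain ⟨L, hL, hper⟩ := h
  lift L to ℕ using hL.le
  exact ⟨L, by exact_mod_cast hL, hper⟩

section GroundStates

variable {p q : ℕ} {v : ℝ}

theorem period_of_mem_orbit (hq : 0 < q) (hpq : p ≤ q) (hc : Nat.Coprime p q) {η : Config}
    (hη : η ∈ orbit (formulaConfig p q)) : ∀ x, η (x + q) = η x := by
  obtain ⟨c, h⟩ := (mem_orbit_iff hq hpq hc η).mp hη
  intro x
  rw [h, h, ← formulaConfig_add_period p q (x + c)]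
  congr 1
  ring

theorem particleDensity_of_mem_orbit (hq : 0 < q) (hpq : p ≤ q) (hc : Nat.Coprime p q)
    {η : Config} (hη : η ∈ orbit (formulaConfig p q)) : particleDensity η = (p : ℝ) / q := by
  rw [particleDensity_of_period hq (period_of_mem_orbit hq hpq hc hη)]
  obtain ⟨c, h⟩ := (mem_orbit_iff hq hpq hc η).mp hη
  rw [streamAt_translate h, numOnes_formulaConfig hq hpq]

/-- The ground state energy density at electron and particle densities `p / q`. -/
noncomputable def optimalEnergy (v : ℝ) (p q : ℕ) : ℝ :=
  -(2 * v) * (p / q) - periodShift v (formulaConfig p q) q / q / 2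

theorem energyDensity_of_mem_orbit (hq : 0 < q) (hpq : p ≤ q) (hc : Nat.Coprime p q) (hv : 4 ≤ v)
    {η : Config} (hη : η ∈ orbit (formulaConfig p q)) :
    energyDensity (2 * v) ((p : ℝ) / q) η = optimalEnergy v p q := by
  have h1 := energyDensity_particleDensity hv hq (period_of_mem_orbit hq hpq hc hη)
  obtain ⟨c, h⟩ := (mem_orbit_iff hq hpq hc η).mp hη
  rw [particleDensity_of_mem_orbit hq hpq hc hη,
    periodShift_translate v h (formulaConfig_add_period p q)] at h1
  exact h1

variable {ι : Type*} [Fintype ι] {ω : ι → Config} {L : ι → ℕ} {α : ι → ℝ}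

/-- Among the mixtures of density `p / q`, those made of the configuration given by the formula
have the largest shift. -/
theorem sum_weight_periodShift_le (hq : 0 < q) (hpq : p ≤ q) (hc : Nat.Coprime p q) (hv : 4 ≤ v)
    (hqv : 176 * 8 ^ q < v ^ 2) (hL : ∀ i, 0 < L i) (hper : ∀ i x, ω i (x + L i) = ω i x)
    (hα : ∀ i, 0 ≤ α i) (hα1 : ∑ i, α i = 1)
    (hd : ∑ i, α i * particleDensity (ω i) = (p : ℝ) / q) :
    ∑ i, α i * (periodShift v (ω i) (L i) / L i) ≤ periodShift v (formulaConfig p q) q / q ∧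
      (∑ i, α i * (periodShift v (ω i) (L i) / L i) = periodShift v (formulaConfig p q) q / q →
        ∀ i, 0 < α i → ω i ∈ orbit (formulaConfig p q)) := by
  have hq' : (0 : ℝ) < q := by exact_mod_cast hq
  have hL' : ∀ i, (0 : ℝ) < L i := fun i => by exact_mod_cast hL i
  set S := periodShift v (formulaConfig p q) q with hS
  have hρ : ∀ i, particleDensity (ω i) = (numOnes (streamAt (ω i) 0) (L i) : ℝ) / L i :=
    fun i => particleDensity_of_period (hL i) (hper i)
  -- the weights per site are converted to weights per period
  have key := sum_mul_nonpos_of_integral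
    (d := fun i => (q * numOnes (streamAt (ω i) 0) (L i) - p * L i : ℤ))
    (g := fun i => q * periodShift v (ω i) (L i) - L i * S)
    (Good := fun i => ω i ∈ orbit (formulaConfig p q))
    (fun i hi => by
      have h1 := particleDensity_of_mem_orbit hq hpq hc hi
      rw [hρ, div_eq_div_iff (hL' i).ne' hq'.ne'] at h1
      have h2 : (numOnes (streamAt (ω i) 0) (L i) : ℤ) * q = p * L i := by exact_mod_cast h1
      rw [mul_comm, h2, sub_self])
    (fun a ha => by
      have hN : q * ∑ i, a i * numOnes (streamAt (ω i) 0) (L i) = p * ∑ i, a i * L i := by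
        zify
        rw [Finset.mul_sum, Finset.mul_sum, ← sub_eq_zero, ← Finset.sum_sub_distrib]
        refine Eq.trans ?_ ha
        exact Finset.sum_congr rfl fun i _ => by ring
      have h := sum_periodShift_le hL hper hq hpq hc hv hqv a hN
      have e : ∑ i, (a i : ℝ) * (q * periodShift v (ω i) (L i) - L i * S) =
          q * ∑ i, a i * periodShift v (ω i) (L i) - (∑ i, a i * L i : ℕ) * S := by
        push_cast
        rw [Finset.mul_sum, Finset.sum_mul, ← Finset.sum_sub_distrib]
        exact Finset.sum_congr rfl fun i _ => by ring
      rw [e, sub_nonpos, sub_eq_zero]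
      exact h)
    (β := fun i => α i / L i) (fun i => div_nonneg (hα i) (hL' i).le)
    (by
      have e : ∀ i, α i / L i * ((q * numOnes (streamAt (ω i) 0) (L i) - p * L i : ℤ) : ℝ) =
          q * (α i * particleDensity (ω i)) - p * α i := by
        intro i
        have := (hL' i).ne'
        rw [hρ]
        push_cast
        field_simp
      rw [Finset.sum_congr rfl fun i _ => e i, Finset.sum_sub_distrib, ← Finset.mul_sum,
        ← Finset.mul_sum, hd, hα1]
      field_simp
      ring)
  have e : ∑ i, α i / L i * (q * periodShift v (ω i) (L i) - L i * S) =
      q * (∑ i, α i * (periodShift v (ω i) (L i) / L i) - S / q) := by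
    have e1 : ∀ i, α i / L i * (q * periodShift v (ω i) (L i) - L i * S) =
        q * (α i * (periodShift v (ω i) (L i) / L i)) - S * α i := by
      intro i
      have := (hL' i).ne'
      field_simp
    rw [Finset.sum_congr rfl fun i _ => e1 i, Finset.sum_sub_distrib, ← Finset.mul_sum,
      ← Finset.mul_sum, hα1]
    field_simp
  rw [e] at key
  refine ⟨?_, fun h i hi => key.2 (by rw [h, sub_self, mul_zero]) i (div_pos hi (hL' i))⟩
  have := nonpos_of_mul_nonpos_right key.1 hq'
  linarith

/-- Lower bound on the energy of a mixture, whatever the distribution of the electrons. -/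
theorem le_sum_weight_energyDensity (hv : 4 ≤ v) (hL : ∀ i, 0 < L i)
    (hper : ∀ i x, ω i (x + L i) = ω i x) (hα : ∀ i, 0 ≤ α i) {ρ : ℝ}
    (hd : ∑ i, α i * particleDensity (ω i) = ρ) {r : ι → ℝ} (hr : ∀ i, r i ∈ Set.Icc (0 : ℝ) 1)
    (hrs : ∑ i, α i * r i = ρ) :
    -(2 * v) * ρ - (∑ i, α i * (periodShift v (ω i) (L i) / L i)) / 2 ≤
      ∑ i, α i * energyDensity (2 * v) (r i) (ω i) := by
  have h := Finset.sum_le_sum fun i (_ : i ∈ Finset.univ) =>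
    mul_le_mul_of_nonneg_left (le_energyDensity hv (hL i) (hper i) (hr i)) (hα i)
  refine le_trans (le_of_eq ?_) h
  have e : ∀ i, α i * (-v * r i - v * particleDensity (ω i) -
      periodShift v (ω i) (L i) / L i / 2) = -v * (α i * r i) - v * (α i * particleDensity (ω i)) -
        α i * (periodShift v (ω i) (L i) / L i) / 2 := fun i => by ring
  rw [Finset.sum_congr rfl fun i _ => e i, Finset.sum_sub_distrib, Finset.sum_sub_distrib,
    ← Finset.mul_sum, ← Finset.mul_sum, ← Finset.sum_div, hd, hrs]
  ring

/-- A single configuration is a mixture with one component. -/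
theorem optimalEnergy_le (hq : 0 < q) (hpq : p ≤ q) (hc : Nat.Coprime p q) (hv : 4 ≤ v)
    (hqv : 176 * 8 ^ q < v ^ 2) {η : Config} (hη : IsPeriodic η)
    (hd : particleDensity η = (p : ℝ) / q) :
    optimalEnergy v p q ≤ energyDensity (2 * v) ((p : ℝ) / q) η ∧
      (energyDensity (2 * v) ((p : ℝ) / q) η = optimalEnergy v p q →
        η ∈ orbit (formulaConfig p q)) := by
  obtain ⟨M, hM, hper⟩ := hη.exists_nat
  have h1 := energyDensity_particleDensity hv hM hper
  have h2 := sum_weight_periodShift_le (ι := Unit) (ω := fun _ => η) (L := fun _ => M)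
    (α := fun _ => 1) hq hpq hc hv hqv (fun _ => hM) (fun _ => hper) (fun _ => zero_le_one)
    (by simp) (by simpa using hd)
  simp only [Finset.univ_unique, Finset.sum_singleton, one_mul] at h2
  rw [hd] at h1
  rw [h1, optimalEnergy]
  exact ⟨by linarith [h2.1], fun h => h2.2 (by linarith) () one_pos⟩

theorem mem_orbit_self (ω : Config) : ω ∈ orbit ω := ⟨0, Or.inl fun k => by rw [add_zero]⟩

theorem minEnergyDensity_eq (hq : 0 < q) (hpq : p ≤ q) (hc : Nat.Coprime p q) (hv : 4 ≤ v)
    (hqv : 176 * 8 ^ q < v ^ 2) :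
    minEnergyDensity (2 * v) ((p : ℝ) / q) ((p : ℝ) / q) = optimalEnergy v p q := by
  have hmem := mem_orbit_self (formulaConfig p q)
  refine IsLeast.csInf_eq ⟨⟨formulaConfig p q, ⟨q, by exact_mod_cast hq,
    formulaConfig_add_period p q⟩, particleDensity_of_mem_orbit hq hpq hc hmem,
    (energyDensity_of_mem_orbit hq hpq hc hv hmem).symm⟩, ?_⟩
  rintro E ⟨η, hη, hd, rfl⟩
  exact (optimalEnergy_le hq hpq hc hv hqv hη hd).1

theorem periodicGroundStates_eq (hq : 0 < q) (hpq : p ≤ q) (hc : Nat.Coprime p q) (hv : 4 ≤ v)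
    (hqv : 176 * 8 ^ q < v ^ 2) :
    periodicGroundStates (2 * v) ((p : ℝ) / q) ((p : ℝ) / q) = orbit (formulaConfig p q) := by
  ext η
  rw [periodicGroundStates, Set.mem_ofPred_eq, minEnergyDensity_eq hq hpq hc hv hqv]
  constructor
  · rintro ⟨hη, hd, he⟩
    exact (optimalEnergy_le hq hpq hc hv hqv hη hd).2 he
  · intro h
    exact ⟨⟨q, by exact_mod_cast hq, period_of_mem_orbit hq hpq hc h⟩,
      particleDensity_of_mem_orbit hq hpq hc h, energyDensity_of_mem_orbit hq hpq hc hv h⟩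

/-- The lower bound on the energy depends on the distribution of the electrons only through their
total density, and it is attained if every component is neutral. -/
theorem mem_mixedGroundStates_iff (hq : 0 < q) (hpq : p ≤ q) (hc : Nat.Coprime p q) (hv : 4 ≤ v)
    (hqv : 176 * 8 ^ q < v ^ 2) (m : Mixture) :
    m ∈ mixedGroundStates (2 * v) ((p : ℝ) / q) ((p : ℝ) / q) ↔
      ∀ i, 0 < m.weight i → m.comp i ∈ orbit (formulaConfig p q) := by
  choose L hL hper using fun i => (m.comp_periodic i).exists_nat
  have hq' : (0 : ℝ) < q := by exact_mod_cast hq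
  have hpqR : (p : ℝ) / q ∈ Set.Icc (0 : ℝ) 1 :=
    ⟨by positivity, by rw [div_le_one hq']; exact_mod_cast hpq⟩
  have hconst : ∑ i, m.weight i * ((p : ℝ) / q) = p / q := by
    rw [← Finset.sum_mul, m.weight_sum, one_mul]
  rw [mixedGroundStates, Set.mem_ofPred_eq, minEnergyDensity_eq hq hpq hc hv hqv]
  constructor
  · rintro ⟨hd, he⟩
    have hopt := sum_weight_periodShift_le hq hpq hc hv hqv hL hper m.weight_nonneg m.weight_sum hd
    -- the energy is at least what the bands allow, so a ground state has the largest shift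
    refine hopt.2 (le_antisymm hopt.1 ?_)
    have hle : -(2 * v) * (p / q) -
        (∑ i, m.weight i * (periodShift v (m.comp i) (L i) / L i)) / 2 ≤
          m.energyDensity (2 * v) (p / q) := by
      refine le_csInf ⟨_, fun _ => (p : ℝ) / q, fun _ => hpqR, hconst, rfl⟩ ?_
      rintro E ⟨r, hr, hrs, rfl⟩
      exact le_sum_weight_energyDensity hv hL hper m.weight_nonneg hd hr hrs
    rw [he, optimalEnergy] at hle
    linarith
  · intro h
    have hd : m.particleDensity = (p : ℝ) / q := by
      rw [← hconst]
      refine Finset.sum_congr rfl fun i _ => ?_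
      rcases (m.weight_nonneg i).eq_or_lt with h0 | h0
      · rw [← h0, zero_mul, zero_mul]
      · rw [particleDensity_of_mem_orbit hq hpq hc (h i h0)]
    have hopt := sum_weight_periodShift_le hq hpq hc hv hqv hL hper m.weight_nonneg m.weight_sum hd
    refine ⟨hd, IsLeast.csInf_eq ⟨⟨fun _ => (p : ℝ) / q, fun _ => hpqR, hconst, ?_⟩, ?_⟩⟩
    · rw [← one_mul (optimalEnergy v p q), ← m.weight_sum, Finset.sum_mul]
      refine Finset.sum_congr rfl fun i _ => ?_
      rcases (m.weight_nonneg i).eq_or_lt with h0 | h0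
      · rw [← h0, zero_mul, zero_mul]
      · rw [energyDensity_of_mem_orbit hq hpq hc hv (h i h0)]
    · rintro E ⟨r, hr, hrs, rfl⟩
      refine le_trans ?_ (le_sum_weight_energyDensity hv hL hper m.weight_nonneg hd hr hrs)
      rw [optimalEnergy]
      linarith [hopt.1]

end GroundStates

end FalicovKimball

theorem theorem2 :
    ∃ c : ℝ, 0 < c ∧ ∀ (p q : ℕ), 0 < q → p ≤ q → Nat.Coprime p q →
      ∀ U : ℝ, c * 4 ^ q < U →
        -- the energy per site and the density in infinite volume exist for periodic configurations
        (∀ ω : FalicovKimball.Config, FalicovKimball.IsPeriodic ω →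
          Filter.Tendsto (fun ab => FalicovKimball.particlesPerSite ω (FalicovKimball.box ab))
            FalicovKimball.boxes (nhds (FalicovKimball.particleDensity ω)) ∧
          ∀ ρe ∈ Set.Icc (0 : ℝ) 1,
            Filter.Tendsto (fun ab => FalicovKimball.energyPerSite U ρe ω (FalicovKimball.box ab))
              FalicovKimball.boxes (nhds (FalicovKimball.energyDensity U ρe ω))) ∧
        -- the configuration given by the formula is most homogeneous
        FalicovKimball.IsMostHomogeneous (FalicovKimball.formulaConfig p q) ∧
        -- it is the only periodic ground state, up to translations and reflections
        FalicovKimball.periodicGroundStates U ((p : ℝ) / q) ((p : ℝ) / q) =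
          FalicovKimball.orbit (FalicovKimball.formulaConfig p q) ∧
        -- mixtures bring in no other configuration
        ∀ m : FalicovKimball.Mixture,
          m ∈ FalicovKimball.mixedGroundStates U ((p : ℝ) / q) ((p : ℝ) / q) ↔
            ∀ i, 0 < m.weight i →
              m.comp i ∈ FalicovKimball.orbit (FalicovKimball.formulaConfig p q) := by
  refine ⟨100, by norm_num, fun p q hq hpq hc U hU => ?_⟩
  -- the levels are symmetric about zero after a shift of the energy by `v = U / 2`
  obtain ⟨v, rfl⟩ : ∃ v, U = 2 * v := ⟨U / 2, by ring⟩
  have h4 : (1 : ℝ) ≤ 4 ^ q := one_le_pow₀ (by norm_num)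
  have hv : 4 ≤ v := by linarith
  have hqv : 176 * 8 ^ q < v ^ 2 := by
    have h8 : (8 : ℝ) ^ q ≤ 4 ^ q * 4 ^ q := by
      rw [← mul_pow]
      gcongr
      norm_num
    nlinarith
  refine ⟨fun ω hω => ⟨?_, fun ρe hρ =>
    FalicovKimball.tendsto_energyPerSite (by linarith) hω hρ⟩,
    FalicovKimball.isMostHomogeneous_formulaConfig hq hpq hc,
    FalicovKimball.periodicGroundStates_eq hq hpq hc hv hqv,
    FalicovKimball.mem_mixedGroundStates_iff hq hpq hc hv hqv⟩
  obtain ⟨L, hL, hper⟩ := hω.exists_nat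
  rw [FalicovKimball.particleDensity_of_period hL hper]
  exact FalicovKimball.tendsto_particlesPerSite_of_period hL hper
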